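/- **Setting.** Fix $D\ge 2$. A *background* $\mathbf M$ is a $D$-dimensional globally hyperbolic spacetime $(M,g)$, time-oriented by a time function, possibly with further structure (orientation, spin structure, choice of bundles). A theory consists of a set $\mathcal I$ of field labels with a distinguished label $\mathbf 1$, an involution $i\mapsto i^\star$ with $\mathbf 1^\star=\mathbf 1$, parities $F(i)\in\mathbb Z/2$, and, for each background in some class, smooth complex vector bundles $V(i)$ over $M$ with $V(i^\star)=\overline{V(i)}$ and $V(\mathbf 1)=M\times\mathbb C$, together with *OPE coefficients* $C^{(i_1)\cdots(i_n)}_{(j)}(x_1,\dots,x_n;y)$: distributions in $x_1,\dots,x_n$, defined near the diagonal, valued in $V(i_1)\times\cdots\times V(i_n)\times V(j)^{\rm v}$, and depending smoothly on $y$. The *scaling degree* $\operatorname{sd}_y$ of a coefficient is the infimum of all $\delta\in\mathbb R$ such that, in every coordinate chart around $y$, $\lambda^{\delta}\,C(y'+\lambda z_1,\dots,y'+\lambda z_n;y')\to 0$ as $\lambda\to 0+$ in the sense of distributions in $z$ depending smoothly on $y'$ (i.e. with all $y'$-derivatives, uniformly as $y'\to y$). A *merger tree* $\mathbf T$ on $\{1,\dots,n\}$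 is a rooted tree with $n\ge2$ leaves, ordered from left to right, each other node having at least two branches; to each node $S$ other than the root one attaches $v_S\in\mathbb R^D$, the root has position $y$, and a node $S$ of depth $d$ has, in a chart around $y$, the position of its parent plus $\varepsilon^d v_S$. One writes $u\sim_{\mathbf T,\delta}0$ if $\varepsilon^{-\delta}u\to 0$ as $\varepsilon\to0+$ as a distribution in the $v_S$ (it suffices to test with products $\prod_S F_S(v_S)$), when $u$ is evaluated at these positions. **Axioms on the coefficients.** There are real numbers $\dim(i)$ such that: 1. $2\dim(i)$ is the supremum of $\operatorname{sd}_y C^{(i)(i^\star)}_{(\mathbf 1)}$ over all backgrounds and all $y$, the supremum is attained, and only finitely many $i$ have $\dim(i)\le\Delta$, for each $\Delta$. 2. (Identity) A factor $(\mathbf 1)$ may be omitted, i.e. $C^{\cdots(\mathbf 1)\cdots}_{(j)}=C^{\cdots\cdots}_{(j)}$; and $C^{(i)}_{(j)}(x;y)$ is smooth with $C^{(i)}_{(j)}(x;x)=\delta^{(i)}_{(j)}\,\mathrm{id}$. 3. (Scaling degree) $\operatorname{sd}_y C^{(i)(j)}_{(k)}\le\dim(i)+\dim(j)-\dim(k)$.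 4. (Asymptotic positivity) $\dim(i)\ge0$, with equality if and only if $i=\mathbf 1$; and whenever $\operatorname{sd}_y C^{(i)(i^\star)}_{(\mathbf 1)}=2\dim(i)$, then for each chart around $y$ and each $\delta>0$ there is a test section $f$ with $\lambda^{2\dim(i)-\delta}\bigl|\int C^{(i)(i^\star)}_{(\mathbf 1)}(x_1,x_2;y)f_\lambda(x_1)\bar f_\lambda(x_2)\,d\mu_1d\mu_2\bigr|\to\infty$ as $\lambda\to0+$, where $f_\lambda$ is $\lambda^{-D}$ times $f$ contracted towards $y$ by the factor $\lambda$. 5. (Associativity) For each merger tree $\mathbf T$ with $n$ leaves, each $\delta>0$ and all labels there is $\Delta\ge0$ such that $C^{(i_1)\cdots(i_n)}_{(j)}\sim_{\mathbf T,\delta}\sum\prod_{S}C^{(i_{S(1)})\cdots(i_{S(r)})}_{(i_S)}(x_{S(1)},\dots,x_{S(r)};x_S)$, where $S$ runs over the nodes that are not leaves, $S(1),\dots,S(r)$ are the branches of $S$, leaves and root carry the labels $i_1,\dots,i_n$ and $j$, and one sums over the labels with $\dim(i_S)\le\Delta$ of the other nodes. **Algebra and states.** $\mathcal A(\mathbf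 M)$ is the unital $*$-algebra generated by symbols $\phi^{(i)}(f)$, $f$ a test section of $V(i)^{\rm v}$, with $\phi^{(i)}(f)^*=\phi^{(i^\star)}(\bar f)$, and with the relations: linearity in $f$; $\phi^{(\mathbf 1)}(f)=\int f\,d\mu\cdot 1$; $\phi^{(i_1)}(f_1)\phi^{(i_2)}(f_2)=(-1)^{F(i_1)F(i_2)}\phi^{(i_2)}(f_2)\phi^{(i_1)}(f_1)$ if the supports of $f_1,f_2$ are spacelike separated; and $\sum_{i\in K}c_i\phi^{(i)}=0$ whenever $K$ is finite and $c_i$ are scalar differential operators such that $\sum_{i,j\in K}(\bar c_i\otimes c_j)C^{(i^\star)(j)}_{(k)}$ has negative scaling degree for every $k$. A *state* is a linear functional $\omega$ on $\mathcal A(\mathbf M)$ with $\omega(1)=1$ and $\omega(A^*A)\ge0$, whose $n$-point functions are distributions, whose one-point functions $\langle\phi^{(j)}(y)\rangle_\omega$ are smooth, and such that for every merger tree $\mathbf T$, every $\delta>0$ and all labels there is $\Delta\ge0$ with $\langle\phi^{(i_1)}(x_1)\cdots\phi^{(i_n)}(x_n)\rangle_\omega\sim_{\mathbf T,\delta}\sum_{\dim(j)\le\Delta}C^{(i_1)\cdots(i_n)}_{(j)}(x_1,\dots,x_n;y)\langle\phi^{(j)}(y)\rangle_\omega$.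 **Theorem 1 (normal (anti-)commutation relations).** If the axioms above hold and every background admits at least one state, then $$F(i)=F(i^\star)\qquad\text{for all } i\in\mathcal I .$$ -/

import Mathlib

open scoped Manifold ContDiff Topology ComplexOrder
open Filter MeasureTheory Set

universe u v w

noncomputable section

namespace OPEQFT

/-! ### Globally hyperbolic spacetimes -/

/-- The coordinate space `ℝ^D`. -/
abbrev Vec (D : ℕ) : Type := EuclideanSpace ℝ (Fin D)

/-- A time-oriented Lorentzian manifold of dimension `D` (signature `-+⋯+`). The time orientation is
given by a smooth time function `T`, whose differential does not vanish on causal vectors. -/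
structure LorentzManifold (D : ℕ) where
  M : Type u
  [top : TopologicalSpace M]
  [t2 : T2Space M]
  [sc : SecondCountableTopology M]
  [charted : ChartedSpace (Vec D) M]
  [mfd : IsManifold (𝓡 D) ∞ M]
  g : ∀ x : M, TangentSpace (𝓡 D) x →L[ℝ] TangentSpace (𝓡 D) x →L[ℝ] ℝ
  g_symm : ∀ x v w, g x v w = g x w v
  g_lorentz : ∀ x, ∃ t, g x t t < 0 ∧ ∀ v, g x t v = 0 → v ≠ 0 → 0 < g x v v
  g_smooth : ContMDiff (𝓡 D) ((𝓡 D).prod 𝓘(ℝ, Vec D →L[ℝ] Vec D →L[ℝ] ℝ)) ∞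
    (fun x ↦ Bundle.TotalSpace.mk' (Vec D →L[ℝ] Vec D →L[ℝ] ℝ) x (g x))
  T : M → ℝ
  T_smooth : ContMDiff (𝓡 D) 𝓘(ℝ, ℝ) ∞ T
  T_time : ∀ x (v : TangentSpace (𝓡 D) x), v ≠ 0 → g x v v ≤ 0 →
    (mfderiv (𝓡 D) 𝓘(ℝ, ℝ) T x v : ℝ) ≠ 0

attribute [instance] LorentzManifold.top LorentzManifold.t2 LorentzManifold.sc
  LorentzManifold.charted LorentzManifold.mfd

namespace LorentzManifold

variable {D : ℕ} (S : LorentzManifold.{u} D)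

/-- A `C¹` future directed causal curve segment from `p` to `q`. -/
def CausalSegment (p q : S.M) : Prop :=
  ∃ γ : ℝ → S.M, ContMDiffOn 𝓘(ℝ, ℝ) (𝓡 D) 1 γ (Icc 0 1) ∧ γ 0 = p ∧ γ 1 = q ∧
    ∀ t ∈ Icc (0 : ℝ) 1,
      S.g (γ t) (mfderivWithin 𝓘(ℝ, ℝ) (𝓡 D) γ (Icc 0 1) t (1 : ℝ))
        (mfderivWithin 𝓘(ℝ, ℝ) (𝓡 D) γ (Icc 0 1) t (1 : ℝ)) ≤ 0 ∧
      (0 : ℝ) < mfderiv (𝓡 D) 𝓘(ℝ, ℝ) S.T (γ t)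
        (mfderivWithin 𝓘(ℝ, ℝ) (𝓡 D) γ (Icc 0 1) t (1 : ℝ))

/-- `q` lies in the causal future `J⁺(p)`: `q = p`, or there is a piecewise `C¹` future directed
causal curve from `p` to `q`. -/
def CausallyPrecedes : S.M → S.M → Prop := Relation.ReflTransGen S.CausalSegment

/-- Global hyperbolicity: strong causality (causal curves whose end points are close to `p` stay
close to `p`) and compactness of all `J⁺(p) ∩ J⁻(q)`. -/
def GloballyHyperbolic : Prop :=
  (∀ p : S.M, ∀ U ∈ 𝓝 p, ∃ V ∈ 𝓝 p, ∀ a ∈ V, ∀ c ∈ V, ∀ b,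
    S.CausallyPrecedes a b → S.CausallyPrecedes b c → b ∈ U) ∧
  ∀ p q : S.M, IsCompact {r | S.CausallyPrecedes p r ∧ S.CausallyPrecedes r q}

/-- No point of `A` can be joined to a point of `B` by a causal curve. -/
def SpacelikeSeparated (A B : Set S.M) : Prop :=
  ∀ p ∈ A, ∀ q ∈ B, ¬ S.CausallyPrecedes p q ∧ ¬ S.CausallyPrecedes q p

/-- `κ` is a smooth coordinate chart of the spacetime. -/
def IsChart (κ : OpenPartialHomeomorph S.M (Vec D)) : Prop :=
  κ ∈ IsManifold.maximalAtlas (𝓡 D) ∞ S.M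

/-- The density `|det g_{ab}|^{1/2}` of the metric volume element `dμ` in the chart `κ`. -/
def volDensity (κ : OpenPartialHomeomorph S.M (Vec D)) (z : Vec D) : ℝ :=
  Real.sqrt |Matrix.det (Matrix.of fun i j : Fin D ↦
    S.g (κ.symm z)
      (mfderiv 𝓘(ℝ, Vec D) (𝓡 D) κ.symm z (EuclideanSpace.single i (1 : ℝ) : Vec D))
      (mfderiv 𝓘(ℝ, Vec D) (𝓡 D) κ.symm z (EuclideanSpace.single j (1 : ℝ) : Vec D)))|

/-- The integral `∫ f dμ` of a function that is supported in the domain of the chart `κ`. -/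
def chartIntegral {E : Type*} [NormedAddCommGroup E] [NormedSpace ℝ E]
    (κ : OpenPartialHomeomorph S.M (Vec D)) (f : S.M → E) : E :=
  ∫ z in κ.target, S.volDensity κ z • f (κ.symm z)

end LorentzManifold

/-- A globally hyperbolic spacetime. -/
structure Spacetime (D : ℕ) extends LorentzManifold.{u} D where
  globallyHyperbolic : toLorentzManifold.GloballyHyperbolic

/-! ### Complex vector bundles and their sections -/

/-- A smooth complex vector bundle of finite rank, given by smooth transition functions. -/
structure CBundle {D : ℕ} (S : Spacetime.{u} D) where
  rank : ℕ
  idx : Type u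
  core : VectorBundleCore ℂ S.M (Fin rank → ℂ) idx
  smooth : ∀ a b v, ContMDiffOn (𝓡 D) 𝓘(ℝ, Fin rank → ℂ) ∞ (fun x ↦ core.coordChange a b x v)
    (core.baseSet a ∩ core.baseSet b)

namespace CBundle

variable {D : ℕ} {S : Spacetime.{u} D} (W : CBundle S)

/-- The model fibre. The fibre over `x` is a copy of it, through the local trivialization
`W.core.indexAt x`. -/
abbrev Fib : Type := Fin W.rank → ℂ

/-- The components, in the local trivialization `a`, of an element `v` of the fibre over `x`. -/
def rep (a : W.idx) (x : S.M) (v : W.Fib) : W.Fib :=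
  W.core.coordChange (W.core.indexAt x) a x v

/-- Smoothness of a section on a set. -/
def SmoothOn (U : Set S.M) (s : S.M → W.Fib) : Prop :=
  ∀ a, ContMDiffOn (𝓡 D) 𝓘(ℝ, W.Fib) ∞ (fun x ↦ W.rep a x (s x)) (U ∩ W.core.baseSet a)

/-- Smooth sections. -/
def IsSmooth (s : S.M → W.Fib) : Prop := W.SmoothOn univ s

/-- Test sections: smooth sections of compact support. -/
def IsTest (s : S.M → W.Fib) : Prop := W.IsSmooth s ∧ HasCompactSupport s

/-- `f y`, for `y ∈ U`, is a family of test sections, all supported in one compact subset of `U`,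
that depends smoothly on the parameter `y`. -/
def IsTestFamily (U : Set S.M) (f : S.M → S.M → W.Fib) : Prop :=
  (∀ a, ContMDiffOn ((𝓡 D).prod (𝓡 D)) 𝓘(ℝ, W.Fib) ∞
    (fun p : S.M × S.M ↦ W.rep a p.2 (f p.1 p.2)) (U ×ˢ W.core.baseSet a)) ∧
  ∃ K : Set S.M, IsCompact K ∧ K ⊆ U ∧ ∀ y ∈ U, ∀ x ∉ K, f y x = 0

/-- A profile is a function `P (w, x) = ∑ₖ Fₖ(w) sₖ(x)` with scalar test functions `Fₖ` on `ℝ^D`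
and smooth sections `sₖ`. Its rescalings (see `scaled`) are the test sections that get concentrated
at a point. -/
def IsProfile (P : Vec D → S.M → W.Fib) : Prop :=
  ∃ (r : ℕ) (F : Fin r → Vec D → ℂ) (s : Fin r → S.M → W.Fib),
    (∀ k, ContDiff ℝ ∞ (F k) ∧ HasCompactSupport (F k)) ∧ (∀ k, W.IsSmooth (s k)) ∧
    ∀ w x, P w x = ∑ k, F k w • s k x

/-- In the chart `κ`, the section `x ↦ lam^{-D} P ((x - z) / lam, x)`, which is concentrated near
the point with coordinates `z`. -/
def scaled (κ : OpenPartialHomeomorph S.M (Vec D)) (lam : ℝ) (z : Vec D)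
    (P : Vec D → S.M → W.Fib) : S.M → W.Fib :=
  κ.source.indicator fun x ↦ ((lam ^ D)⁻¹ : ℝ) • P (lam⁻¹ • (κ x - z)) x

/-- The section `G` multiplied by `lam^{-D} F ((x - z) / lam)`, where `F` is a scalar test function
on `ℝ^D`; the division by the density turns integration with respect to `dμ` into integration with
respect to the coordinates. -/
def scaledMul (κ : OpenPartialHomeomorph S.M (Vec D)) (lam : ℝ) (z : Vec D) (F : Vec D → ℂ)
    (G : S.M → W.Fib) : S.M → W.Fib :=
  κ.source.indicator fun x ↦
    (((lam ^ D * S.volDensity κ (κ x))⁻¹ : ℝ) * F (lam⁻¹ • (κ x - z))) • G x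

end CBundle

/-! ### Smeared factors and multilinear distributions -/

section Factors

variable {D : ℕ} {S : Spacetime.{u} D} {Label : Type w} (W : Label → CBundle S)

/-- A field label together with a section with which the field is smeared. Lists of factors stand
for the test sections `f₁ ⊗ ⋯ ⊗ fₙ` of products of fields. -/
abbrev Factor : Type (max u w) := Σ i, (S.M → (W i).Fib)

/-- Labels with profiles, which stand for the arguments of rescaled products. -/
abbrev Profile : Type (max u w) := Σ i, (Vec D → S.M → (W i).Fib)

variable {W}

/-- The rescaled factor. -/
def Profile.scaled (κ : OpenPartialHomeomorph S.M (Vec D)) (lam : ℝ) (z : Vec D)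
    (p : Profile W) : Factor W :=
  ⟨p.1, (W p.1).scaled κ lam z p.2⟩

/-- All factors are test sections with support in `U`. -/
def TestIn (U : Set S.M) (l : List (Factor W)) : Prop :=
  ∀ p ∈ l, (W p.1).IsTest p.2 ∧ tsupport p.2 ⊆ U

/-- `u` is a distribution on `U^n`, valued in the bundle dual to the one of the test sections with
labels `is`: it is multilinear in the test sections, and it is continuous, i.e. bounded in terms of
finitely many derivatives of the test functions on each compact set of a chart. -/
def IsDistributionOn {E : Type*} [NormedAddCommGroup E] [NormedSpace ℂ E] (U : Set S.M)
    (is : List Label) (u : List (Factor W) → E) : Prop :=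
  (∀ (l₁ l₂ : List (Factor W)) (i : Label) (f h : S.M → (W i).Fib) (c : ℂ),
    (l₁ ++ ⟨i, f⟩ :: l₂).map Sigma.fst = is →
    TestIn U (l₁ ++ ⟨i, f⟩ :: l₂) → TestIn U (l₁ ++ ⟨i, h⟩ :: l₂) →
    u (l₁ ++ ⟨i, f + c • h⟩ :: l₂) = u (l₁ ++ ⟨i, f⟩ :: l₂) + c • u (l₁ ++ ⟨i, h⟩ :: l₂)) ∧
  (∀ s : List (Factor W), s.map Sigma.fst = is → (∀ p ∈ s, (W p.1).IsSmooth p.2) →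
    ∀ κ, S.IsChart κ → ∀ K : Set (Vec D), IsCompact K → K ⊆ κ.target → κ.symm '' K ⊆ U →
    ∃ (N : ℕ) (A : ℝ), ∀ L : List (Σ i, (Vec D → ℂ) × (S.M → (W i).Fib)),
      L.map (fun p ↦ (⟨p.1, p.2.2⟩ : Factor W)) = s →
      (∀ p ∈ L, ContDiff ℝ ∞ p.2.1 ∧ tsupport p.2.1 ⊆ K ∧
        ∀ m ≤ N, ∀ z, ‖iteratedFDeriv ℝ m p.2.1 z‖ ≤ 1) →
      ‖u (L.map fun p ↦ ⟨p.1, κ.source.indicator fun x ↦ p.2.1 (κ x) • p.2.2 x⟩)‖ ≤ A)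

/-- `lam^δ u(lam, ·)` tends to zero as `lam → 0+`, with all derivatives and uniformly near `z₀`. -/
def VanishesScaled {E : Type*} [NormedAddCommGroup E] [NormedSpace ℝ E] (δ : ℝ)
    (u : ℝ → Vec D → E) (z₀ : Vec D) : Prop :=
  ∀ m : ℕ, Tendsto (fun p : ℝ × Vec D ↦ p.1 ^ δ • iteratedFDeriv ℝ m (u p.1) p.2)
    (𝓝[>] 0 ×ˢ 𝓝 z₀) (𝓝 0)

end Factors

/-! ### Merger trees -/

/-- Rooted trees with ordered branches. Leaves and the other nodes carry data. -/
inductive MergerTree (L : Type u) (N : Type v) : Type (max u v)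
  | leaf (l : L) : MergerTree L N
  | node (n : N) (children : List (MergerTree L N)) : MergerTree L N

namespace MergerTree

/-- In a merger tree every node which is not a leaf has at least two branches. The data of the
leaves and nodes are to satisfy `PL` and `PN`. -/
inductive Valid {L : Type u} {N : Type v} (PL : L → Prop) (PN : N → Prop) :
    MergerTree L N → Prop
  | leaf {l : L} : PL l → Valid PL PN (leaf l)
  | node {n : N} {ts : List (MergerTree L N)} : PN n → 2 ≤ ts.length →
      (∀ t ∈ ts, Valid PL PN t) → Valid PL PN (node n ts)

mutual
/-- The underlying tree, of which only the labels `a` of the leaves are kept. -/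
def shape {L : Type u} {N : Type v} {A : Type w} (a : L → A) : MergerTree L N → MergerTree A Unit
  | leaf l => leaf (a l)
  | node _ ts => node () (shapes a ts)
/-- The shapes of a list of trees. -/
def shapes {L : Type u} {N : Type v} {A : Type w} (a : L → A) :
    List (MergerTree L N) → List (MergerTree A Unit)
  | [] => []
  | t :: ts => shape a t :: shapes a ts
end

end MergerTree

section Trees

variable {D : ℕ} {S : Spacetime.{u} D} {Label : Type w} {W : Label → CBundle S}

/-- A merger tree whose leaves carry labels and profiles, and whose inner nodes carry scalar test
functions on `ℝ^D`: a test function `∏_S F_S(v_S)` of the vectors attached to its nodes. -/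
abbrev TestTree (W : Label → CBundle S) : Type (max u w) :=
  MergerTree (Profile W) (Vec D → ℂ)

/-- The branches `ts` at the root of a merger tree with test functions. -/
def ValidBranches (ts : List (TestTree W)) : Prop :=
  2 ≤ ts.length ∧ ∀ t ∈ ts, MergerTree.Valid (fun p : Profile W ↦ (W p.1).IsProfile p.2)
    (fun F : Vec D → ℂ ↦ ContDiff ℝ ∞ F ∧ HasCompactSupport F) t

variable {E : Type*} [NormedAddCommGroup E] [NormedSpace ℂ E]

mutual
/-- `mergeLeaves κ ε d z t k` is the integral, over the vectors `v_S` of the inner nodes `S` of the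
tree `t`, of `∏ F_S(v_S) k(l)`, where `l` is the list of the leaves of `t`, rescaled about their
parent nodes. The parent of the root of `t` is at the position `z`, and a node of depth `d` is at
the position `ε^d v_S` relative to its parent. -/
def mergeLeaves (κ : OpenPartialHomeomorph S.M (Vec D)) (ε : ℝ) (d : ℕ) (z : Vec D) :
    TestTree W → (List (Factor W) → E) → E
  | .leaf p, k => k [p.scaled κ (ε ^ d) z]
  | .node F ts, k => ∫ v, F v • mergeLeavesList κ ε (d + 1) (z + ε ^ d • v) ts k
/-- The same for a list of trees. -/
def mergeLeavesList (κ : OpenPartialHomeomorph S.M (Vec D)) (ε : ℝ) (d : ℕ) (z : Vec D) :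
    List (TestTree W) → (List (Factor W) → E) → E
  | [], k => k []
  | t :: ts, k => mergeLeaves κ ε d z t fun l ↦ mergeLeavesList κ ε d z ts fun l' ↦ k (l ++ l')
end

mutual
/-- `mergeNodes C J κ ε d z t k` is the sum of `k(f)` over labels `i ∈ J` of the root of `t` (and,
recursively, of all inner nodes), where `f` is the factor with label `i` in which the branches of
`t` have been merged by means of the coefficients `C`. -/
def mergeNodes (C : List (Factor W) → ∀ j, S.M → (W j).Fib) (J : Finset Label)
    (κ : OpenPartialHomeomorph S.M (Vec D)) (ε : ℝ) (d : ℕ) (z : Vec D) {E : Type}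
    [AddCommMonoid E] : TestTree W → (Factor W → E) → E
  | .leaf p, k => k (p.scaled κ (ε ^ d) z)
  | .node F ts, k => ∑ i ∈ J, k ⟨i, (W i).scaledMul κ (ε ^ d) z F fun x ↦
      mergeNodesList C J κ ε (d + 1) (κ x) ts fun l ↦ C l i x⟩
/-- The same for a list of trees. -/
def mergeNodesList (C : List (Factor W) → ∀ j, S.M → (W j).Fib) (J : Finset Label)
    (κ : OpenPartialHomeomorph S.M (Vec D)) (ε : ℝ) (d : ℕ) (z : Vec D) {E : Type}
    [AddCommMonoid E] : List (TestTree W) → (List (Factor W) → E) → E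
  | [], k => k []
  | t :: ts, k => mergeNodes C J κ ε d z t fun f ↦
      mergeNodesList C J κ ε d z ts fun l ↦ k (f :: l)
end

end Trees

/-! ### Star algebras given by generators and relations -/

/-- The free complex algebra on generators `X`. -/
abbrev FreeStar (X : Type u) : Type u := MonoidAlgebra ℂ (FreeMonoid X)

section FreeStar

variable {X : Type u}

/-- A generator. -/
def FreeStar.gen (x : X) : FreeStar X := MonoidAlgebra.single (FreeMonoid.of x) 1

variable [InvolutiveStar X]

/-- The antilinear antimultiplicative map that sends each generator `x` to `x*`. -/
def FreeStar.starHom : FreeStar X →+* (FreeStar X)ᵐᵒᵖ :=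
  MonoidAlgebra.liftNCRingHom
    (((algebraMap ℂ (FreeStar X)).comp (starRingEnd ℂ)).toOpposite
      fun c _ ↦ Algebra.commutes (star c) _)
    (FreeMonoid.lift fun x : X ↦ MulOpposite.op (FreeStar.gen (star x)))
    (fun c y ↦ by
      apply MulOpposite.unop_injective
      exact (Algebra.commutes (star c)
        (FreeMonoid.lift (fun x : X ↦ MulOpposite.op (FreeStar.gen (star x))) y).unop).symm)

theorem FreeStar.starHom_single_one (c : ℂ) :
    FreeStar.starHom (MonoidAlgebra.single (1 : FreeMonoid X) c) =
      MulOpposite.op (MonoidAlgebra.single 1 (star c)) := by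
  simp [FreeStar.starHom, MonoidAlgebra.liftNCRingHom]
  rfl

theorem FreeStar.starHom_gen (x : X) :
    FreeStar.starHom (FreeStar.gen x) = MulOpposite.op (FreeStar.gen (star x)) := by
  simp [FreeStar.gen, FreeStar.starHom, MonoidAlgebra.liftNCRingHom]

theorem FreeStar.starHom_starHom (a : FreeStar X) :
    (FreeStar.starHom (FreeStar.starHom a).unop).unop = a := by
  let φ : FreeStar X →+* FreeStar X :=
    { toFun := fun a ↦ (FreeStar.starHom (FreeStar.starHom a).unop).unop
      map_one' := by simp
      map_mul' := by simp
      map_zero' := by simp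
      map_add' := by simp }
  have h : φ = RingHom.id _ := by
    apply MonoidAlgebra.ringHom_ext'
    · ext c : 1
      simp [φ, FreeStar.starHom_single_one]
    · apply FreeMonoid.hom_eq
      intro x
      have := FreeStar.starHom_gen (star x)
      rw [star_star] at this
      change (FreeStar.starHom (FreeStar.starHom (FreeStar.gen x)).unop).unop = _
      rw [FreeStar.starHom_gen, MulOpposite.unop_op, this]
      rfl
  exact congrArg (fun f : FreeStar X →+* FreeStar X ↦ f a) h

/-- The star operation of the free star algebra. -/
instance FreeStar.instStarRing : StarRing (FreeStar X) where
  star a := (FreeStar.starHom a).unop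
  star_involutive := FreeStar.starHom_starHom
  star_mul a b := by simp
  star_add a b := by simp

variable (r : FreeStar X → FreeStar X → Prop)

/-- The relations `r` together with their adjoints. -/
inductive StarRel : FreeStar X → FreeStar X → Prop
  | of {a b : FreeStar X} : r a b → StarRel a b
  | adj {a b : FreeStar X} : r a b → StarRel (star a) (star b)

theorem StarRel.star {a b : FreeStar X} (h : StarRel r a b) : StarRel r (star a) (star b) := by
  cases h with
  | of h => exact .adj h
  | adj h => simpa using StarRel.of h

/-- The star algebra with generators `X` and relations `r`: the quotient of the free star algebra by
the two-sided star ideal generated by `r`. -/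
abbrev StarQuot : Type u := RingQuot (StarRel r)

/-- The star operation of the quotient, as a homomorphism to the opposite ring. -/
def StarQuot.starHom : StarQuot r →+* (StarQuot r)ᵐᵒᵖ :=
  RingQuot.lift ⟨((RingQuot.mkRingHom (StarRel r)).op).comp FreeStar.starHom, fun _ _ h ↦
    MulOpposite.unop_injective (RingQuot.mkRingHom_rel (h.star))⟩

theorem StarQuot.starHom_mk (a : FreeStar X) :
    (StarQuot.starHom r (RingQuot.mkRingHom (StarRel r) a)).unop =
      RingQuot.mkRingHom (StarRel r) (star a) := by
  simp [StarQuot.starHom]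
  rfl

/-- The star operation of the quotient. -/
instance StarQuot.instStarRing : StarRing (StarQuot r) where
  star a := (StarQuot.starHom r a).unop
  star_involutive a := by
    obtain ⟨a, rfl⟩ := RingQuot.mkRingHom_surjective _ a
    simp only [StarQuot.starHom_mk, star_star]
  star_mul a b := by simp
  star_add a b := by simp

end FreeStar

/-! ### Scaling degree -/

section ScalingDegree

variable {D : ℕ} {S : Spacetime.{u} D} {Label : Type w} {W : Label → CBundle S}

/-- The scaling degree at the point `y` of the diagonal. Here `u κ t lam x` is the value, at the
reference point `x`, of a distribution on the test functions `t` rescaled by `lam` about `x` in the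
chart `κ`; it depends smoothly on `x`, and the scaling limit is taken in this sense, i.e. with all
derivatives with respect to `x` and uniformly near `y`. -/
def scalingDegree (V : CBundle S) (y : S.M) {X : Type*} (adm : X → Prop)
    (u : OpenPartialHomeomorph S.M (Vec D) → X → ℝ → S.M → V.Fib) : EReal :=
  sInf {δ : EReal | ∃ r : ℝ, δ = r ∧ ∀ κ, S.IsChart κ → y ∈ κ.source →
    ∀ a, y ∈ V.core.baseSet a → ∀ t, adm t →
      VanishesScaled r (fun lam z ↦ V.rep a (κ.symm z) (u κ t lam (κ.symm z))) (κ y)}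

/-- The scaling degree of the coefficient with upper labels `is` and lower label `j` (the largest one
of its components). -/
def coefScalingDegree (C : List (Factor W) → ∀ j, S.M → (W j).Fib) (is : List Label) (j : Label)
    (y : S.M) : EReal :=
  scalingDegree (W j) y
    (fun L : List (Profile W) ↦ L.map Sigma.fst = is ∧ ∀ p ∈ L, (W p.1).IsProfile p.2)
    (fun κ L lam x ↦ C (L.map (Profile.scaled κ lam (κ x))) j x)

end ScalingDegree

/-! ### Fields and operator product coefficients -/

/-- The field content of a theory, and the background structures on which it is defined. A
background consists of a globally hyperbolic spacetime `st b` and possibly of further data (an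
orientation, a spin structure, a choice of bundles), which enter only through the index `b`. -/
structure FieldContent (D : ℕ) where
  /-- the labels of the fields -/
  Label : Type w
  /-- the label of the identity field -/
  one : Label
  /-- the label of the adjoint field -/
  star : Label → Label
  star_star : ∀ i, star (star i) = i
  star_one : star one = one
  /-- the Bose/Fermi parity -/
  parity : Label → ZMod 2
  /-- the background structures -/
  Bg : Type v
  /-- the spacetime of a background -/
  st : Bg → Spacetime.{u} D
  /-- The dual of the bundle in which the field `i` takes its values: the sections of `V b i` are
  those with which the field `i` is smeared. -/
  V : ∀ b, Label → CBundle (st b)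
  /-- the identification of the bundle of `star i` with the complex conjugate of the one of `i` -/
  conj : ∀ b i, (st b).M → ((V b i).Fib →ₛₗ[starRingEnd ℂ] (V b (star i)).Fib)
  conj_smooth : ∀ b i s, (V b i).IsSmooth s → (V b (star i)).IsSmooth fun x ↦ conj b i x (s x)
  conj_conj : ∀ b i x v,
    (⟨star (star i), conj b (star i) x (conj b i x v)⟩ : Σ k, (V b k).Fib) = ⟨i, v⟩
  /-- the identification of the bundle of the identity field with the trivial line bundle -/
  unit : ∀ b, (st b).M → ((V b one).Fib ≃ₗ[ℂ] ℂ)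
  unit_smooth : ∀ b (f : (st b).M → ℂ),
    (V b one).IsSmooth (fun x ↦ (unit b x).symm (f x)) ↔ ContMDiff (𝓡 D) 𝓘(ℝ, ℂ) ∞ f
  conj_unit : ∀ b x c, (⟨star one, conj b one x ((unit b x).symm c)⟩ : Σ k, (V b k).Fib) =
    ⟨one, (unit b x).symm (starRingEnd ℂ c)⟩

namespace FieldContent

variable {D : ℕ} (Φ : FieldContent.{u, v, w} D) (b : Φ.Bg)

/-- The complex conjugate of a section. -/
def conjSec (i : Φ.Label) (f : (Φ.st b).M → (Φ.V b i).Fib) :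
    (Φ.st b).M → (Φ.V b (Φ.star i)).Fib :=
  fun x ↦ Φ.conj b i x (f x)

/-- Generators of the field algebra: a label and a test section. -/
def Gen : Type (max u w) := Σ i, {f : (Φ.st b).M → (Φ.V b i).Fib // (Φ.V b i).IsTest f}

theorem isTest_conjSec {i : Φ.Label} {f : (Φ.st b).M → (Φ.V b i).Fib}
    (hf : (Φ.V b i).IsTest f) : (Φ.V b (Φ.star i)).IsTest (Φ.conjSec b i f) := by
  refine ⟨Φ.conj_smooth b i f hf.1, hf.2.mono ?_⟩
  intro x hx hfx
  apply hx
  simp [conjSec, hfx]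

theorem conjSec_conjSec (i : Φ.Label) (f : (Φ.st b).M → (Φ.V b i).Fib) :
    (⟨Φ.star (Φ.star i), Φ.conjSec b (Φ.star i) (Φ.conjSec b i f)⟩ : Factor (Φ.V b)) = ⟨i, f⟩ := by
  have key : ∀ (k : Φ.Label) (f' : (Φ.st b).M → (Φ.V b k).Fib), k = i →
      (∀ x, (⟨k, f' x⟩ : Σ k, (Φ.V b k).Fib) = ⟨i, f x⟩) →
      (⟨k, f'⟩ : Factor (Φ.V b)) = ⟨i, f⟩ := by
    intro k f' hk h
    subst hk
    congr 1
    funext x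
    exact eq_of_heq (Sigma.mk.inj (h x)).2
  exact key _ _ (Φ.star_star i) fun x ↦ Φ.conj_conj b i x (f x)

/-- `(i, f)* = (star i, conj f)`. -/
instance instInvolutiveStarGen : InvolutiveStar (Φ.Gen b) where
  star p := ⟨Φ.star p.1, Φ.conjSec b p.1 p.2.1, Φ.isTest_conjSec b p.2.2⟩
  star_involutive := by
    rintro ⟨i, f, hf⟩
    have key : ∀ p q : Factor (Φ.V b), p = q → ∀ (hp : (Φ.V b p.1).IsTest p.2)
        (hq : (Φ.V b q.1).IsTest q.2), (⟨p.1, p.2, hp⟩ : Φ.Gen b) = ⟨q.1, q.2, hq⟩ := by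
      rintro p q rfl _ _
      rfl
    exact key _ _ (Φ.conjSec_conjSec b i f) _ _

end FieldContent

/-- A field content with a system of operator product coefficients: `coef b [(i₁, f₁), …, (iₙ, fₙ)] j y`
is the coefficient with upper labels `i₁ … iₙ` and lower label `j`, smeared with `f₁ ⊗ ⋯ ⊗ fₙ` in
its first `n` arguments, at the reference point `y`. Only its values for test sections supported
near `y` are meaningful. `dim i` is the dimension of the field `i`. -/
structure OPESystem (D : ℕ) extends FieldContent.{u, v, w} D where
  coef : ∀ b, List (Factor (V b)) → ∀ j, (st b).M → (V b j).Fib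
  dim : Label → ℝ

namespace OPESystem

variable {D : ℕ} (Q : OPESystem.{u, v, w} D) (b : Q.Bg)

/-- The points of the spacetime. -/
abbrev Pt : Type u := (Q.st b).M

/-- The scaling degree of an operator product coefficient. -/
def sd (is : List Q.Label) (j : Q.Label) (y : Q.Pt b) : EReal :=
  coefScalingDegree (W := Q.V b) (Q.coef b) is j y

/-! ### The field algebra -/

/-- The formal adjoint of a scalar valued differential operator on the bundle of the field `i`, i.e. a
linear operator from scalar test functions to test sections that does not increase supports. -/
structure DiffOp (i : Q.Label) where
  op : (Q.Pt b → ℂ) → Q.Pt b → (Q.V b i).Fib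
  test : ∀ f, ContMDiff (𝓡 D) 𝓘(ℝ, ℂ) ∞ f → HasCompactSupport f →
    (Q.V b i).IsTest (op f) ∧ tsupport (op f) ⊆ tsupport f
  linear : ∀ f h (c : ℂ), ContMDiff (𝓡 D) 𝓘(ℝ, ℂ) ∞ f → HasCompactSupport f →
    ContMDiff (𝓡 D) 𝓘(ℝ, ℂ) ∞ h → HasCompactSupport h → op (f + c • h) = op f + c • op h

/-- The scalar test function `x ↦ lam^{-D} F ((x - z) / lam)`. -/
def scaledFun (κ : OpenPartialHomeomorph (Q.Pt b) (Vec D)) (lam : ℝ) (z : Vec D)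
    (F : Vec D → ℂ) : Q.Pt b → ℂ :=
  κ.source.indicator fun x ↦ ((lam ^ D)⁻¹ : ℝ) • F (lam⁻¹ • (κ x - z))

/-- The scaling degree, at `y`, of the coefficient with lower label `k` in the operator product
expansion of `O* O`, where `O = ∑ᵢ cᵢ φ⁽ⁱ⁾` is a sum of differential operators applied to fields. -/
def sumScalingDegree (K : Finset Q.Label) (c : ∀ i, Q.DiffOp b i) (k : Q.Label) (y : Q.Pt b) :
    EReal :=
  scalingDegree (Q.V b k) y
    (fun F : (Vec D → ℂ) × (Vec D → ℂ) ↦ (ContDiff ℝ ∞ F.1 ∧ HasCompactSupport F.1) ∧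
      (ContDiff ℝ ∞ F.2 ∧ HasCompactSupport F.2))
    (fun κ F lam x ↦ ∑ i ∈ K, ∑ j ∈ K, Q.coef b
      [⟨Q.star i, Q.conjSec b i ((c i).op fun x' ↦
          starRingEnd ℂ (Q.scaledFun b κ lam (κ x) F.1 x'))⟩,
        ⟨j, (c j).op (Q.scaledFun b κ lam (κ x) F.2)⟩] k x)

open FreeStar in
/-- The relations of the field algebra. -/
inductive Rel : FreeStar (Q.Gen b) → FreeStar (Q.Gen b) → Prop
  /-- the identity field: `φ⁽¹⁾(f) = ∫ f dμ · 1` (for `f` supported in a chart; the general case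
  follows by linearity) -/
  | identity (κ : OpenPartialHomeomorph (Q.Pt b) (Vec D)) (_ : (Q.st b).IsChart κ)
      (f : {f // (Q.V b Q.one).IsTest f}) (_ : tsupport f.1 ⊆ κ.source) :
      Rel (gen ⟨Q.one, f⟩)
        (algebraMap ℂ _ ((Q.st b).chartIntegral κ fun x ↦ Q.unit b x (f.1 x)))
  /-- linearity -/
  | linear (i : Q.Label) (c₁ c₂ : ℂ) (f f₁ f₂ : {f // (Q.V b i).IsTest f})
      (_ : f.1 = c₁ • f₁.1 + c₂ • f₂.1) :
      Rel (gen ⟨i, f⟩) (c₁ • gen ⟨i, f₁⟩ + c₂ • gen ⟨i, f₂⟩)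
  /-- relations between fields that are implied by the operator product coefficients -/
  | ope (K : Finset Q.Label) (c : ∀ i, Q.DiffOp b i)
      (_ : ∀ k y, Q.sumScalingDegree b K c k y < 0)
      (f : Q.Pt b → ℂ) (hf : ContMDiff (𝓡 D) 𝓘(ℝ, ℂ) ∞ f) (hf' : HasCompactSupport f) :
      Rel (∑ i ∈ K, gen ⟨i, (c i).op f, ((c i).test f hf hf').1⟩) 0
  /-- (anti-)commutation at spacelike separation -/
  | comm (i₁ i₂ : Q.Label) (f₁ : {f // (Q.V b i₁).IsTest f}) (f₂ : {f // (Q.V b i₂).IsTest f})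
      (_ : (Q.st b).SpacelikeSeparated (tsupport f₁.1) (tsupport f₂.1)) :
      Rel (gen ⟨i₁, f₁⟩ * gen ⟨i₂, f₂⟩)
        ((-1 : ℂ) ^ (Q.parity i₁ * Q.parity i₂).val • (gen ⟨i₂, f₂⟩ * gen ⟨i₁, f₁⟩))

/-- The field algebra: the star algebra with generators `φ⁽ⁱ⁾(f)`, where
`φ⁽ⁱ⁾(f)* = φ^(star i)(conj f)`, and the above relations. -/
abbrev Alg : Type (max u w) := StarQuot (Q.Rel b)

open Classical in
/-- The smeared field `φ⁽ⁱ⁾(f)` (zero if `f` is not a test section). -/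
def field (p : Factor (Q.V b)) : Q.Alg b :=
  if h : (Q.V b p.1).IsTest p.2 then
    RingQuot.mkRingHom _ (FreeStar.gen (⟨p.1, p.2, h⟩ : Q.Gen b))
  else 0

/-! ### States -/

/-- `u` is asymptotically zero for the branches `ts` of merger trees of the shape `τs`, to order `δ`. -/
def MergeEquiv {E : Type*} [NormedAddCommGroup E] [NormedSpace ℝ E]
    (τs : List (MergerTree Q.Label Unit)) (δ : ℝ) (u : List (TestTree (Q.V b)) → ℝ → E) : Prop :=
  ∀ ts : List (TestTree (Q.V b)), ValidBranches ts → MergerTree.shapes Sigma.fst ts = τs →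
    Tendsto (fun ε : ℝ ↦ ε ^ (-δ) • u ts ε) (𝓝[>] 0) (𝓝 0)

/-- The states of the theory: normalized positive linear functionals on the field algebra, whose
`n`-point functions are distributions, whose one-point functions are smooth, and which satisfy the
operator product expansion as an asymptotic relation for each merger tree. -/
structure State where
  toFun : Q.Alg b →ₗ[ℂ] ℂ
  normalized : toFun 1 = 1
  positive : ∀ A : Q.Alg b, 0 ≤ toFun (star A * A)
  distribution : ∀ is : List Q.Label,
    IsDistributionOn (W := Q.V b) univ is fun l ↦ toFun (l.map (Q.field b)).prod
  /-- the one-point functions `⟨φ⁽ʲ⁾(y)⟩` -/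
  onePoint : ∀ j, Q.Pt b → ((Q.V b j).Fib →ₗ[ℂ] ℂ)
  onePoint_smooth : ∀ j s, (Q.V b j).IsSmooth s →
    ContMDiff (𝓡 D) 𝓘(ℝ, ℂ) ∞ fun x ↦ onePoint j x (s x)
  onePoint_eq : ∀ j f, (Q.V b j).IsTest f → ∀ κ, (Q.st b).IsChart κ → tsupport f ⊆ κ.source →
    toFun (Q.field b ⟨j, f⟩) = (Q.st b).chartIntegral κ fun x ↦ onePoint j x (f x)
  ope : ∀ (y : Q.Pt b) (κ : OpenPartialHomeomorph (Q.Pt b) (Vec D)), (Q.st b).IsChart κ →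
    y ∈ κ.source → ∀ (τs : List (MergerTree Q.Label Unit)) (δ : ℝ), 0 < δ →
    ∃ Δ : ℝ, 0 ≤ Δ ∧ ∃ J : Finset Q.Label, (∀ j, j ∈ J ↔ Q.dim j ≤ Δ) ∧
      Q.MergeEquiv b τs δ fun ts ε ↦
        mergeLeavesList κ ε 1 (κ y) ts (fun l ↦ toFun (l.map (Q.field b)).prod) -
        ∑ j ∈ J, onePoint j y (mergeLeavesList κ ε 1 (κ y) ts fun l ↦ Q.coef b l j y)

/-! ### The axioms for the operator product coefficients -/

/-- The axioms on the operator product coefficients. -/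
structure Axioms : Prop where
  /-- Near the diagonal, the coefficients are distributions that depend smoothly on the reference
  point. -/
  coef_distribution : ∀ (b : Q.Bg) (is : List Q.Label) (j : Q.Label) (y₀ : Q.Pt b),
    ∃ U : Set (Q.Pt b), IsOpen U ∧ y₀ ∈ U ∧
      (∀ y ∈ U, IsDistributionOn (W := Q.V b) U is fun l ↦ Q.coef b l j y) ∧
      ∀ L : List (Σ i, (Q.Pt b → Q.Pt b → (Q.V b i).Fib)), L.map Sigma.fst = is →
        (∀ p ∈ L, (Q.V b p.1).IsTestFamily U p.2) →
        (Q.V b j).SmoothOn U fun y ↦ Q.coef b (L.map fun p ↦ ⟨p.1, p.2 y⟩) j y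
  /-- `dim i` is half the supremum, over all backgrounds, of the scaling degree of the coefficient of
  the identity in the product of the field `i` and its adjoint. -/
  dim_eq : ∀ i, ((2 * Q.dim i : ℝ) : EReal) = ⨆ (b : Q.Bg) (y : Q.Pt b), Q.sd b [i, Q.star i] Q.one y
  /-- There are only finitely many fields whose dimension is below a given bound. -/
  dim_finite : ∀ Δ : ℝ, {i | Q.dim i ≤ Δ}.Finite
  /-- Identity element: an identity field can be omitted from a product. -/
  identity_left : ∀ (b : Q.Bg) (is₁ is₂ : List Q.Label) (j : Q.Label) (y₀ : Q.Pt b),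
    ∃ U : Set (Q.Pt b), IsOpen U ∧ y₀ ∈ U ∧ ∀ y ∈ U, ∀ (l₁ l₂ : List (Factor (Q.V b)))
      (f : Q.Pt b → (Q.V b Q.one).Fib) (κ : OpenPartialHomeomorph (Q.Pt b) (Vec D)),
      l₁.map Sigma.fst = is₁ → l₂.map Sigma.fst = is₂ → TestIn U (l₁ ++ ⟨Q.one, f⟩ :: l₂) →
      (Q.st b).IsChart κ → tsupport f ⊆ κ.source →
      Q.coef b (l₁ ++ ⟨Q.one, f⟩ :: l₂) j y =
        ((Q.st b).chartIntegral κ fun x ↦ Q.unit b x (f x)) • Q.coef b (l₁ ++ l₂) j y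
  /-- Identity element: the coefficients with one upper label are smooth functions `k i j x y`, and on
  the diagonal they are the identity for `i = j` and zero otherwise. -/
  identity_diag : ∀ b : Q.Bg, ∃ k : ∀ i j, Q.Pt b → Q.Pt b → ((Q.V b i).Fib →ₗ[ℂ] (Q.V b j).Fib),
    (∀ i x, k i i x x = LinearMap.id) ∧ (∀ i j x, i ≠ j → k i j x x = 0) ∧
    ∀ (i j : Q.Label) (y₀ : Q.Pt b), ∃ U : Set (Q.Pt b), IsOpen U ∧ y₀ ∈ U ∧
      (∀ s, (Q.V b i).IsSmooth s → ∀ a, ContMDiffOn ((𝓡 D).prod (𝓡 D)) 𝓘(ℝ, (Q.V b j).Fib) ∞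
        (fun p : Q.Pt b × Q.Pt b ↦ (Q.V b j).rep a p.2 (k i j p.1 p.2 (s p.1)))
        (U ×ˢ (U ∩ (Q.V b j).core.baseSet a))) ∧
      ∀ y ∈ U, ∀ f κ, TestIn (W := Q.V b) U [⟨i, f⟩] → (Q.st b).IsChart κ →
        tsupport f ⊆ κ.source →
        Q.coef b [⟨i, f⟩] j y = (Q.st b).chartIntegral κ fun x ↦ k i j x y (f x)
  /-- Scaling degree. -/
  scaling_degree : ∀ (b : Q.Bg) (i j k : Q.Label) (y : Q.Pt b),
    Q.sd b [i, j] k y ≤ ((Q.dim i + Q.dim j - Q.dim k : ℝ) : EReal)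
  /-- Asymptotic positivity: dimensions are non-negative, and only the identity has dimension 0. -/
  dim_nonneg : ∀ i, 0 ≤ Q.dim i
  dim_eq_zero : ∀ i, Q.dim i = 0 ↔ i = Q.one
  /-- The supremum in the definition of the dimension is attained. -/
  dim_attained : ∀ i, ∃ (b : Q.Bg) (y : Q.Pt b),
    Q.sd b [i, Q.star i] Q.one y = ((2 * Q.dim i : ℝ) : EReal)
  /-- Asymptotic positivity: where the supremum is attained, the divergence can be seen on test
  sections of the form `f ⊗ conj f`. -/
  asymptotic_positivity : ∀ (i : Q.Label) (b : Q.Bg) (y : Q.Pt b),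
    Q.sd b [i, Q.star i] Q.one y = ((2 * Q.dim i : ℝ) : EReal) →
    ∀ κ, (Q.st b).IsChart κ → y ∈ κ.source → ∀ δ : ℝ, 0 < δ →
    ∃ P, (Q.V b i).IsProfile P ∧
      Tendsto (fun lam : ℝ ↦ lam ^ (2 * Q.dim i - δ) *
        ‖Q.unit b y (Q.coef b [⟨i, (Q.V b i).scaled κ lam (κ y) P⟩,
          ⟨Q.star i, Q.conjSec b i ((Q.V b i).scaled κ lam (κ y) P)⟩] Q.one y)‖)
        (𝓝[>] 0) atTop
  /-- Associativity, for each merger tree. -/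
  associativity : ∀ (b : Q.Bg) (y : Q.Pt b) (κ : OpenPartialHomeomorph (Q.Pt b) (Vec D)),
    (Q.st b).IsChart κ → y ∈ κ.source → ∀ (τs : List (MergerTree Q.Label Unit)) (j : Q.Label)
    (δ : ℝ), 0 < δ →
    ∃ Δ : ℝ, 0 ≤ Δ ∧ ∃ J : Finset Q.Label, (∀ j, j ∈ J ↔ Q.dim j ≤ Δ) ∧
      Q.MergeEquiv b τs δ fun ts ε ↦
        (mergeLeavesList κ ε 1 (κ y) ts fun l ↦ Q.coef b l j y) -
        mergeNodesList (Q.coef b) J κ ε 1 (κ y) ts fun l ↦ Q.coef b l j y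

end OPESystem

end OPEQFT

end

/-!
# Normal (anti-)commutation relations from operator product expansions

Suppose that `F(i) ≠ F(i*)`. Then exactly one of the fields `φ⁽ⁱ⁾`, `φ⁽ⁱ*⁾` is fermionic, and a pair
`φ⁽ⁱ⁾ φ⁽ⁱ*⁾`, concentrated at one point, *anticommutes* with a spacelike separated copy of itself
(`OPEQFT.OPESystem.prod_field_exchange`). On the other hand, the leading contribution to the operator
product of two such pairs comes from merging each pair into the identity field, and it is *symmetric*
in the two pairs. Hence this contribution has to be subleading, which contradicts asymptotic
positivity.

In detail, let `d = dim i = dim i*`, choose a background and a point `y` where the scaling degree of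
`C = C^{(i)(i*)}_{(1)}` is `2d`, and consider in a state the four-point function `S(F, F')` for the
merger tree with two branches at the root, each of which merges a pair: the pairs have size `ε²`, and
their positions relative to `y` are of size `ε` and averaged with `F` and `F'`. The expansion of the
state and the associativity axiom express it by terms, labelled by the fields `a`, `c` into which the
pairs are merged and the field `j` into which these are merged, of order
`ε^{-(8d - dim a - dim c - dim j)}` up to arbitrarily small powers (`tendsto_coef_merged`). There is a gap
`γ > 0` in the dimensions, so all terms with `(a, c) ≠ (1, 1)` are smaller than the leading order
`ε^{-8d}` by the power `ε^γ`. As the identity may be omitted from products, the remaining term is the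
product of the averages of `C` with `F` and with `F'` (`tendsto_state_pairTree`). These averages vary
slowly on the scale `ε`, whence this term is `(∫ F) (∫ F') C(ε²)²` up to a relative error of order `ε`
(`tendsto_pairAverage_mul_sub`). Taking `F`, `F'` with spacelike separated supports
(`Spacetime.exists_spacelike_testFunctions`; this is where `D ≥ 2` and strong causality enter), one has
`S(F, F') = -S(F', F)`. So `C(ε²)²` is of order `ε^{-(8d - γ/2)}` at most
(`tendsto_pairValue_sq`), i.e. `λ^{2d - γ/8} C(λ) → 0`, for all test sections that are concentrated on
the scale `λ`; but asymptotic positivity provides a test section for which this diverges.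

The analytic difficulty is that in the terms of the associativity axiom the outer coefficient acts on
test sections which depend on `ε` through the inner coefficients. The axiom on the scaling degree
concerns fixed test functions. It is extended to families that are bounded with all derivatives by
the uniform boundedness principle (`exists_bound_bilinear`, `tendsto_bilinear_zoom`). The inner
coefficients, multiplied with a suitable power of their scale, are such families, because the scaling
limits hold with all derivatives with respect to the reference point (`locallyBdd_pair`).
-/

noncomputable section

namespace OPEQFT

/-! ### Uniform boundedness of functionals on test functions -/

section TestFunctions

open scoped Distributions
open TopologicalSpace (Compacts)

variable {X : Type*} [NormedAddCommGroup X] [NormedSpace ℝ X]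
  {E : Type*} [NormedAddCommGroup E] [NormedSpace ℂ E]

/-- The `C^N` norm on the smooth functions with support in `K`. -/
abbrev testNorm (K : Compacts X) (N : ℕ) : Seminorm ℂ 𝓓_{K}(X, ℂ) :=
  ContDiffMapSupportedIn.supSeminorm ℂ X ℂ ⊤ K N

theorem testNorm_le_iff {K : Compacts X} {N : ℕ} {C : ℝ} (hC : 0 ≤ C) (h : 𝓓_{K}(X, ℂ)) :
    testNorm K N h ≤ C ↔ ∀ m ≤ N, ∀ x, ‖iteratedFDeriv ℝ m h x‖ ≤ C := by
  constructor
  · intro H m hm x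
    refine (ContDiffMapSupportedIn.norm_iteratedFDeriv_apply_le_seminorm_top ℂ).trans (le_trans ?_ H)
    exact Seminorm.le_finset_sup_apply (Finset.mem_Iic.2 hm)
  · intro H
    refine Seminorm.finset_sup_apply_le hC fun m hm ↦ ?_
    rw [ContDiffMapSupportedIn.seminorm_top_le_iff ℂ hC]
    exact fun x _ ↦ H m (Finset.mem_Iic.1 hm) x

theorem norm_iteratedFDeriv_le_testNorm {K : Compacts X} {N m : ℕ} (hm : m ≤ N)
    (h : 𝓓_{K}(X, ℂ)) (x : X) : ‖iteratedFDeriv ℝ m h x‖ ≤ testNorm K N h :=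
  (testNorm_le_iff (apply_nonneg _ _) h).1 le_rfl m hm x

theorem summable_norm_ell1 (c : lp (fun _ : ℕ ↦ ℂ) 1) : Summable fun k ↦ ‖c k‖ := by
  simpa using (lp.memℓp c).summable (by norm_num)

theorem norm_ell1 (c : lp (fun _ : ℕ ↦ ℂ) 1) : ‖c‖ = ∑' k, ‖c k‖ := by
  simpa using lp.norm_eq_tsum_rpow (p := 1) (by norm_num) c

/-- The linear map that sends a summable sequence `c` to the test function `∑ₖ cₖ hₖ`, for a sequence
`h` of test functions that is bounded in all `C^N` norms. -/
def seriesMap {K : Compacts X} (h : ℕ → 𝓓_{K}(X, ℂ))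
    (hb : ∀ N, ∃ C, ∀ k, testNorm K N (h k) ≤ C) :
    lp (fun _ : ℕ ↦ ℂ) 1 →ₗ[ℂ] 𝓓_{K}(X, ℂ) where
  toFun c :=
    { toFun := fun x ↦ ∑' k, c k • h k x
      contDiff' := by
        choose C hC using hb
        refine contDiff_tsum (v := fun m k ↦ ‖c k‖ * C m)
          (fun k ↦ (h k).contDiff.const_smul _)
          (fun m _ ↦ (summable_norm_ell1 c).mul_right _) fun m k x _ ↦ ?_
        rw [iteratedFDeriv_const_smul_apply' ((h k).contDiff.contDiffAt.of_le (mod_cast le_top)),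
          norm_smul]
        gcongr
        exact (norm_iteratedFDeriv_le_testNorm le_rfl _ x).trans (hC m k)
      zero_on_compl' := fun x hx ↦ by simp [(h _).zero_on_compl hx] }
  map_add' c c' := by
    have hs : ∀ (c : lp (fun _ : ℕ ↦ ℂ) 1) (x : X), Summable fun k ↦ c k • h k x := by
      intro c x
      obtain ⟨C, hC⟩ := hb 0
      refine Summable.of_norm_bounded ((summable_norm_ell1 c).mul_right C) fun k ↦ ?_
      rw [norm_smul]
      gcongr
      simpa using (norm_iteratedFDeriv_le_testNorm le_rfl (h k) x).trans (hC k)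
    refine ContDiffMapSupportedIn.ext fun x ↦ ?_
    change ∑' k, (c k + c' k) • h k x = (∑' k, c k • h k x) + ∑' k, c' k • h k x
    rw [← (hs c x).tsum_add (hs c' x)]
    simp only [add_smul]
  map_smul' a c := by
    refine ContDiffMapSupportedIn.ext fun x ↦ ?_
    change ∑' k, (a • c k) • h k x = a • ∑' k, c k • h k x
    simp only [smul_assoc]
    exact tsum_const_smul'' a

theorem seriesMap_apply {K : Compacts X} (h : ℕ → 𝓓_{K}(X, ℂ))
    (hb : ∀ N, ∃ C, ∀ k, testNorm K N (h k) ≤ C) (c : lp (fun _ : ℕ ↦ ℂ) 1) (x : X) :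
    seriesMap h hb c x = ∑' k, c k • h k x := rfl

theorem seriesMap_single {K : Compacts X} (h : ℕ → 𝓓_{K}(X, ℂ))
    (hb : ∀ N, ∃ C, ∀ k, testNorm K N (h k) ≤ C) (k : ℕ) :
    seriesMap h hb (lp.single 1 k 1) = h k := by
  refine ContDiffMapSupportedIn.ext fun x ↦ ?_
  rw [seriesMap_apply, tsum_eq_single k]
  · simp
  · intro j hj
    simp [hj]

/-- `seriesMap` is continuous, so that it pulls continuous functionals on test functions back to
continuous functionals on `ℓ¹`. -/
theorem testNorm_seriesMap_le {K : Compacts X} (h : ℕ → 𝓓_{K}(X, ℂ))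
    (hb : ∀ N, ∃ C, ∀ k, testNorm K N (h k) ≤ C) (N : ℕ) :
    ∃ C, 0 ≤ C ∧ ∀ c, testNorm K N (seriesMap h hb c) ≤ C * ‖c‖ := by
  obtain ⟨C, hC⟩ := hb N
  have hC0 : 0 ≤ C := (apply_nonneg _ _).trans (hC 0)
  refine ⟨C, hC0, fun c ↦ (testNorm_le_iff (by positivity) _).2 fun m hm x ↦ ?_⟩
  have hb' : ∀ (j k : ℕ) (y : X), ‖iteratedFDeriv ℝ j (fun x ↦ c k • h k x) y‖ ≤
      ‖c k‖ * testNorm K j (h k) := by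
    intro j k y
    rw [iteratedFDeriv_const_smul_apply' ((h k).contDiff.contDiffAt.of_le (mod_cast le_top)),
      norm_smul]
    gcongr
    exact norm_iteratedFDeriv_le_testNorm le_rfl _ y
  have hsum : ∀ j : ℕ, Summable fun k ↦ ‖c k‖ * testNorm K j (h k) := by
    intro j
    obtain ⟨C', hC'⟩ := hb j
    refine Summable.of_nonneg_of_le (fun k ↦ by positivity) (fun k ↦ ?_)
      ((summable_norm_ell1 c).mul_right C')
    gcongr
    exact hC' k
  change ‖iteratedFDeriv ℝ m (fun x ↦ ∑' k, c k • h k x) x‖ ≤ _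
  rw [iteratedFDeriv_tsum_apply (N := ⊤) (v := fun j k ↦ ‖c k‖ * testNorm K j (h k))
    (fun k ↦ (h k).contDiff.const_smul _) (fun j _ ↦ hsum j) (fun j k y _ ↦ hb' j k y)
    (by simp) x]
  have hle : ∀ k, ‖iteratedFDeriv ℝ m (fun x ↦ c k • h k x) x‖ ≤ ‖c k‖ * C := by
    intro k
    refine (hb' m k x).trans ?_
    gcongr
    refine le_trans ?_ (hC k)
    refine (testNorm_le_iff (apply_nonneg _ _) _).2 fun j hj x ↦ ?_
    exact norm_iteratedFDeriv_le_testNorm (hj.trans hm) _ x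
  calc _ ≤ ∑' k, ‖c k‖ * C :=
        tsum_of_norm_bounded ((summable_norm_ell1 c).mul_right C).hasSum hle
    _ = C * ‖c‖ := by rw [tsum_mul_right, norm_ell1, mul_comm]

/-- The uniform boundedness principle for bilinear functionals on test functions: a pointwise bounded
sequence of bounded bilinear maps is bounded along sequences of test functions that are bounded in
all `C^N` norms. The proof composes with `seriesMap`, which reduces it to the Banach space `ℓ¹`. -/
theorem exists_bound_bilinear {K K' : Compacts X}
    (β : ℕ → 𝓓_{K}(X, ℂ) →ₗ[ℂ] 𝓓_{K'}(X, ℂ) →ₗ[ℂ] E)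
    (hβ : ∀ n, ∃ (N : ℕ) (A : ℝ), ∀ h h', ‖β n h h'‖ ≤ A * (testNorm K N h * testNorm K' N h'))
    (hpt : ∀ h h', ∃ C, ∀ n, ‖β n h h'‖ ≤ C)
    (h : ℕ → 𝓓_{K}(X, ℂ)) (h' : ℕ → 𝓓_{K'}(X, ℂ))
    (hb : ∀ N, ∃ C, ∀ k, testNorm K N (h k) ≤ C) (hb' : ∀ N, ∃ C, ∀ k, testNorm K' N (h' k) ≤ C) :
    ∃ M, ∀ n, ‖β n (h n) (h' n)‖ ≤ M := by
  have hbd : ∀ n, ∃ C, ∀ c c', ‖β n (seriesMap h hb c) (seriesMap h' hb' c')‖ ≤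
      C * ‖c‖ * ‖c'‖ := by
    intro n
    obtain ⟨N, A, hA⟩ := hβ n
    obtain ⟨C₁, hC₁0, hC₁⟩ := testNorm_seriesMap_le h hb N
    obtain ⟨C₂, hC₂0, hC₂⟩ := testNorm_seriesMap_le h' hb' N
    refine ⟨|A| * (C₁ * C₂), fun c c' ↦ ?_⟩
    calc _ ≤ |A| * (testNorm K N (seriesMap h hb c) * testNorm K' N (seriesMap h' hb' c')) := by
          refine (hA _ _).trans ?_
          gcongr
          exact le_abs_self A
      _ ≤ |A| * ((C₁ * ‖c‖) * (C₂ * ‖c'‖)) := by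
          gcongr
          exacts [hC₁ c, hC₂ c']
      _ = _ := by ring
  choose C hC using hbd
  let g : ℕ → lp (fun _ : ℕ ↦ ℂ) 1 →L[ℂ] lp (fun _ : ℕ ↦ ℂ) 1 →L[ℂ] E := fun n ↦
    LinearMap.mkContinuous₂ ((β n).compl₁₂ (seriesMap h hb) (seriesMap h' hb')) (C n)
      fun c c' ↦ hC n c c'
  have hg : ∀ n c c', g n c c' = β n (seriesMap h hb c) (seriesMap h' hb' c') := fun _ _ _ ↦ rfl
  obtain ⟨M, hM⟩ : ∃ M, ∀ n, ‖g n‖ ≤ M := by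
    refine banach_steinhaus fun c ↦ banach_steinhaus fun c' ↦ ?_
    simp only [hg]
    exact hpt _ _
  refine ⟨M, fun n ↦ ?_⟩
  have h1 := (g n).le_opNorm₂ (lp.single 1 n 1) (lp.single 1 n 1)
  rw [hg, seriesMap_single, seriesMap_single] at h1
  simp only [lp.norm_single (p := 1) zero_lt_one, norm_one, mul_one] at h1
  exact h1.trans (hM n)

end TestFunctions

/-! ### Multilinear maps that are bounded with respect to a seminorm -/

section Multilinear

variable {ι : Type*} [Fintype ι] {T : Type*} [AddCommGroup T] [Module ℂ T]
  {E : Type*} [NormedAddCommGroup E] [NormedSpace ℂ E]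

/-- A multilinear map that is bounded on a product of seminorm balls satisfies the homogeneous bound. -/
theorem multilinear_bound_of_unit (p : Seminorm ℂ T) (μ : MultilinearMap ℂ (fun _ : ι ↦ T) E)
    {A : ℝ} (h : ∀ x, (∀ k, p (x k) ≤ 1) → ‖μ x‖ ≤ A) (x : ι → T) :
    ‖μ x‖ ≤ A * ∏ k, p (x k) := by
  -- The seminorm may vanish on some `x k`, so one divides by `p (x k) + η` and lets `η` tend to zero.
  have key : ∀ η > 0, ‖μ x‖ ≤ A * ∏ k, (p (x k) + η) := by
    intro η hη
    have hpos : ∀ k, 0 < p (x k) + η := fun k ↦ add_pos_of_nonneg_of_pos (apply_nonneg _ _) hη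
    have hx : x = fun k ↦ ((p (x k) + η : ℝ) : ℂ) • (((p (x k) + η : ℝ) : ℂ)⁻¹ • x k) := by
      funext k
      rw [smul_smul, mul_inv_cancel₀ (by exact_mod_cast (hpos k).ne'), one_smul]
    have hy := h (fun k ↦ ((p (x k) + η : ℝ) : ℂ)⁻¹ • x k) fun k ↦ by
      rw [map_smul_eq_mul, norm_inv, Complex.norm_real, Real.norm_of_nonneg (hpos k).le,
        inv_mul_le_one₀ (hpos k)]
      linarith
    rw [hx, MultilinearMap.map_smul_univ, norm_smul, ← hx, norm_prod, mul_comm]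
    have : ∏ k, ‖((p (x k) + η : ℝ) : ℂ)‖ = ∏ k, (p (x k) + η) :=
      Finset.prod_congr rfl fun k _ ↦ by rw [Complex.norm_real, Real.norm_of_nonneg (hpos k).le]
    rw [this]
    exact mul_le_mul_of_nonneg_right hy (Finset.prod_nonneg fun k _ ↦ (hpos k).le)
  have hlim : Tendsto (fun η : ℝ ↦ A * ∏ k, (p (x k) + η)) (𝓝[>] 0) (𝓝 (A * ∏ k, p (x k))) := by
    have : Continuous fun η : ℝ ↦ A * ∏ k, (p (x k) + η) := by fun_prop
    simpa using (this.tendsto 0).mono_left nhdsWithin_le_nhds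
  exact ge_of_tendsto hlim (eventually_mem_nhdsWithin.mono fun η hη ↦ key η hη)

theorem multilinear_continuous_of_bound {Y : Type*} [TopologicalSpace Y] (p : Seminorm ℂ T)
    (μ : MultilinearMap ℂ (fun _ : ι ↦ T) E) {A : ℝ} (h : ∀ x, ‖μ x‖ ≤ A * ∏ k, p (x k))
    (φ : Y → ι → T)
    (hφ : ∀ y₀ k, Tendsto (fun y ↦ p (φ y k - φ y₀ k)) (𝓝 y₀) (𝓝 0)) :
    Continuous fun y ↦ μ (φ y) := by
  let _ : SeminormedAddCommGroup T := p.toAddGroupSeminorm.toSeminormedAddCommGroup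
  let _ : NormedSpace ℂ T := ⟨fun a x ↦ (map_smul_eq_mul p a x).le⟩
  have hμ : Continuous μ := (μ.mkContinuous A h).cont
  refine hμ.comp (continuous_pi fun k ↦ continuous_iff_continuousAt.2 fun y₀ ↦ ?_)
  exact tendsto_iff_norm_sub_tendsto_zero.2 (hφ y₀ k)

end Multilinear

/-! ### Families of functions that are bounded near a point, and their dilations -/

theorem tendsto_rpow_nhdsGT_zero {r : ℝ} (hr : 0 < r) :
    Tendsto (fun ε : ℝ ↦ ε ^ r) (𝓝[>] 0) (𝓝 0) := by
  have := (Real.continuousAt_rpow_const 0 r (Or.inr hr.le)).tendsto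
  rw [Real.zero_rpow hr.ne'] at this
  exact this.mono_left nhdsWithin_le_nhds

section Zoom

open scoped Distributions
open TopologicalSpace (Compacts)

variable {X : Type*} [NormedAddCommGroup X] [NormedSpace ℝ X]

theorem norm_iteratedFDeriv_comp_affine_le (q : X → ℂ) (n : ℕ) {ε : ℝ} (hε : ε ≠ 0) (z w : X) :
    ‖iteratedFDeriv ℝ n (fun w ↦ q (z + ε • w)) w‖ ≤
      ‖iteratedFDeriv ℝ n q (z + ε • w)‖ * |ε| ^ n := by
  have h1 : (fun w ↦ q (z + ε • w)) =
      (fun x ↦ q (z + x)) ∘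
      (ContinuousLinearEquiv.smulLeft (Units.mk0 ε hε) : X ≃L[ℝ] X) := rfl
  have h2 := ContinuousLinearEquiv.iteratedFDerivWithin_comp_right
    (ContinuousLinearEquiv.smulLeft (Units.mk0 ε hε) : X ≃L[ℝ] X) (fun x ↦ q (z + x))
    uniqueDiffOn_univ (x := w) (mem_univ _) n
  simp only [preimage_univ, iteratedFDerivWithin_univ] at h2
  rw [h1, h2, iteratedFDeriv_comp_add_left]
  refine (ContinuousMultilinearMap.norm_compContinuousLinearMap_le _ _).trans ?_
  rw [Finset.prod_const, Finset.card_univ, Fintype.card_fin]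
  refine mul_le_mul_of_nonneg_left ?_ (norm_nonneg _)
  refine pow_le_pow_left₀ (norm_nonneg _) ?_ n
  refine ContinuousLinearMap.opNorm_le_bound _ (abs_nonneg _) fun x ↦ ?_
  change ‖ε • x‖ ≤ _
  rw [norm_smul, Real.norm_eq_abs]

theorem norm_iteratedFDeriv_mul_le_at {f g : X → ℂ} {x : X} (n : ℕ) (hf : ContDiffAt ℝ n f x)
    (hg : ContDiffAt ℝ n g x) :
    ‖iteratedFDeriv ℝ n (fun y ↦ f y * g y) x‖ ≤ ∑ i ∈ Finset.range (n + 1),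
      (n.choose i : ℝ) * ‖iteratedFDeriv ℝ i f x‖ * ‖iteratedFDeriv ℝ (n - i) g x‖ := by
  obtain ⟨u, hu, hfu⟩ := hf.contDiffOn le_rfl (by simp)
  obtain ⟨v, hv, hgv⟩ := hg.contDiffOn le_rfl (by simp)
  obtain ⟨o, ho, hoo, hxo⟩ := mem_nhds_iff.1 (inter_mem hu hv)
  have := norm_iteratedFDerivWithin_mul_le (hfu.mono (ho.trans inter_subset_left))
    (hgv.mono (ho.trans inter_subset_right)) hoo.uniqueDiffOn hxo le_rfl
  simpa only [iteratedFDerivWithin_of_isOpen _ hoo hxo] using this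

/-- A family of functions `q ε` which, for `ε → 0+`, are smooth near `z₀`, with bounds on all
derivatives that are uniform near `z₀`. -/
def LocallyBdd (z₀ : X) (q : ℝ → X → ℂ) : Prop :=
  (∀ᶠ p : ℝ × X in 𝓝[>] 0 ×ˢ 𝓝 z₀, ContDiffAt ℝ ∞ (q p.1) p.2) ∧
  ∀ m : ℕ, ∃ C, ∀ᶠ p : ℝ × X in 𝓝[>] 0 ×ˢ 𝓝 z₀, ‖iteratedFDeriv ℝ m (q p.1) p.2‖ ≤ C

namespace LocallyBdd

variable {z₀ : X} {q q' : ℝ → X → ℂ}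

theorem mul (hq : LocallyBdd z₀ q) (hq' : LocallyBdd z₀ q') :
    LocallyBdd z₀ fun ε z ↦ q ε z * q' ε z := by
  refine ⟨?_, fun m ↦ ?_⟩
  · filter_upwards [hq.1, hq'.1] with p h h' using h.mul h'
  · choose C hC using hq.2
    choose C' hC' using hq'.2
    refine ⟨∑ i ∈ Finset.range (m + 1), (m.choose i : ℝ) * C i * C' (m - i), ?_⟩
    filter_upwards [hq.1, hq'.1, (Finset.eventually_all (Finset.range (m + 1))).2 fun i _ ↦ hC i,
      (Finset.eventually_all (Finset.range (m + 1))).2 fun i _ ↦ hC' (m - i)] with p h h' hb hb'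
    refine (norm_iteratedFDeriv_mul_le_at m (h.of_le (mod_cast le_top))
      (h'.of_le (mod_cast le_top))).trans (Finset.sum_le_sum fun i hi ↦ ?_)
    have h0 : 0 ≤ C i := (norm_nonneg _).trans (hb i hi)
    gcongr
    exacts [hb i hi, hb' i hi]

theorem sum {ι : Type*} (s : Finset ι) {q : ι → ℝ → X → ℂ} (hq : ∀ i ∈ s, LocallyBdd z₀ (q i)) :
    LocallyBdd z₀ fun ε z ↦ ∑ i ∈ s, q i ε z := by
  refine ⟨?_, fun m ↦ ?_⟩
  · filter_upwards [(Finset.eventually_all s).2 fun i hi ↦ (hq i hi).1] with p h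
    exact ContDiffAt.sum h
  · have : ∀ i, ∃ C, i ∈ s → ∀ᶠ p : ℝ × X in 𝓝[>] 0 ×ˢ 𝓝 z₀,
        ‖iteratedFDeriv ℝ m (q i p.1) p.2‖ ≤ C := by
      intro i
      by_cases hi : i ∈ s
      · obtain ⟨C, hC⟩ := (hq i hi).2 m
        exact ⟨C, fun _ ↦ hC⟩
      · exact ⟨0, fun h ↦ absurd h hi⟩
    choose C hC using this
    refine ⟨∑ i ∈ s, C i, ?_⟩
    filter_upwards [(Finset.eventually_all s).2 fun i hi ↦ (hq i hi).1,
      (Finset.eventually_all s).2 hC] with p h hb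
    rw [iteratedFDeriv_fun_sum_apply fun i hi ↦ (h i hi).of_le (mod_cast le_top)]
    exact norm_sum_le_of_le _ hb

theorem of_contDiffAt {f : X → ℂ} (hf : ∀ᶠ z in 𝓝 z₀, ContDiffAt ℝ ∞ f z) :
    LocallyBdd z₀ fun _ ↦ f := by
  refine ⟨hf.prod_inr _, fun m ↦ ?_⟩
  have hc : ContinuousAt (iteratedFDeriv ℝ m f) z₀ := by
    have := (hf.self_of_nhds.iteratedFDeriv_right (m := 0) (i := m)
      (by simpa using mod_cast le_top)).continuousAt
    exact this
  refine ⟨‖iteratedFDeriv ℝ m f z₀‖ + 1, ?_⟩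
  have := hc.norm.eventually (eventually_le_nhds (lt_add_one _))
  exact this.prod_inr _

end LocallyBdd

/-- What holds near `z₀` for small `ε` holds at all points `z₀ + ε w`, with `w` in a bounded set. -/
theorem eventually_forall_zoom {z₀ : X} {P : ℝ × X → Prop} (hP : ∀ᶠ p in 𝓝[>] 0 ×ˢ 𝓝 z₀, P p)
    {K : Set X} (hK : Bornology.IsBounded K) :
    ∀ᶠ ε : ℝ in 𝓝[>] 0, ∀ w ∈ K, P (ε, z₀ + ε • w) := by
  obtain ⟨R, hR⟩ := hK.exists_norm_le
  obtain ⟨P₁, h₁, P₂, h₂, h⟩ := eventually_prod_iff.1 hP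
  obtain ⟨ρ, hρ, hball⟩ := Metric.eventually_nhds_iff_ball.1 h₂
  have hsmall : ∀ᶠ ε : ℝ in 𝓝[>] 0, ε * (|R| + 1) < ρ := by
    have : Tendsto (fun ε : ℝ ↦ ε * (|R| + 1)) (𝓝[>] 0) (𝓝 0) := by
      have hc : Continuous fun ε : ℝ ↦ ε * (|R| + 1) := by fun_prop
      simpa using (hc.tendsto 0).mono_left nhdsWithin_le_nhds
    exact this.eventually (gt_mem_nhds hρ)
  filter_upwards [h₁, hsmall, eventually_mem_nhdsWithin] with ε hε hs hpos w hw
  refine h hε (hball _ ?_)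
  rw [mem_ball_iff_norm, add_sub_cancel_left, norm_smul, Real.norm_of_nonneg (le_of_lt hpos)]
  refine lt_of_le_of_lt ?_ hs
  have : ‖w‖ ≤ |R| + 1 := (hR w hw).trans ((le_abs_self R).trans (by linarith))
  exact mul_le_mul_of_nonneg_left this (le_of_lt hpos)

/-- The test function `F` multiplied by the dilation of a family that is bounded near `z₀`: for
`ε → 0+` it is smooth with support in that of `F`, and bounded in all `C^N` norms. -/
theorem LocallyBdd.zoom {z₀ : X} {q : ℝ → X → ℂ} (hq : LocallyBdd z₀ q) {F : X → ℂ}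
    (hF : ContDiff ℝ ∞ F) (hFc : HasCompactSupport F) :
    (∀ᶠ ε : ℝ in 𝓝[>] 0, ContDiff ℝ ∞ fun w ↦ F w * q ε (z₀ + ε • w)) ∧
    ∀ m : ℕ, ∃ C, ∀ᶠ ε : ℝ in 𝓝[>] 0, ∀ w,
      ‖iteratedFDeriv ℝ m (fun w ↦ F w * q ε (z₀ + ε • w)) w‖ ≤ C := by
  have hb : Bornology.IsBounded (tsupport F) := hFc.isCompact.isBounded
  have hz : ∀ (ε : ℝ), ∀ w ∉ tsupport F,
      (fun w ↦ F w * q ε (z₀ + ε • w)) =ᶠ[𝓝 w] fun _ ↦ 0 := by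
    intro ε w hw
    filter_upwards [(isClosed_tsupport F).isOpen_compl.mem_nhds hw] with x hx
    simp [image_eq_zero_of_notMem_tsupport hx]
  have hcd : ∀ {ε : ℝ} {w : X}, ContDiffAt ℝ ∞ (q ε) (z₀ + ε • w) →
      ContDiffAt ℝ ∞ (fun w ↦ q ε (z₀ + ε • w)) w := by
    intro ε w h
    exact ContDiffAt.comp (g := q ε) w h (by fun_prop)
  refine ⟨?_, fun m ↦ ?_⟩
  · filter_upwards [eventually_forall_zoom hq.1 hb] with ε hε
    refine contDiff_iff_contDiffAt.2 fun w ↦ ?_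
    by_cases hw : w ∈ tsupport F
    · exact hF.contDiffAt.mul (hcd (hε w hw))
    · exact contDiffAt_const.congr_of_eventuallyEq (hz ε w hw)
  · choose C hC using hq.2
    have hB : ∀ i : ℕ, ∃ B, ∀ x, ‖iteratedFDeriv ℝ i F x‖ ≤ B := fun i ↦
      (hF.continuous_iteratedFDeriv (mod_cast le_top)).bounded_above_of_compact_support
        (hFc.iteratedFDeriv i)
    choose B hB using hB
    have hB0 : ∀ i, 0 ≤ B i := fun i ↦ (norm_nonneg _).trans (hB i z₀)
    refine ⟨∑ i ∈ Finset.range (m + 1), (m.choose i : ℝ) * B i * |C (m - i)|, ?_⟩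
    have h1 : ∀ᶠ ε : ℝ in 𝓝[>] 0, ε ≤ 1 := nhdsWithin_le_nhds (eventually_le_nhds zero_lt_one)
    filter_upwards [eventually_forall_zoom hq.1 hb, h1, eventually_mem_nhdsWithin,
      (Finset.eventually_all (Finset.range (m + 1))).2 fun i _ ↦
        eventually_forall_zoom (hC (m - i)) hb] with ε hε hε1 hpos hbd w
    by_cases hw : w ∈ tsupport F
    · refine (norm_iteratedFDeriv_mul_le_at m (hF.contDiffAt.of_le (mod_cast le_top))
        ((hcd (hε w hw)).of_le (mod_cast le_top))).trans (Finset.sum_le_sum fun i hi ↦ ?_)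
      have h2 : ‖iteratedFDeriv ℝ (m - i) (fun w ↦ q ε (z₀ + ε • w)) w‖ ≤ |C (m - i)| := by
        refine (norm_iteratedFDeriv_comp_affine_le _ _ (ne_of_gt hpos) _ _).trans ?_
        have h3 : |ε| ^ (m - i) ≤ 1 := by
          rw [abs_of_pos hpos]
          exact pow_le_one₀ (le_of_lt hpos) hε1
        calc _ ≤ ‖iteratedFDeriv ℝ (m - i) (q ε) (z₀ + ε • w)‖ * 1 := by gcongr
          _ ≤ |C (m - i)| := by
            rw [mul_one]
            exact (hbd i hi w hw).trans (le_abs_self _)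
      have := hB0 i
      gcongr
      exact hB i w
    · rw [((hz ε w hw).iteratedFDeriv ℝ m).self_of_nhds]
      rw [show (fun _ : X ↦ (0 : ℂ)) = 0 from rfl, iteratedFDeriv_zero]
      simp only [Pi.zero_apply, norm_zero]
      exact Finset.sum_nonneg fun i _ ↦ mul_nonneg (mul_nonneg (by positivity) (hB0 i))
        (abs_nonneg _)

/-- For a sequence of test functions, eventual bounds on the derivatives give bounds on all terms. -/
theorem eventually_bounded_testNorm {K : Compacts X} (h : ℕ → 𝓓_{K}(X, ℂ))
    (hb : ∀ m : ℕ, ∃ C, ∀ᶠ k in atTop, ∀ x, ‖iteratedFDeriv ℝ m (h k) x‖ ≤ C) (N : ℕ) :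
    ∃ C, ∀ k, testNorm K N (h k) ≤ C := by
  choose C hC using hb
  obtain ⟨k₀, hk₀⟩ := eventually_atTop.1
    ((Finset.eventually_all (Finset.range (N + 1))).2 fun m _ ↦ hC m)
  refine ⟨∑ m ∈ Finset.range (N + 1), |C m| + ∑ k ∈ Finset.range k₀, testNorm K N (h k),
    fun k ↦ ?_⟩
  rcases lt_or_ge k k₀ with hk | hk
  · have h1 : testNorm K N (h k) ≤ ∑ k ∈ Finset.range k₀, testNorm K N (h k) :=
      Finset.single_le_sum (f := fun k ↦ testNorm K N (h k)) (fun _ _ ↦ apply_nonneg _ _)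
        (Finset.mem_range.2 hk)
    have h2 : 0 ≤ ∑ m ∈ Finset.range (N + 1), |C m| := Finset.sum_nonneg fun _ _ ↦ abs_nonneg _
    linarith
  · have h2 : 0 ≤ ∑ k ∈ Finset.range k₀, testNorm K N (h k) :=
      Finset.sum_nonneg fun _ _ ↦ apply_nonneg _ _
    refine (testNorm_le_iff (add_nonneg (Finset.sum_nonneg fun _ _ ↦ abs_nonneg _) h2) _).2
      fun m hm x ↦ ?_
    have hm' : m ∈ Finset.range (N + 1) := Finset.mem_range.2 (by omega)
    have h3 : |C m| ≤ ∑ m ∈ Finset.range (N + 1), |C m| :=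
      Finset.single_le_sum (f := fun m ↦ |C m|) (fun _ _ ↦ abs_nonneg _) hm'
    have := (hk₀ k hk m hm' x).trans (le_abs_self _)
    linarith

/-- If bilinear functionals `B ε` of test functions are `O(ε^{-r})` when evaluated on fixed test
functions, then they are `o(ε^{-r'})`, `r' > r`, when evaluated on test functions that depend on `ε`
through dilations of bounded families. -/
theorem tendsto_bilinear_zoom {E : Type*} [NormedAddCommGroup E] [NormedSpace ℂ E] {z₀ : X}
    {q q' : ℝ → X → ℂ} (hq : LocallyBdd z₀ q) (hq' : LocallyBdd z₀ q') {F F' : X → ℂ}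
    (hF : ContDiff ℝ ∞ F) (hFc : HasCompactSupport F) (hF' : ContDiff ℝ ∞ F')
    (hFc' : HasCompactSupport F') (B : ℝ → (X → ℂ) → (X → ℂ) → E) {r r' : ℝ} (hr : r < r')
    (hB : ∀ K K' : Compacts X, ∀ᶠ ε : ℝ in 𝓝[>] 0,
      ∃ β : 𝓓_{K}(X, ℂ) →ₗ[ℂ] 𝓓_{K'}(X, ℂ) →ₗ[ℂ] E, (∀ h h', β h h' = B ε h h') ∧
        ∃ (N : ℕ) (A : ℝ), ∀ h h', ‖β h h'‖ ≤ A * (testNorm K N h * testNorm K' N h'))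
    (hpt : ∀ h h' : X → ℂ, ContDiff ℝ ∞ h → HasCompactSupport h → ContDiff ℝ ∞ h' →
      HasCompactSupport h' → Tendsto (fun ε ↦ ε ^ r * ‖B ε h h'‖) (𝓝[>] 0) (𝓝 0)) :
    Tendsto (fun ε ↦ ε ^ r' * ‖B ε (fun w ↦ F w * q ε (z₀ + ε • w))
      (fun w ↦ F' w * q' ε (z₀ + ε • w))‖) (𝓝[>] 0) (𝓝 0) := by
  obtain ⟨hs, hbd⟩ := hq.zoom hF hFc
  obtain ⟨hs', hbd'⟩ := hq'.zoom hF' hFc'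
  let K : Compacts X := ⟨tsupport F, hFc⟩
  let K' : Compacts X := ⟨tsupport F', hFc'⟩
  have hsupp : ∀ (G : X → ℂ) (p : X → ℂ), Function.support (fun w ↦ G w * p w) ⊆ tsupport G :=
    fun G p ↦ (Function.support_mul_subset_left G p).trans (subset_tsupport G)
  -- By Banach-Steinhaus along an arbitrary sequence `ε → 0+`, the bilinear maps `ε^r B ε` are bounded
  -- on the dilated functions; the remaining factor `ε^(r' - r)` tends to zero.
  refine tendsto_of_seq_tendsto fun x hx ↦ ?_
  obtain ⟨k₀, hk₀⟩ := eventually_atTop.1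
    (hx.eventually (hs.and (hs'.and ((hB K K').and eventually_mem_nhdsWithin))))
  rw [← tendsto_add_atTop_iff_nat k₀]
  have hx' : Tendsto (fun k ↦ x (k + k₀)) atTop (𝓝[>] 0) := (tendsto_add_atTop_iff_nat k₀).2 hx
  have hk : ∀ k, _ := fun k ↦ hk₀ (k + k₀) (Nat.le_add_left _ _)
  choose hc hc' hβ hpos using hk
  choose β hβB hβb using hβ
  let h : ℕ → 𝓓_{K}(X, ℂ) := fun k ↦
    ContDiffMapSupportedIn.of_support_subset (hc k) (hsupp F _)
  let h' : ℕ → 𝓓_{K'}(X, ℂ) := fun k ↦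
    ContDiffMapSupportedIn.of_support_subset (hc' k) (hsupp F' _)
  have hnn : ∀ k, 0 ≤ x (k + k₀) := fun k ↦ le_of_lt (hpos k)
  obtain ⟨M, hM⟩ := exists_bound_bilinear
    (fun k ↦ ((x (k + k₀) ^ r : ℝ) : ℂ) • β k)
    (fun k ↦ by
      obtain ⟨N, A, hA⟩ := hβb k
      refine ⟨N, x (k + k₀) ^ r * A, fun f f' ↦ ?_⟩
      rw [LinearMap.smul_apply, LinearMap.smul_apply, norm_smul, Complex.norm_real,
        Real.norm_of_nonneg (Real.rpow_nonneg (hnn k) _), mul_assoc]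
      exact mul_le_mul_of_nonneg_left (hA f f') (Real.rpow_nonneg (hnn k) _))
    (fun f f' ↦ by
      have h1 := ((hpt f f' f.contDiff f.compact_supp f'.contDiff f'.compact_supp).comp
        hx').bddAbove_range
      obtain ⟨C, hC⟩ := h1
      refine ⟨C, fun k ↦ ?_⟩
      rw [LinearMap.smul_apply, LinearMap.smul_apply, norm_smul, Complex.norm_real,
        Real.norm_of_nonneg (Real.rpow_nonneg (hnn k) _), hβB]
      exact hC ⟨k, rfl⟩)
    h h'
    (eventually_bounded_testNorm h fun m ↦ by
      obtain ⟨C, hC⟩ := hbd m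
      exact ⟨C, hx'.eventually hC⟩)
    (eventually_bounded_testNorm h' fun m ↦ by
      obtain ⟨C, hC⟩ := hbd' m
      exact ⟨C, hx'.eventually hC⟩)
  have hlim : Tendsto (fun k ↦ x (k + k₀) ^ (r' - r) * M) atTop (𝓝 0) := by
    simpa using ((tendsto_rpow_nhdsGT_zero (sub_pos.2 hr)).comp hx').mul_const M
  refine squeeze_zero (fun k ↦ mul_nonneg (Real.rpow_nonneg (hnn k) _) (norm_nonneg _))
    (fun k ↦ ?_) hlim
  have h1 := hM k
  rw [LinearMap.smul_apply, LinearMap.smul_apply, norm_smul, Complex.norm_real,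
    Real.norm_of_nonneg (Real.rpow_nonneg (hnn k) _), hβB] at h1
  have h2 : x (k + k₀) ^ r' = x (k + k₀) ^ (r' - r) * x (k + k₀) ^ r := by
    rw [← Real.rpow_add (hpos k), sub_add_cancel]
  change x (k + k₀) ^ r' * _ ≤ _
  rw [h2, mul_assoc]
  exact mul_le_mul_of_nonneg_left h1 (Real.rpow_nonneg (hnn k) _)

/-! ### Concentrated test functions -/

/-- The function `x ↦ c F ((x - z) / lam)`. -/
def rescale (c : ℂ) (lam : ℝ) (z : X) (F : X → ℂ) : X → ℂ := fun x ↦ c * F (lam⁻¹ • (x - z))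

theorem contDiff_rescale {F : X → ℂ} (hF : ContDiff ℝ ∞ F) (c : ℂ) (lam : ℝ) (z : X) :
    ContDiff ℝ ∞ (rescale c lam z F) :=
  contDiff_const.mul (hF.comp (by fun_prop))

theorem support_rescale_subset {F : X → ℂ} {K K' : Set X} (hF : Function.support F ⊆ K) {c : ℂ}
    {lam : ℝ} {z : X} (hl : lam ≠ 0) (hK : ∀ w ∈ K, z + lam • w ∈ K') :
    Function.support (rescale c lam z F) ⊆ K' := by
  intro x hx
  have h1 : F (lam⁻¹ • (x - z)) ≠ 0 := right_ne_zero_of_mul hx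
  have h2 := hK _ (hF h1)
  rwa [smul_smul, mul_inv_cancel₀ hl, one_smul, add_sub_cancel] at h2

theorem norm_iteratedFDeriv_rescale_le {F : X → ℂ} (hF : ContDiff ℝ ∞ F) (c : ℂ) {lam : ℝ}
    (hl : lam ≠ 0) (z : X) (m : ℕ) (x : X) :
    ‖iteratedFDeriv ℝ m (rescale c lam z F) x‖ ≤
      ‖c‖ * (‖iteratedFDeriv ℝ m F (lam⁻¹ • (x - z))‖ * |lam⁻¹| ^ m) := by
  have h1 : rescale c lam z F = fun x ↦ c • F (-(lam⁻¹ • z) + lam⁻¹ • x) := by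
    funext x
    rw [rescale, smul_sub, sub_eq_neg_add, smul_eq_mul]
  have h2 : ContDiff ℝ ∞ fun x ↦ F (-(lam⁻¹ • z) + lam⁻¹ • x) := hF.comp (by fun_prop)
  rw [h1, iteratedFDeriv_const_smul_apply' (h2.contDiffAt.of_le (mod_cast le_top)), norm_smul,
    smul_sub, sub_eq_neg_add]
  gcongr
  exact norm_iteratedFDeriv_comp_affine_le F m (inv_ne_zero hl) _ x

/-- `rescale` as a linear map between spaces of test functions. -/
def rescaleLM {K K' : Compacts X} (c : ℂ) {lam : ℝ} (hl : lam ≠ 0) (z : X)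
    (hK : ∀ w ∈ K, z + lam • w ∈ K') : 𝓓_{K}(X, ℂ) →ₗ[ℂ] 𝓓_{K'}(X, ℂ) where
  toFun h := ContDiffMapSupportedIn.of_support_subset (contDiff_rescale h.contDiff c lam z)
    (support_rescale_subset h.support_subset hl hK)
  map_add' h h' := ContDiffMapSupportedIn.ext fun x ↦ by simp [rescale, mul_add]
  map_smul' a h := ContDiffMapSupportedIn.ext fun x ↦ by simp [rescale]; ring

theorem exists_testNorm_rescaleLM_le {K K' : Compacts X} (c : ℂ) {lam : ℝ} (hl : lam ≠ 0) (z : X)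
    (hK : ∀ w ∈ K, z + lam • w ∈ K') (N : ℕ) :
    ∃ C, 0 ≤ C ∧ ∀ h, testNorm K' N (rescaleLM c hl z hK h) ≤ C * testNorm K N h := by
  refine ⟨‖c‖ * (1 + |lam⁻¹|) ^ N, by positivity, fun h ↦
    (testNorm_le_iff (mul_nonneg (by positivity) (apply_nonneg _ _)) _).2 fun m hm x ↦ ?_⟩
  refine (norm_iteratedFDeriv_rescale_le h.contDiff c hl z m x).trans ?_
  have h1 : |lam⁻¹| ^ m ≤ (1 + |lam⁻¹|) ^ N :=
    (pow_le_pow_left₀ (abs_nonneg _) (by linarith) m).trans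
      (pow_le_pow_right₀ (by linarith [abs_nonneg lam⁻¹]) hm)
  have h2 := norm_iteratedFDeriv_le_testNorm hm h (lam⁻¹ • (x - z))
  calc _ ≤ ‖c‖ * (testNorm K N h * (1 + |lam⁻¹|) ^ N) := by gcongr
    _ = _ := by ring

/-- Concentrated test functions depend continuously, in all `C^N` norms, on the point of
concentration. -/
theorem tendsto_testNorm_rescale {Y : Type*} [TopologicalSpace Y] {K : Compacts X} (c : ℂ)
    (lam : ℝ) {z : Y → X} (hz : Continuous z) {F : X → ℂ} (hF : ContDiff ℝ ∞ F)
    (hFc : HasCompactSupport F) (hl : lam ≠ 0) (φ : Y → 𝓓_{K}(X, ℂ))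
    (hφ : ∀ y, ⇑(φ y) = rescale c lam (z y) F) (N : ℕ) (y₀ : Y) :
    Tendsto (fun y ↦ testNorm K N (φ y - φ y₀)) (𝓝 y₀) (𝓝 0) := by
  set G : X → ℂ := rescale c lam 0 F with hGdef
  have hG : ContDiff ℝ ∞ G := contDiff_rescale hF c lam 0
  have hGc : HasCompactSupport G := by
    have : HasCompactSupport fun x : X ↦ F (lam⁻¹ • x) :=
      hFc.comp_smul (inv_ne_zero hl)
    have h1 : G = (fun _ ↦ c) * fun x : X ↦ F (lam⁻¹ • x) := by
      funext x
      simp [hGdef, rescale]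
    rw [h1]
    exact this.mul_left
  have hφG : ∀ y, ⇑(φ y) = fun x ↦ G (x - z y) := by
    intro y
    rw [hφ]
    funext x
    simp [G, rescale]
  have huc : ∀ m : ℕ, UniformContinuous (iteratedFDeriv ℝ m G) := fun m ↦
    (hGc.iteratedFDeriv m).uniformContinuous_of_continuous
      (hG.continuous_iteratedFDeriv (mod_cast le_top))
  rw [Metric.tendsto_nhds]
  intro η hη
  have hev : ∀ m ∈ Finset.range (N + 1), ∀ᶠ y in 𝓝 y₀, ∀ x,
      ‖iteratedFDeriv ℝ m G (x - z y) - iteratedFDeriv ℝ m G (x - z y₀)‖ ≤ η / 2 := by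
    intro m _
    obtain ⟨ρ, hρ, hd⟩ := Metric.uniformContinuous_iff.1 (huc m) (η / 2) (half_pos hη)
    filter_upwards [hz.continuousAt.eventually (Metric.ball_mem_nhds (z y₀) hρ)] with y hy x
    rw [← dist_eq_norm]
    refine (hd ?_).le
    rw [dist_sub_left]
    exact hy
  filter_upwards [(Finset.eventually_all (Finset.range (N + 1))).2 hev] with y hy
  rw [Real.dist_0_eq_abs, abs_of_nonneg (apply_nonneg _ _)]
  refine lt_of_le_of_lt ?_ (half_lt_self hη)
  refine (testNorm_le_iff (half_pos hη).le _).2 fun m hm x ↦ ?_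
  have h1 : ⇑(φ y - φ y₀) = (φ y : X → ℂ) - φ y₀ := rfl
  rw [h1, iteratedFDeriv_sub_apply ((φ y).contDiff.contDiffAt.of_le (mod_cast le_top))
    ((φ y₀).contDiff.contDiffAt.of_le (mod_cast le_top)), hφG, hφG, iteratedFDeriv_comp_sub,
    iteratedFDeriv_comp_sub]
  exact hy m (Finset.mem_range.2 (by omega)) x

end Zoom

/-! ### The metric in a coordinate chart -/

namespace LorentzManifold

variable {D : ℕ} (S : LorentzManifold.{u} D) {κ : OpenPartialHomeomorph S.M (Vec D)}

/-- The components `g(u, v)` of the metric in the chart `κ`, at the point with coordinates `z`. -/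
def chartMetric (κ : OpenPartialHomeomorph S.M (Vec D)) (z u v : Vec D) : ℝ :=
  S.g (κ.symm z) (mfderiv 𝓘(ℝ, Vec D) (𝓡 D) κ.symm z u) (mfderiv 𝓘(ℝ, Vec D) (𝓡 D) κ.symm z v)

variable {S}

theorem IsChart.mdifferentiable (hκ : S.IsChart κ) : κ.MDifferentiable (𝓡 D) (𝓡 D) :=
  ⟨(contMDiffOn_of_mem_maximalAtlas hκ).mdifferentiableOn (by simp),
    (contMDiffOn_symm_of_mem_maximalAtlas hκ).mdifferentiableOn (by simp)⟩

theorem contMDiffOn_mfderiv_symm (hκ : S.IsChart κ) (u : Vec D) :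
    ContMDiffOn 𝓘(ℝ, Vec D) (𝓡 D).tangent ∞
      (fun z ↦ (⟨κ.symm z, mfderiv 𝓘(ℝ, Vec D) (𝓡 D) κ.symm z u⟩ : TangentBundle (𝓡 D) S.M))
      κ.target := by
  have h1 := (contMDiffOn_symm_of_mem_maximalAtlas hκ).contMDiffOn_tangentMapWithin (m := ∞)
    (by simp) κ.open_target.uniqueMDiffOn
  have h2 : ContMDiffOn 𝓘(ℝ, Vec D) 𝓘(ℝ, Vec D).tangent ∞
      (fun z : Vec D ↦ (⟨z, u⟩ : TangentBundle 𝓘(ℝ, Vec D) (Vec D))) κ.target :=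
    contMDiffOn_vectorSpace_iff_contDiffOn.2 contDiffOn_const
  refine (h1.comp h2 fun z hz ↦ hz).congr fun z hz ↦ ?_
  simp only [Function.comp, tangentMapWithin, mfderivWithin_of_isOpen κ.open_target hz]

theorem contDiffOn_chartMetric (hκ : S.IsChart κ) (u v : Vec D) :
    ContDiffOn ℝ ∞ (fun z ↦ S.chartMetric κ z u v) κ.target := by
  rw [← contMDiffOn_iff_contDiffOn]
  intro z hz
  have hb : ContMDiffWithinAt 𝓘(ℝ, Vec D) (𝓡 D) ∞ κ.symm κ.target z :=
    contMDiffOn_symm_of_mem_maximalAtlas hκ z hz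
  have : ContMDiffWithinAt 𝓘(ℝ, Vec D) ((𝓡 D).prod 𝓘(ℝ)) ∞
      (fun z ↦ Bundle.TotalSpace.mk' ℝ (E := Bundle.Trivial S.M ℝ) (κ.symm z)
        (S.chartMetric κ z u v)) κ.target z := by
    apply ContMDiffWithinAt.clm_bundle_apply₂ (F₁ := Vec D) (F₂ := Vec D)
    · exact ContMDiffAt.comp_contMDiffWithinAt z S.g_smooth.contMDiffAt hb
    · exact contMDiffOn_mfderiv_symm hκ u z hz
    · exact contMDiffOn_mfderiv_symm hκ v z hz
  simp only [Bundle.contMDiffWithinAt_totalSpace] at this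
  exact this.2

/-- The metric is determined by its matrix of components, which reduces its regularity in all arguments
to that of finitely many functions of `z`. -/
theorem chartMetric_eq_sum (κ : OpenPartialHomeomorph S.M (Vec D)) (z u v : Vec D) :
    S.chartMetric κ z u v = ∑ i, ∑ j, u i * v j * S.chartMetric κ z
      (EuclideanSpace.single i 1) (EuclideanSpace.single j 1) := by
  have hsum : ∀ u : Vec D, u = ∑ i, u i • (EuclideanSpace.single i (1 : ℝ) : Vec D) := by
    intro u
    ext k
    simp [Finset.sum_apply, Pi.single_apply]
  have h1 : ∀ u : Vec D, mfderiv 𝓘(ℝ, Vec D) (𝓡 D) κ.symm z u =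
      ∑ i, u i • mfderiv 𝓘(ℝ, Vec D) (𝓡 D) κ.symm z (EuclideanSpace.single i (1 : ℝ) : Vec D) := by
    intro u
    conv_lhs => rw [hsum u]
    erw [map_sum]
    refine Finset.sum_congr rfl fun i _ ↦ ?_
    erw [map_smul]
  simp only [chartMetric]
  rw [h1 u, h1 v]
  simp only [map_sum, map_smul, _root_.sum_apply, _root_.smul_apply, smul_eq_mul, mul_assoc,
    Finset.mul_sum]
  rw [Finset.sum_comm]
  exact Finset.sum_congr rfl fun i _ ↦ Finset.sum_congr rfl fun j _ ↦ mul_left_comm _ _ _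

theorem continuousOn_chartMetric (hκ : S.IsChart κ) :
    ContinuousOn (fun p : Vec D × Vec D ↦ S.chartMetric κ p.1 p.2 p.2) (κ.target ×ˢ univ) := by
  refine ContinuousOn.congr ?_ fun p _ ↦ chartMetric_eq_sum κ p.1 p.2 p.2
  refine continuousOn_finsetSum _ fun i _ ↦ continuousOn_finsetSum _ fun j _ ↦ ?_
  refine ContinuousOn.mul (by fun_prop) ?_
  exact (contDiffOn_chartMetric hκ _ _).continuousOn.comp continuousOn_fst fun p hp ↦ hp.1

theorem mfderiv_symm_injective (hκ : S.IsChart κ) {z : Vec D} (hz : z ∈ κ.target) :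
    Function.Injective (mfderiv 𝓘(ℝ, Vec D) (𝓡 D) κ.symm z) :=
  hκ.mdifferentiable.symm.mfderiv_injective hz

theorem mfderiv_symm_mfderiv (hκ : S.IsChart κ) {x : S.M} (hx : x ∈ κ.source) (v : Vec D) :
    (mfderiv 𝓘(ℝ, Vec D) (𝓡 D) κ.symm (κ x) (mfderiv (𝓡 D) 𝓘(ℝ, Vec D) κ x v) : Vec D) = v :=
  congrArg (fun f ↦ f v) (hκ.mdifferentiable.symm_comp_deriv hx)

/-- The metric is nondegenerate: a vector in its kernel would be orthogonal to a timelike vector. -/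
theorem det_chartMetric_ne_zero (hκ : S.IsChart κ) {z : Vec D} (hz : z ∈ κ.target) :
    Matrix.det (Matrix.of fun i j : Fin D ↦ S.chartMetric κ z
      (EuclideanSpace.single i 1) (EuclideanSpace.single j 1)) ≠ 0 := by
  intro h0
  obtain ⟨v, hv, hv0⟩ := Matrix.exists_vecMul_eq_zero_iff.2 h0
  set w : Vec D := WithLp.toLp 2 v
  have hw : ∀ u, S.chartMetric κ z w u = 0 := by
    intro u
    rw [chartMetric_eq_sum, Finset.sum_comm]
    refine Finset.sum_eq_zero fun j _ ↦ ?_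
    have := congrFun hv0 j
    simp only [Matrix.vecMul, dotProduct, Matrix.of_apply, Pi.zero_apply] at this
    calc _ = u j * ∑ i, v i * S.chartMetric κ z (EuclideanSpace.single i 1)
          (EuclideanSpace.single j 1) := by
            rw [Finset.mul_sum]
            exact Finset.sum_congr rfl fun i _ ↦ by simp only [w]; ring
      _ = 0 := by rw [this, mul_zero]
  have hsurj : Function.Surjective (mfderiv 𝓘(ℝ, Vec D) (𝓡 D) κ.symm z) :=
    hκ.mdifferentiable.symm.mfderiv_surjective hz
  obtain ⟨t, ht, htpos⟩ := S.g_lorentz (κ.symm z)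
  obtain ⟨t', rfl⟩ := hsurj t
  have hne : mfderiv 𝓘(ℝ, Vec D) (𝓡 D) κ.symm z w ≠ 0 := by
    intro h
    apply hv
    have h2 : w = 0 := mfderiv_symm_injective hκ hz (by rw [h]; exact (map_zero _).symm)
    funext i
    exact congrFun (congrArg WithLp.ofLp h2) i
  have h1 := htpos (mfderiv 𝓘(ℝ, Vec D) (𝓡 D) κ.symm z w)
    (by rw [S.g_symm]; exact hw t') hne
  exact h1.ne' (hw w)

theorem volDensity_pos (hκ : S.IsChart κ) {z : Vec D} (hz : z ∈ κ.target) :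
    0 < S.volDensity κ z :=
  Real.sqrt_pos.2 (abs_pos.2 (det_chartMetric_ne_zero hκ hz))

theorem contDiffOn_volDensity (hκ : S.IsChart κ) :
    ContDiffOn ℝ ∞ (S.volDensity κ) κ.target := by
  have hdet : ContDiffOn ℝ ∞ (fun z ↦ Matrix.det (Matrix.of fun i j : Fin D ↦
      S.chartMetric κ z (EuclideanSpace.single i 1) (EuclideanSpace.single j 1))) κ.target := by
    simp only [Matrix.det_apply, Matrix.of_apply]
    refine ContDiffOn.sum fun σ _ ↦ ContDiffOn.const_smul _ ?_
    exact contDiffOn_prod fun i _ ↦ contDiffOn_chartMetric hκ _ _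
  intro z hz
  have h0 := det_chartMetric_ne_zero hκ hz
  refine ContDiffWithinAt.sqrt ?_ (abs_ne_zero.2 h0)
  exact (contDiffAt_abs h0).comp_contDiffWithinAt z (hdet z hz)

/-! ### Causality in a coordinate chart -/

theorem fderiv_time_comp_symm (hκ : S.IsChart κ) {z : Vec D} (hz : z ∈ κ.target) (u : Vec D) :
    fderiv ℝ (S.T ∘ κ.symm) z u = mfderiv (𝓡 D) 𝓘(ℝ, ℝ) S.T (κ.symm z)
      (mfderiv 𝓘(ℝ, Vec D) (𝓡 D) κ.symm z u) := by
  have h1 := mfderiv_comp z (S.T_smooth.mdifferentiable (by simp) (κ.symm z))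
    (hκ.mdifferentiable.mdifferentiableAt_symm hz)
  rw [mfderiv_eq_fderiv] at h1
  exact congrArg (fun f ↦ f u) h1

/-- Near a point, the coordinate vectors of future directed causal vectors lie in the fixed cone
`c ‖u‖ ≤ L u`, where `L` is the differential of the time function at the point. -/
theorem exists_cone (hκ : S.IsChart κ) {z₀ : Vec D} (hz₀ : z₀ ∈ κ.target) :
    ∃ c > 0, ∀ᶠ z in 𝓝 z₀, ∀ u, S.chartMetric κ z u u ≤ 0 →
      0 < fderiv ℝ (S.T ∘ κ.symm) z u → c * ‖u‖ ≤ fderiv ℝ (S.T ∘ κ.symm) z₀ u := by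
  set τ : Vec D → Vec D →L[ℝ] ℝ := fderiv ℝ (S.T ∘ κ.symm) with hτ
  have hTs : ContDiffOn ℝ ∞ (S.T ∘ κ.symm) κ.target := by
    rw [← contMDiffOn_iff_contDiffOn]
    exact S.T_smooth.comp_contMDiffOn (contMDiffOn_symm_of_mem_maximalAtlas hκ)
  have hτc : ContinuousOn (fun p : Vec D × Vec D ↦ τ p.1 p.2) (κ.target ×ˢ univ) := by
    have h1 : ContinuousOn τ κ.target := hTs.continuousOn_fderiv_of_isOpen κ.open_target (by simp)
    exact (h1.comp continuousOn_fst fun p hp ↦ hp.1).clm_apply continuousOn_snd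
  have hQc := continuousOn_chartMetric hκ
  have hopen : IsOpen (κ.target ×ˢ (univ : Set (Vec D))) := κ.open_target.prod isOpen_univ
  have hτpos : ∀ u ≠ 0, S.chartMetric κ z₀ u u ≤ 0 → 0 ≤ τ z₀ u → 0 < τ z₀ u := by
    intro u hu hQ h0
    refine lt_of_le_of_ne h0 (Ne.symm ?_)
    rw [hτ, fderiv_time_comp_symm hκ hz₀]
    refine S.T_time _ _ (fun h ↦ hu ?_) hQ
    exact mfderiv_symm_injective hκ hz₀ (h.trans (map_zero _).symm)
  -- On the compact set of future directed causal unit vectors at `z₀`, the linear form is bounded below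
  -- by a positive constant, as causal vectors are not annihilated by the differential of time.
  have hC : IsCompact {u ∈ Metric.sphere (0 : Vec D) 1 |
      S.chartMetric κ z₀ u u ≤ 0 ∧ 0 ≤ τ z₀ u} := by
    refine (isCompact_sphere 0 1).inter_right ?_
    have hQ0 : Continuous fun u ↦ S.chartMetric κ z₀ u u :=
      continuousOn_univ.1 (hQc.comp (f := fun u ↦ (z₀, u)) (by fun_prop) fun u _ ↦ ⟨hz₀, trivial⟩)
    exact (isClosed_le hQ0 continuous_const).inter (isClosed_le continuous_const (τ z₀).continuous)
  obtain ⟨c, hc, hcC⟩ : ∃ c > 0, ∀ u ∈ {u ∈ Metric.sphere (0 : Vec D) 1 |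
      S.chartMetric κ z₀ u u ≤ 0 ∧ 0 ≤ τ z₀ u}, c < τ z₀ u := by
    rcases eq_empty_or_nonempty {u ∈ Metric.sphere (0 : Vec D) 1 |
      S.chartMetric κ z₀ u u ≤ 0 ∧ 0 ≤ τ z₀ u} with he | hne
    · exact ⟨1, one_pos, fun u hu ↦ by rw [he] at hu; exact hu.elim⟩
    · obtain ⟨u₀, hu₀, hmin⟩ := hC.exists_isMinOn hne (τ z₀).continuous.continuousOn
      have hpos := hτpos u₀ (ne_zero_of_mem_unit_sphere ⟨u₀, hu₀.1⟩) hu₀.2.1 hu₀.2.2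
      exact ⟨τ z₀ u₀ / 2, half_pos hpos, fun u hu ↦ lt_of_lt_of_le (half_lt_self hpos) (hmin hu)⟩
  refine ⟨c, hc, ?_⟩
  -- By compactness of the unit sphere, the bound persists for the causal vectors at nearby points.
  have hev : ∀ᶠ z in 𝓝 z₀, ∀ u ∈ Metric.sphere (0 : Vec D) 1,
      S.chartMetric κ z u u ≤ 0 → 0 < τ z u → c < τ z₀ u := by
    refine (isCompact_sphere 0 1).eventually_forall_of_forall_eventually fun u hu ↦ ?_
    have hmem : (z₀, u) ∈ κ.target ×ˢ (univ : Set (Vec D)) := ⟨hz₀, trivial⟩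
    by_cases hQ : 0 < S.chartMetric κ z₀ u u
    · filter_upwards [(hQc.continuousAt (hopen.mem_nhds hmem)).eventually (lt_mem_nhds hQ)]
        with p hp h1 using absurd h1 (not_le.2 hp)
    by_cases hT : τ z₀ u < 0
    · filter_upwards [(hτc.continuousAt (hopen.mem_nhds hmem)).eventually (gt_mem_nhds hT)]
        with p hp _ h2 using absurd h2 (not_lt.2 (le_of_lt hp))
    have hlt := hcC u ⟨hu, not_lt.1 hQ, not_lt.1 hT⟩
    have hcont : ContinuousAt (fun p : Vec D × Vec D ↦ τ z₀ p.2) (z₀, u) := by fun_prop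
    filter_upwards [hcont.eventually (lt_mem_nhds hlt)] with p hp _ _ using hp
  filter_upwards [hev] with z hz u hQ hT
  have hu0 : u ≠ 0 := fun h ↦ by simp [h] at hT
  have hn : 0 < ‖u‖ := norm_pos_iff.2 hu0
  have hscale : ∀ L : Vec D →L[ℝ] ℝ, L (‖u‖⁻¹ • u) = ‖u‖⁻¹ * L u := fun L ↦ by simp
  have h1 := hz (‖u‖⁻¹ • u) (by simp [norm_smul, hn.ne'])
    (by
      have : S.chartMetric κ z (‖u‖⁻¹ • u) (‖u‖⁻¹ • u) =
          ‖u‖⁻¹ * (‖u‖⁻¹ * S.chartMetric κ z u u) := by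
        rw [chartMetric_eq_sum, chartMetric_eq_sum κ z u u]
        simp only [Finset.mul_sum, PiLp.smul_apply, smul_eq_mul]
        exact Finset.sum_congr rfl fun i _ ↦ Finset.sum_congr rfl fun j _ ↦ by ring
      rw [this]
      exact mul_nonpos_of_nonneg_of_nonpos (by positivity)
        (mul_nonpos_of_nonneg_of_nonpos (by positivity) hQ))
    (by rw [hscale]; positivity)
  rw [hscale, lt_inv_mul_iff₀ hn] at h1
  rw [mul_comm]
  exact h1.le

/-- Parts of causal curve segments are causal. -/
theorem causallyPrecedes_of_segment {γ : ℝ → S.M}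
    (hγ : ContMDiffOn 𝓘(ℝ, ℝ) (𝓡 D) 1 γ (Icc 0 1))
    (hc : ∀ t ∈ Icc (0 : ℝ) 1,
      S.g (γ t) (mfderivWithin 𝓘(ℝ, ℝ) (𝓡 D) γ (Icc 0 1) t (1 : ℝ))
        (mfderivWithin 𝓘(ℝ, ℝ) (𝓡 D) γ (Icc 0 1) t (1 : ℝ)) ≤ 0 ∧
      (0 : ℝ) < mfderiv (𝓡 D) 𝓘(ℝ, ℝ) S.T (γ t)
        (mfderivWithin 𝓘(ℝ, ℝ) (𝓡 D) γ (Icc 0 1) t (1 : ℝ)))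
    {s t : ℝ} (hs : s ∈ Icc (0 : ℝ) 1) (ht : t ∈ Icc (0 : ℝ) 1) (hst : s ≤ t) :
    S.CausallyPrecedes (γ s) (γ t) := by
  rcases hst.eq_or_lt with rfl | hlt
  · exact Relation.ReflTransGen.refl
  refine Relation.ReflTransGen.single ⟨fun r ↦ γ (s + (t - s) * r), ?_, by simp, by simp, ?_⟩
  all_goals
    have hmaps : MapsTo (fun r : ℝ ↦ s + (t - s) * r) (Icc 0 1) (Icc 0 1) := fun r hr ↦ by
      have h1 : 0 ≤ (t - s) * r := mul_nonneg (sub_nonneg.2 hst) hr.1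
      have h2 : (t - s) * r ≤ t - s := mul_le_of_le_one_right (sub_nonneg.2 hst) hr.2
      exact ⟨by linarith [hs.1], by linarith [ht.2]⟩
  · refine hγ.comp ?_ hmaps
    exact ContDiff.contMDiff (by fun_prop) |>.contMDiffOn
  · intro r hr
    have hu : UniqueMDiffWithinAt 𝓘(ℝ, ℝ) (Icc (0 : ℝ) 1) r :=
      (uniqueDiffOn_Icc zero_lt_one r hr).uniqueMDiffWithinAt
    have hA : HasMFDerivWithinAt 𝓘(ℝ, ℝ) 𝓘(ℝ, ℝ) (fun r : ℝ ↦ s + (t - s) * r) (Icc 0 1) r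
        ((t - s) • ContinuousLinearMap.id ℝ ℝ : ℝ →L[ℝ] ℝ) :=
      (((hasFDerivWithinAt_id r _).const_mul (t - s)).const_add s).hasMFDerivWithinAt
    have hg : HasMFDerivWithinAt 𝓘(ℝ, ℝ) (𝓡 D) γ (Icc 0 1) (s + (t - s) * r) _ :=
      ((hγ.mdifferentiableOn (by simp)) _ (hmaps hr)).hasMFDerivWithinAt
    have hcomp := (HasMFDerivWithinAt.comp (f := fun r : ℝ ↦ s + (t - s) * r) (u := Icc 0 1)
      r hg hA hmaps).mfderivWithin hu
    have hval : mfderivWithin 𝓘(ℝ, ℝ) (𝓡 D) (fun r ↦ γ (s + (t - s) * r)) (Icc 0 1) r (1 : ℝ) =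
        (t - s) • mfderivWithin 𝓘(ℝ, ℝ) (𝓡 D) γ (Icc 0 1) (s + (t - s) * r) (1 : ℝ) := by
      refine (congrArg (fun f ↦ f (1 : ℝ)) hcomp).trans ?_
      change mfderivWithin 𝓘(ℝ, ℝ) (𝓡 D) γ (Icc 0 1) (s + (t - s) * r) ((t - s) • (1 : ℝ)) = _
      exact map_smul _ _ _
    obtain ⟨h1, h2⟩ := hc _ (hmaps hr)
    have hpos : 0 < t - s := sub_pos.2 hlt
    erw [hval]
    constructor
    · erw [map_smul, map_smul]
      simp only [_root_.smul_apply, smul_eq_mul]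
      exact mul_nonpos_of_nonneg_of_nonpos hpos.le (mul_nonpos_of_nonneg_of_nonpos hpos.le h1)
    · erw [map_smul]
      exact mul_pos hpos h2

end LorentzManifold

/-- In a chart near `y`, the coordinate difference of two causally related points lies in a fixed
cone `c ‖u‖ ≤ L u`. By strong causality, causal curves with end points near `y` stay in a small
coordinate ball, so that `exists_cone` can be integrated along them. -/
theorem Spacetime.exists_causal_cone {D : ℕ} (S : Spacetime.{u} D)
    {κ : OpenPartialHomeomorph S.M (Vec D)} (hκ : S.IsChart κ) {y : S.M} (hy : y ∈ κ.source) :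
    ∃ (L : Vec D →L[ℝ] ℝ) (c : ℝ), 0 < c ∧ ∃ V ∈ 𝓝 y, ∀ p ∈ V, ∀ q ∈ V,
      S.CausallyPrecedes p q → c * ‖κ q - κ p‖ ≤ L (κ q - κ p) := by
  obtain ⟨c, hc, hcone⟩ := LorentzManifold.exists_cone hκ (κ.map_source hy)
  set L := fderiv ℝ (S.T ∘ κ.symm) (κ y)
  have hU : {x | x ∈ κ.source ∧ ∀ u, S.chartMetric κ (κ x) u u ≤ 0 →
      0 < fderiv ℝ (S.T ∘ κ.symm) (κ x) u → c * ‖u‖ ≤ L u} ∈ 𝓝 y :=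
    inter_mem (κ.open_source.mem_nhds hy) ((κ.continuousAt hy).eventually hcone)
  obtain ⟨V, hV, hVU⟩ := S.globallyHyperbolic.1 y _ hU
  refine ⟨L, c, hc, V, hV, fun p hp q hq hpq ↦ ?_⟩
  have hseg : ∀ a b, S.CausallyPrecedes p a → S.CausalSegment a b → S.CausallyPrecedes b q →
      c * ‖κ b - κ a‖ ≤ L (κ b - κ a) := by
    rintro a b hpa ⟨γ, hγ, rfl, rfl, hcaus⟩ hbq
    have hin : ∀ t ∈ Icc (0 : ℝ) 1, γ t ∈ κ.source ∧ ∀ u, S.chartMetric κ (κ (γ t)) u u ≤ 0 →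
        0 < fderiv ℝ (S.T ∘ κ.symm) (κ (γ t)) u → c * ‖u‖ ≤ L u := by
      intro t ht
      refine hVU p hp q hq (γ t) (hpa.trans ?_) (Relation.ReflTransGen.trans ?_ hbq)
      · exact LorentzManifold.causallyPrecedes_of_segment hγ hcaus (by simp) ht ht.1
      · exact LorentzManifold.causallyPrecedes_of_segment hγ hcaus ht (by simp) ht.2
    let u : ℝ → Vec D := fun t ↦ mfderiv (𝓡 D) 𝓘(ℝ, Vec D) κ (γ t)
      (mfderivWithin 𝓘(ℝ, ℝ) (𝓡 D) γ (Icc 0 1) t (1 : ℝ))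
    have hder : ∀ t ∈ Icc (0 : ℝ) 1, HasDerivWithinAt (κ ∘ γ) (u t) (Icc 0 1) t := by
      intro t ht
      have h1 := ((hγ.mdifferentiableOn (by simp)) t ht).hasMFDerivWithinAt
      have h2 := (hκ.mdifferentiable.mdifferentiableAt (hin t ht).1).hasMFDerivAt
      have h3 := h2.comp_hasMFDerivWithinAt t h1
      let A : Vec D →L[ℝ] Vec D := mfderiv (𝓡 D) 𝓘(ℝ, Vec D) κ (γ t)
      let B : ℝ →L[ℝ] Vec D := mfderivWithin 𝓘(ℝ, ℝ) (𝓡 D) γ (Icc 0 1) t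
      have h4 : HasFDerivWithinAt (κ ∘ γ) (A.comp B) (Icc 0 1) t :=
        hasMFDerivWithinAt_iff_hasFDerivWithinAt.1 h3
      exact h4.hasDerivWithinAt
    have hbound : ∀ t ∈ Icc (0 : ℝ) 1, c * ‖u t‖ ≤ L (u t) := by
      intro t ht
      obtain ⟨hx, hcn⟩ := hin t ht
      obtain ⟨h1, h2⟩ := hcaus t ht
      have hu := LorentzManifold.mfderiv_symm_mfderiv hκ hx
        (mfderivWithin 𝓘(ℝ, ℝ) (𝓡 D) γ (Icc 0 1) t (1 : ℝ))
      refine hcn (u t) ?_ ?_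
      -- The fibres over `γ t` and over `κ.symm (κ (γ t))` are different types, so the equality of
      -- base points has to be generalized before it is used.
      · have hg : ∀ x, x = γ t → ∀ w : Vec D,
            w = mfderivWithin 𝓘(ℝ, ℝ) (𝓡 D) γ (Icc 0 1) t (1 : ℝ) → S.g x w w ≤ 0 := by
          rintro _ rfl _ rfl
          exact h1
        exact hg _ (κ.left_inv hx) _ hu
      · have hT : ∀ x, x = γ t → ∀ w : Vec D,
            w = mfderivWithin 𝓘(ℝ, ℝ) (𝓡 D) γ (Icc 0 1) t (1 : ℝ) →
            (0 : ℝ) < mfderiv (𝓡 D) 𝓘(ℝ, ℝ) S.T x w := by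
          rintro _ rfl _ rfl
          exact h2
        rw [LorentzManifold.fderiv_time_comp_symm hκ (κ.map_source hx)]
        exact hT _ (κ.left_inv hx) _ hu
    -- The bound on the velocity integrates to a bound on the displacement.
    have hmono : ∀ t ∈ Ico (0 : ℝ) 1, Icc (0 : ℝ) 1 ∈ 𝓝[≥] t := fun t ht ↦
      mem_of_superset (Icc_mem_nhdsGE ht.2) (Icc_subset_Icc_left ht.1)
    have hcontd : ContinuousOn (κ ∘ γ) (Icc 0 1) := fun t ht ↦ (hder t ht).continuousWithinAt
    have := image_norm_le_of_norm_deriv_right_le_deriv_boundary'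
      (f := fun t ↦ (κ ∘ γ) t - κ (γ 0)) (f' := u) (a := 0) (b := 1)
      (B := fun t ↦ c⁻¹ * L ((κ ∘ γ) t - κ (γ 0))) (B' := fun t ↦ c⁻¹ * L (u t))
      (hcontd.sub continuousOn_const)
      (fun t ht ↦ ((hder t (Ico_subset_Icc_self ht)).mono_of_mem_nhdsWithin
        (hmono t ht)).sub_const _)
      (by simp)
      (continuousOn_const.mul (L.continuous.comp_continuousOn (hcontd.sub continuousOn_const)))
      (fun t ht ↦ ((L.hasFDerivAt.comp_hasDerivWithinAt t
        (((hder t (Ico_subset_Icc_self ht)).mono_of_mem_nhdsWithin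
          (hmono t ht)).sub_const _))).const_mul _)
      (fun t ht ↦ by
        rw [le_inv_mul_iff₀ hc]
        exact hbound t (Ico_subset_Icc_self ht))
      (right_mem_Icc.2 zero_le_one)
    rwa [le_inv_mul_iff₀ hc] at this
  have hind : ∀ q', S.CausallyPrecedes p q' → S.CausallyPrecedes q' q →
      c * ‖κ q' - κ p‖ ≤ L (κ q' - κ p) := by
    intro q' h
    induction h with
    | refl => simp
    | tail hpb hbq' ih =>
      rename_i b q'
      intro hq'
      have h1 := ih (Relation.ReflTransGen.head hbq' hq')
      have h2 := hseg _ _ hpb hbq' hq'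
      have h3 : κ q' - κ p = (κ q' - κ b) + (κ b - κ p) := by abel
      rw [h3, map_add]
      calc c * ‖κ q' - κ b + (κ b - κ p)‖ ≤ c * (‖κ q' - κ b‖ + ‖κ b - κ p‖) := by
            gcongr
            exact norm_add_le _ _
        _ ≤ _ := by rw [mul_add]; exact add_le_add h2 h1
  exact hind q hpq Relation.ReflTransGen.refl

/-! ### Sections with small support -/

/-- A function that is smooth on an open set `O` and vanishes off a closed subset of `O` is smooth. -/
theorem contMDiffOn_of_zero_off {EN HN N F : Type*} [NormedAddCommGroup EN] [NormedSpace ℝ EN]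
    [TopologicalSpace HN] {I : ModelWithCorners ℝ EN HN} [TopologicalSpace N] [ChartedSpace HN N]
    [NormedAddCommGroup F] [NormedSpace ℝ F] {O C A : Set N} (hO : IsOpen O) (hC : IsClosed C)
    (hCO : C ⊆ O) {f g : N → F} (hg : ContMDiffOn I 𝓘(ℝ, F) ∞ g (O ∩ A))
    (hfg : ∀ x ∈ O ∩ A, f x = g x) (h0 : ∀ x ∉ C, f x = 0) : ContMDiffOn I 𝓘(ℝ, F) ∞ f A := by
  intro x hx
  by_cases hxO : x ∈ O
  · have h1 : ContMDiffWithinAt I 𝓘(ℝ, F) ∞ f (O ∩ A) x :=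
      (hg x ⟨hxO, hx⟩).congr (fun z hz ↦ hfg z hz) (hfg x ⟨hxO, hx⟩)
    rwa [inter_comm, contMDiffWithinAt_inter (hO.mem_nhds hxO)] at h1
  · have h1 : f =ᶠ[𝓝 x] fun _ ↦ 0 := by
      filter_upwards [hC.isOpen_compl.mem_nhds fun h ↦ hxO (hCO h)] with z hz using h0 z hz
    exact (contMDiffAt_const.congr_of_eventuallyEq h1).contMDiffWithinAt

theorem contMDiffOn_smul_complex {EN HN N F : Type*} [NormedAddCommGroup EN] [NormedSpace ℝ EN]
    [TopologicalSpace HN] {I : ModelWithCorners ℝ EN HN} [TopologicalSpace N] [ChartedSpace HN N]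
    [NormedAddCommGroup F] [NormedSpace ℂ F] {A : Set N} {f : N → ℂ} {g : N → F}
    (hf : ContMDiffOn I 𝓘(ℝ, ℂ) ∞ f A) (hg : ContMDiffOn I 𝓘(ℝ, F) ∞ g A) :
    ContMDiffOn I 𝓘(ℝ, F) ∞ (fun x ↦ f x • g x) A :=
  (contDiff_smul (𝕜 := ℝ) (𝕜' := ℂ) (F := F)).contMDiff.comp_contMDiffOn (hf.prodMk_space hg)

namespace CBundle

variable {D : ℕ} {S : Spacetime.{u} D} (W : CBundle S) {κ : OpenPartialHomeomorph S.M (Vec D)}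

@[simp]
theorem rep_smul (a : W.idx) (x : S.M) (c : ℂ) (v : W.Fib) : W.rep a x (c • v) = c • W.rep a x v :=
  map_smul _ _ _

@[simp]
theorem rep_zero (a : W.idx) (x : S.M) : W.rep a x 0 = 0 := map_zero _

theorem rep_indexAt (x : S.M) (v : W.Fib) : W.rep (W.core.indexAt x) x v = v :=
  W.core.coordChange_self _ _ (W.core.mem_baseSet_at x) _

/-- The section `x ↦ h(κ x) s(x)`, for a function `h` of the coordinates. -/
def chartMul (κ : OpenPartialHomeomorph S.M (Vec D)) (h : Vec D → ℂ) (s : S.M → W.Fib) :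
    S.M → W.Fib :=
  κ.source.indicator fun x ↦ h (κ x) • s x

theorem chartMul_apply_of_mem {h : Vec D → ℂ} {s : S.M → W.Fib} {x : S.M} (hx : x ∈ κ.source) :
    W.chartMul κ h s x = h (κ x) • s x := indicator_of_mem hx _

theorem chartMul_add_smul (h h' : Vec D → ℂ) (c : ℂ) (s : S.M → W.Fib) :
    W.chartMul κ (h + c • h') s = W.chartMul κ h s + c • W.chartMul κ h' s := by
  funext x
  by_cases hx : x ∈ κ.source <;> simp [chartMul, hx, add_smul, mul_smul]

theorem chartMul_zero (s : S.M → W.Fib) : W.chartMul κ 0 s = 0 := by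
  funext x
  simp [chartMul]

theorem isClosed_symm_image {K : Set (Vec D)} (hK : IsCompact K) (hKt : K ⊆ κ.target) :
    IsClosed (κ.symm '' K) :=
  (hK.image_of_continuousOn (κ.continuousOn_symm.mono hKt)).isClosed

theorem chartMul_eq_zero {h : Vec D → ℂ} {s : S.M → W.Fib} {K : Set (Vec D)}
    (hh : Function.support h ⊆ K) {x : S.M} (hx : x ∉ κ.symm '' K) : W.chartMul κ h s x = 0 := by
  by_cases hxs : x ∈ κ.source
  · rw [chartMul_apply_of_mem _ hxs]
    have : h (κ x) = 0 := by
      by_contra h0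
      exact hx ⟨κ x, hh h0, κ.left_inv hxs⟩
    rw [this, zero_smul]
  · exact indicator_of_notMem hxs _

theorem tsupport_chartMul_subset {h : Vec D → ℂ} {s : S.M → W.Fib} {K : Set (Vec D)}
    (hK : IsCompact K) (hKt : K ⊆ κ.target) (hh : Function.support h ⊆ K) :
    tsupport (W.chartMul κ h s) ⊆ κ.symm '' K := by
  refine closure_minimal (fun x hx ↦ ?_) (isClosed_symm_image hK hKt)
  by_contra h0
  exact hx (W.chartMul_eq_zero hh h0)

theorem isTest_chartMul (hκ : S.IsChart κ) {h : Vec D → ℂ} {s : S.M → W.Fib} {K : Set (Vec D)}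
    (hK : IsCompact K) (hKt : K ⊆ κ.target) (hh : Function.support h ⊆ K) (hd : ContDiff ℝ ∞ h)
    (hs : W.IsSmooth s) : W.IsTest (W.chartMul κ h s) := by
  have hc := hK.image_of_continuousOn (κ.continuousOn_symm.mono hKt)
  refine ⟨fun a ↦ ?_, hc.of_isClosed_subset (isClosed_tsupport _)
    (W.tsupport_chartMul_subset hK hKt hh)⟩
  rw [univ_inter]
  refine contMDiffOn_of_zero_off (C := κ.symm '' K) κ.open_source (isClosed_symm_image hK hKt)
    ((image_mono hKt).trans κ.symm_image_target_eq_source.subset)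
    (g := fun x ↦ h (κ x) • W.rep a x (s x)) ?_ (fun x hx ↦ ?_) fun x hx ↦ ?_
  · have h1 : ContMDiffOn (𝓡 D) 𝓘(ℝ, ℂ) ∞ (h ∘ κ) (κ.source ∩ W.core.baseSet a) :=
      hd.contMDiff.comp_contMDiffOn
        ((contMDiffOn_of_mem_maximalAtlas hκ).mono inter_subset_left)
    exact contMDiffOn_smul_complex h1 ((hs a).mono (inter_subset_inter_left _ (subset_univ _)))
  · rw [chartMul_apply_of_mem _ hx.1, rep_smul]
  · rw [W.chartMul_eq_zero hh hx, rep_zero]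

/-- Near each point of the domain of a local trivialization, there is a frame of sections that are
globally smooth. -/
theorem exists_local_frame (a : W.idx) {y : S.M} (hy : y ∈ W.core.baseSet a) :
    ∃ s : Fin W.rank → S.M → W.Fib, (∀ m, W.IsSmooth (s m)) ∧
      ∀ᶠ x in 𝓝 y, x ∈ W.core.baseSet a ∧ ∀ v, v = ∑ m, W.rep a x v m • s m x := by
  obtain ⟨χ, -, hχ⟩ := (SmoothBumpFunction.nhds_basis_tsupport (I := 𝓡 D) y).mem_iff.1
    ((W.core.isOpen_baseSet a).mem_nhds hy)
  refine ⟨fun m x ↦ χ x • W.core.coordChange a (W.core.indexAt x) x (Pi.single m 1),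
    fun m a' ↦ ?_, ?_⟩
  · rw [univ_inter]
    refine contMDiffOn_of_zero_off (W.core.isOpen_baseSet a) (isClosed_tsupport χ) hχ
      (g := fun x ↦ χ x • W.core.coordChange a a' x (Pi.single m 1)) ?_ (fun x hx ↦ ?_)
      fun x hx ↦ ?_
    · exact χ.contMDiff.contMDiffOn.smul (W.smooth a a' _)
    · simp only [rep]
      rw [← Complex.coe_smul, map_smul, Complex.coe_smul, W.core.coordChange_comp]
      exact ⟨⟨hx.1, W.core.mem_baseSet_at x⟩, hx.2⟩
    · simp only
      rw [image_eq_zero_of_notMem_tsupport hx, zero_smul, rep_zero]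
  · filter_upwards [χ.eventuallyEq_one, (W.core.isOpen_baseSet a).mem_nhds hy] with x hx hxa
    refine ⟨hxa, fun v ↦ ?_⟩
    have h1 : ∀ m, W.rep a x v m • (χ x • W.core.coordChange a (W.core.indexAt x) x
        (Pi.single m 1)) = W.core.coordChange a (W.core.indexAt x) x
          (W.rep a x v m • Pi.single m 1) := by
      intro m
      rw [hx, Pi.one_apply, one_smul, map_smul]
    simp only [h1]
    rw [← map_sum]
    have h2 : ∑ m, W.rep a x v m • (Pi.single m 1 : W.Fib) = W.rep a x v := by
      funext k
      simp [Finset.sum_apply, Pi.single_apply]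
    rw [h2, rep, W.core.coordChange_comp _ _ _ _
      ⟨⟨W.core.mem_baseSet_at x, hxa⟩, W.core.mem_baseSet_at x⟩,
      W.core.coordChange_self _ _ (W.core.mem_baseSet_at x)]

/-- A profile that is a single product `F(w) s(x)`, rescaled. -/
theorem scaled_smul (κ : OpenPartialHomeomorph S.M (Vec D)) (lam : ℝ) (z : Vec D) (F : Vec D → ℂ)
    (s : S.M → W.Fib) : W.scaled κ lam z (fun w x ↦ F w • s x) =
      W.chartMul κ (rescale ((lam ^ D)⁻¹ : ℝ) lam z F) s := by
  funext x
  by_cases hx : x ∈ κ.source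
  · simp only [scaled, chartMul, indicator_of_mem hx, rescale]
    rw [mul_smul, Complex.coe_smul]
  · simp [scaled, chartMul, hx]

theorem isProfile_smul {F : Vec D → ℂ} {s : S.M → W.Fib} (hF : ContDiff ℝ ∞ F)
    (hFc : HasCompactSupport F) (hs : W.IsSmooth s) : W.IsProfile fun w x ↦ F w • s x :=
  ⟨1, fun _ ↦ F, fun _ ↦ s, fun _ ↦ ⟨hF, hFc⟩, fun _ ↦ hs, fun w x ↦ by simp⟩

end CBundle

/-! ### Multilinear distributions as bounded multilinear maps -/

section Distributions

open scoped Distributions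
open TopologicalSpace (Compacts)

variable {D : ℕ} {S : Spacetime.{u} D} {Label : Type w} {W : Label → CBundle S}
  {E : Type*} [NormedAddCommGroup E] [NormedSpace ℂ E] {U : Set S.M} {is : List Label}
  {u : List (Factor W) → E}

theorem IsDistributionOn.map_zero (hu : IsDistributionOn U is u) {l₁ l₂ : List (Factor W)}
    {i : Label} (hl : (l₁ ++ ⟨i, 0⟩ :: l₂).map Sigma.fst = is)
    (ht : TestIn U (l₁ ++ ⟨i, 0⟩ :: l₂)) : u (l₁ ++ ⟨i, 0⟩ :: l₂) = 0 := by
  have := hu.1 l₁ l₂ i 0 0 1 hl ht ht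
  simpa using this

theorem isTest_zero (i : Label) : (W i).IsTest 0 :=
  ⟨fun a ↦ contMDiffOn_const.congr fun x _ ↦ (W i).rep_zero a x, HasCompactSupport.zero⟩

theorem testIn_append_cons {l₁ l₂ : List (Factor W)} {p : Factor W} :
    TestIn U (l₁ ++ p :: l₂) ↔
      TestIn U l₁ ∧ ((W p.1).IsTest p.2 ∧ tsupport p.2 ⊆ U) ∧ TestIn U l₂ := by
  simp only [TestIn, List.mem_append, List.mem_cons]
  constructor
  · exact fun h ↦ ⟨fun q hq ↦ h q (Or.inl hq), h p (Or.inr (Or.inl rfl)),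
      fun q hq ↦ h q (Or.inr (Or.inr hq))⟩
  · rintro ⟨h1, h2, h3⟩ q (hq | rfl | hq)
    exacts [h1 q hq, h2, h3 q hq]

theorem isTest_add_smul {i : Label} {f h : S.M → (W i).Fib} (c : ℂ)
    (hf : (W i).IsTest f ∧ tsupport f ⊆ U) (hh : (W i).IsTest h ∧ tsupport h ⊆ U) :
    (W i).IsTest (f + c • h) ∧ tsupport (f + c • h) ⊆ U := by
  refine ⟨⟨fun a ↦ ?_, hf.1.2.add hh.1.2.smul_left⟩, ?_⟩
  · have h1 : (fun x ↦ (W i).rep a x ((f + c • h) x)) =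
        fun x ↦ (W i).rep a x (f x) + c • (W i).rep a x (h x) := by
      funext x
      simp [CBundle.rep]
    rw [h1]
    exact (hf.1.1 a).add (contMDiffOn_smul_complex contMDiffOn_const (hh.1.1 a))
  · refine (tsupport_add _ _).trans (union_subset hf.2 ?_)
    exact (closure_mono (Function.support_const_smul_subset c h)).trans hh.2

theorem isTest_sum {ι : Type*} (t : Finset ι) {i : Label} {f : ι → S.M → (W i).Fib}
    (hf : ∀ m ∈ t, (W i).IsTest (f m) ∧ tsupport (f m) ⊆ U) :
    (W i).IsTest (∑ m ∈ t, f m) ∧ tsupport (∑ m ∈ t, f m) ⊆ U := by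
  classical
  induction t using Finset.induction with
  | empty => exact ⟨isTest_zero i, by simp [tsupport]⟩
  | insert m t hm ih =>
    rw [Finset.sum_insert hm, add_comm]
    have := isTest_add_smul 1 (ih fun k hk ↦ hf k (Finset.mem_insert_of_mem hk))
      (hf m (Finset.mem_insert_self m t))
    rwa [one_smul] at this

theorem IsDistributionOn.map_sum {ι : Type*} (hu : IsDistributionOn U is u) (t : Finset ι)
    {l₁ l₂ : List (Factor W)} {i : Label} {f : ι → S.M → (W i).Fib}
    (hl : (l₁ ++ ⟨i, 0⟩ :: l₂).map Sigma.fst = is) (h₁ : TestIn U l₁) (h₂ : TestIn U l₂)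
    (hf : ∀ m ∈ t, (W i).IsTest (f m) ∧ tsupport (f m) ⊆ U) :
    u (l₁ ++ ⟨i, ∑ m ∈ t, f m⟩ :: l₂) = ∑ m ∈ t, u (l₁ ++ ⟨i, f m⟩ :: l₂) := by
  classical
  have hl' : ∀ g : S.M → (W i).Fib, (l₁ ++ ⟨i, g⟩ :: l₂).map Sigma.fst = is := by
    intro g
    rw [← hl]
    simp
  induction t using Finset.induction with
  | empty =>
    exact hu.map_zero hl (testIn_append_cons.2 ⟨h₁, ⟨isTest_zero i, by simp [tsupport]⟩, h₂⟩)
  | insert m t hm ih =>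
    rw [Finset.sum_insert hm, Finset.sum_insert hm, add_comm (f m), add_comm (u _)]
    have hft : ∀ k ∈ t, (W i).IsTest (f k) ∧ tsupport (f k) ⊆ U :=
      fun k hk ↦ hf k (Finset.mem_insert_of_mem hk)
    have := hu.1 l₁ l₂ i (∑ k ∈ t, f k) (f m) 1 (hl' _)
      (testIn_append_cons.2 ⟨h₁, isTest_sum t hft, h₂⟩)
      (testIn_append_cons.2 ⟨h₁, hf m (Finset.mem_insert_self m t), h₂⟩)
    rw [one_smul, one_smul] at this
    rw [this, ih hft]

/-- The expansion of a distribution in two variables. -/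
theorem IsDistributionOn.map_sum_sum {ι ι' : Type*} {i j : Label}
    (hu : IsDistributionOn U [i, j] u) (t : Finset ι) (t' : Finset ι')
    {f : ι → S.M → (W i).Fib} {f' : ι' → S.M → (W j).Fib}
    (hf : ∀ m ∈ t, (W i).IsTest (f m) ∧ tsupport (f m) ⊆ U)
    (hf' : ∀ m ∈ t', (W j).IsTest (f' m) ∧ tsupport (f' m) ⊆ U) :
    u [⟨i, ∑ m ∈ t, f m⟩, ⟨j, ∑ m ∈ t', f' m⟩] =
      ∑ m ∈ t, ∑ m' ∈ t', u [⟨i, f m⟩, ⟨j, f' m'⟩] := by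
  have h1 := hu.map_sum t (l₁ := []) (l₂ := [⟨j, ∑ m ∈ t', f' m⟩]) rfl (by simp [TestIn])
    (by simpa [TestIn] using isTest_sum t' hf') hf
  refine h1.trans (Finset.sum_congr rfl fun m hm ↦ ?_)
  exact hu.map_sum t' (l₁ := [⟨i, f m⟩]) (l₂ := []) rfl (by simpa [TestIn] using hf m hm)
    (by simp [TestIn]) hf'

theorem ofFn_update_eq {n : ℕ} {α β : Type*} (F : Fin n → β → α) (h : Fin n → β) (i : Fin n) :
    ∃ l₁ l₂ : List α, ∀ x, (List.ofFn fun k ↦ F k (Function.update h i x k)) = l₁ ++ F i x :: l₂ := by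
  refine ⟨(List.ofFn fun k ↦ F k (h k)).take i, (List.ofFn fun k ↦ F k (h k)).drop (i + 1),
    fun x ↦ ?_⟩
  rw [← List.set_eq_take_cons_drop _ (by simp)]
  refine List.ext_getElem (by simp) fun k hk _ ↦ ?_
  rw [List.getElem_ofFn, List.getElem_set, List.getElem_ofFn]
  split_ifs with hik
  · subst hik
    simp
  · rw [Function.update_of_ne fun h0 ↦ hik (congrArg Fin.val h0).symm]

/-- A distribution, applied to fixed smooth sections times functions of the coordinates, is a bounded
multilinear map on test functions. -/
theorem IsDistributionOn.exists_multilinear (hu : IsDistributionOn U is u) {n : ℕ}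
    (s : Fin n → Factor W) (hs : (List.ofFn s).map Sigma.fst = is)
    (hsm : ∀ k, (W (s k).1).IsSmooth (s k).2) {κ : OpenPartialHomeomorph S.M (Vec D)}
    (hκ : S.IsChart κ) (K : Compacts (Vec D)) (hK : (K : Set (Vec D)) ⊆ κ.target)
    (hKU : κ.symm '' K ⊆ U) :
    ∃ μ : MultilinearMap ℂ (fun _ : Fin n ↦ 𝓓_{K}(Vec D, ℂ)) E,
      (∀ h, μ h = u (List.ofFn fun k ↦ ⟨(s k).1, (W (s k).1).chartMul κ (h k) (s k).2⟩)) ∧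
      ∃ (N : ℕ) (A : ℝ), ∀ h, ‖μ h‖ ≤ A * ∏ k, testNorm K N (h k) := by
  let F : Fin n → 𝓓_{K}(Vec D, ℂ) → Factor W :=
    fun k h ↦ ⟨(s k).1, (W (s k).1).chartMul κ h (s k).2⟩
  have hlab : ∀ h : Fin n → 𝓓_{K}(Vec D, ℂ),
      (List.ofFn fun k ↦ F k (h k)).map Sigma.fst = is := by
    intro h
    rw [← hs, List.map_ofFn, List.map_ofFn]
    rfl
  have htest : ∀ h : Fin n → 𝓓_{K}(Vec D, ℂ), TestIn U (List.ofFn fun k ↦ F k (h k)) := by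
    intro h p hp
    obtain ⟨k, rfl⟩ := (List.mem_ofFn' _ _).1 hp
    exact ⟨(W _).isTest_chartMul hκ K.isCompact hK (h k).support_subset (h k).contDiff (hsm k),
      ((W _).tsupport_chartMul_subset K.isCompact hK (h k).support_subset).trans hKU⟩
  have hlin : ∀ (h : Fin n → 𝓓_{K}(Vec D, ℂ)) (i : Fin n) (x y : 𝓓_{K}(Vec D, ℂ)) (c : ℂ),
      u (List.ofFn fun k ↦ F k (Function.update h i (x + c • y) k)) =
      u (List.ofFn fun k ↦ F k (Function.update h i x k)) +
        c • u (List.ofFn fun k ↦ F k (Function.update h i y k)) := by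
    intro h i x y c
    obtain ⟨l₁, l₂, hl⟩ := ofFn_update_eq F h i
    have hx := htest (Function.update h i x)
    have hy := htest (Function.update h i y)
    have hL := hlab (Function.update h i x)
    simp only [hl] at hx hy hL ⊢
    have := hu.1 l₁ l₂ (s i).1 _ _ c hL hx hy
    rw [← this]
    have he : F i (x + c • y) = ⟨(s i).1, (W (s i).1).chartMul κ x (s i).2 +
        c • (W (s i).1).chartMul κ y (s i).2⟩ := by
      rw [← CBundle.chartMul_add_smul]
      rfl
    rw [he]
  have hzero : ∀ (h : Fin n → 𝓓_{K}(Vec D, ℂ)) (i : Fin n),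
      u (List.ofFn fun k ↦ F k (Function.update h i 0 k)) = 0 := by
    intro h i
    simpa using hlin h i 0 0 1
  let μ : MultilinearMap ℂ (fun _ : Fin n ↦ 𝓓_{K}(Vec D, ℂ)) E :=
    MultilinearMap.mk' (fun h ↦ u (List.ofFn fun k ↦ F k (h k)))
      (fun h i x y ↦ by simpa using hlin h i x y 1)
      (fun h i c x ↦ by simpa [hzero] using hlin h i 0 x c)
  refine ⟨μ, fun h ↦ rfl, ?_⟩
  obtain ⟨N, A, hA⟩ := hu.2 (List.ofFn s) hs (fun p hp ↦ by
    obtain ⟨k, rfl⟩ := (List.mem_ofFn' _ _).1 hp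
    exact hsm k) κ hκ K K.isCompact hK hKU
  refine ⟨N, A, multilinear_bound_of_unit _ μ fun h hh ↦ ?_⟩
  have := hA (List.ofFn fun k ↦ ⟨(s k).1, (h k, (s k).2)⟩) (by rw [List.map_ofFn]; rfl)
    (fun p hp ↦ by
      obtain ⟨k, rfl⟩ := (List.mem_ofFn' _ _).1 hp
      exact ⟨(h k).contDiff, (h k).tsupport_subset,
        (testNorm_le_iff zero_le_one (h k)).1 (hh k)⟩)
  rw [List.map_ofFn] at this
  exact this

end Distributions

/-! ### Concentrated test sections -/

theorem VanishesScaled.mono {D : ℕ} {E : Type*} [NormedAddCommGroup E] [NormedSpace ℝ E] {r r' : ℝ}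
    (hr : r < r') {u : ℝ → Vec D → E} {z₀ : Vec D} (h : VanishesScaled r u z₀) :
    VanishesScaled r' u z₀ := by
  intro m
  have h2 := (((tendsto_rpow_nhdsGT_zero (sub_pos.2 hr))).comp (tendsto_fst (g := 𝓝 z₀))).smul (h m)
  rw [smul_zero] at h2
  refine h2.congr' ?_
  filter_upwards [(eventually_mem_nhdsWithin (a := (0 : ℝ)) (s := Ioi 0)).prod_inl (𝓝 z₀)] with p hp
  simp only [Function.comp]
  rw [smul_smul, ← Real.rpow_add hp, sub_add_cancel]

section Concentrated

variable {D : ℕ} {S : Spacetime.{u} D} {Label : Type w} (W : Label → CBundle S)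

/-- The field label `i` with the test section `F((κ x - z) / lam) s(x) / lam^D`, which is concentrated
near the point with coordinates `z`. -/
def concFactor (i : Label) (κ : OpenPartialHomeomorph S.M (Vec D)) (lam : ℝ) (z : Vec D)
    (F : Vec D → ℂ) (s : S.M → (W i).Fib) : Factor W :=
  ⟨i, (W i).chartMul κ (rescale ((lam ^ D)⁻¹ : ℝ) lam z F) s⟩

theorem profile_scaled_smul (i : Label) (κ : OpenPartialHomeomorph S.M (Vec D)) (lam : ℝ)
    (z : Vec D) (F : Vec D → ℂ) (s : S.M → (W i).Fib) :
    Profile.scaled κ lam z (⟨i, fun w x ↦ F w • s x⟩ : Profile W) = concFactor W i κ lam z F s := by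
  rw [Profile.scaled, concFactor, CBundle.scaled_smul]

variable {W} {κ : OpenPartialHomeomorph S.M (Vec D)}

theorem exists_closedBall_subset {y : S.M} (hy : y ∈ κ.source) {U : Set S.M} (hU : U ∈ 𝓝 y) :
    ∃ ρ > 0, Metric.closedBall (κ y) ρ ⊆ κ.target ∧ κ.symm '' Metric.closedBall (κ y) ρ ⊆ U := by
  have h1 : κ.target ∩ κ.symm ⁻¹' U ∈ 𝓝 (κ y) := by
    refine inter_mem (κ.open_target.mem_nhds (κ.map_source hy)) ?_
    refine (κ.continuousAt_symm (κ.map_source hy)).preimage_mem_nhds ?_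
    rwa [κ.left_inv hy]
  obtain ⟨ρ, hρ, hsub⟩ := Metric.nhds_basis_closedBall.mem_iff.1 h1
  exact ⟨ρ, hρ, fun z hz ↦ (hsub hz).1, image_subset_iff.2 fun z hz ↦ (hsub hz).2⟩

theorem eventually_zoom_mem {z₀ : Vec D} {U : Set (Vec D)} (hU : U ∈ 𝓝 z₀) {K : Set (Vec D)}
    (hK : IsCompact K) : ∀ᶠ ε : ℝ in 𝓝[>] 0, ∀ w ∈ K, z₀ + ε • w ∈ U :=
  eventually_forall_zoom (P := fun p ↦ p.2 ∈ U) (Eventually.prod_inr hU _) hK.isBounded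

theorem update_pair_zero {α : Type*} (a b x : α) : Function.update ![a, b] 0 x = ![x, b] := by
  funext k
  fin_cases k <;> rfl

theorem update_pair_one {α : Type*} (a b x : α) : Function.update ![a, b] 1 x = ![a, x] := by
  funext k
  fin_cases k <;> rfl

theorem isTest_concFactor (hκ : S.IsChart κ) {i : Label} {lam : ℝ} (hl : lam ≠ 0) {z : Vec D}
    {F : Vec D → ℂ} {s : S.M → (W i).Fib} (hF : ContDiff ℝ ∞ F) (hs : (W i).IsSmooth s)
    {K : Set (Vec D)} (hK : IsCompact K) (hKt : K ⊆ κ.target)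
    (hFK : ∀ w ∈ Function.support F, z + lam • w ∈ K) :
    (W i).IsTest (concFactor W i κ lam z F s).2 ∧
      tsupport (concFactor W i κ lam z F s).2 ⊆ κ.symm '' K := by
  have hsupp := support_rescale_subset (c := ((lam ^ D)⁻¹ : ℝ)) subset_rfl hl hFK
  exact ⟨(W i).isTest_chartMul hκ hK hKt hsupp (contDiff_rescale hF _ _ _) hs,
    (W i).tsupport_chartMul_subset hK hKt hsupp⟩

open scoped Distributions in
open TopologicalSpace (Compacts) in
/-- A distribution in two variables, on concentrated test sections, is a bounded bilinear map of the
test functions that get concentrated. -/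
theorem IsDistributionOn.eventually_bilinear {E : Type*} [NormedAddCommGroup E] [NormedSpace ℂ E]
    {U : Set S.M} {i j : Label} {u : List (Factor W) → E} (hu : IsDistributionOn U [i, j] u)
    (hκ : S.IsChart κ) {y : S.M} (hy : y ∈ κ.source) (hU : U ∈ 𝓝 y)
    {s : S.M → (W i).Fib} (hs : (W i).IsSmooth s) {s' : S.M → (W j).Fib} (hs' : (W j).IsSmooth s')
    (K K' : Compacts (Vec D)) :
    ∀ᶠ ε : ℝ in 𝓝[>] 0, ∃ β : 𝓓_{K}(Vec D, ℂ) →ₗ[ℂ] 𝓓_{K'}(Vec D, ℂ) →ₗ[ℂ] E,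
      (∀ h h', β h h' = u [concFactor W i κ ε (κ y) h s, concFactor W j κ ε (κ y) h' s']) ∧
      ∃ (N : ℕ) (A : ℝ), ∀ h h', ‖β h h'‖ ≤ A * (testNorm K N h * testNorm K' N h') := by
  obtain ⟨ρ, hρ, ht, hUρ⟩ := exists_closedBall_subset hy hU
  let B : Compacts (Vec D) := ⟨Metric.closedBall (κ y) ρ, isCompact_closedBall _ _⟩
  have hB := Metric.closedBall_mem_nhds (κ y) hρ
  filter_upwards [eventually_zoom_mem hB K.isCompact, eventually_zoom_mem hB K'.isCompact,
    eventually_mem_nhdsWithin] with ε h1 h2 hpos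
  have hne : ε ≠ 0 := ne_of_gt hpos
  obtain ⟨μ, hμ, N, A, hA⟩ := hu.exists_multilinear (n := 2)
    (Fin.cons ⟨i, s⟩ fun _ ↦ ⟨j, s'⟩) rfl (fun k ↦ by
      refine Fin.cases hs (fun _ ↦ hs') k) hκ B ht hUρ
  let R := rescaleLM (K' := B) (((ε ^ D)⁻¹ : ℝ) : ℂ) hne (κ y) h1
  let R' := rescaleLM (K' := B) (((ε ^ D)⁻¹ : ℝ) : ℂ) hne (κ y) h2
  let β₀ : 𝓓_{B}(Vec D, ℂ) →ₗ[ℂ] 𝓓_{B}(Vec D, ℂ) →ₗ[ℂ] E :=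
    LinearMap.mk₂ ℂ (fun h h' ↦ μ ![h, h'])
      (fun h₁ h₂ h' ↦ by
        have := μ.map_update_add ![h₁, h'] 0 h₁ h₂
        rwa [update_pair_zero, update_pair_zero, update_pair_zero] at this)
      (fun c h h' ↦ by
        have := μ.map_update_smul ![h, h'] 0 c h
        rwa [update_pair_zero, update_pair_zero] at this)
      (fun h h₁ h₂ ↦ by
        have := μ.map_update_add ![h, h₁] 1 h₁ h₂
        rwa [update_pair_one, update_pair_one, update_pair_one] at this)
      (fun c h h' ↦ by
        have := μ.map_update_smul ![h, h'] 1 c h'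
        rwa [update_pair_one, update_pair_one] at this)
  obtain ⟨C, hC0, hC⟩ := exists_testNorm_rescaleLM_le (K' := B) (((ε ^ D)⁻¹ : ℝ) : ℂ) hne (κ y) h1 N
  obtain ⟨C', hC0', hC'⟩ :=
    exists_testNorm_rescaleLM_le (K' := B) (((ε ^ D)⁻¹ : ℝ) : ℂ) hne (κ y) h2 N
  refine ⟨β₀.compl₁₂ R R', fun h h' ↦ ?_, N, |A| * (C * C'), fun h h' ↦ ?_⟩
  · change μ ![R h, R' h'] = _
    rw [hμ]
    rfl
  · change ‖μ ![R h, R' h']‖ ≤ _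
    refine (hA _).trans ?_
    rw [Fin.prod_univ_two]
    calc A * (testNorm B N (R h) * testNorm B N (R' h'))
        ≤ |A| * ((C * testNorm K N h) * (C' * testNorm K' N h')) := by
          refine mul_le_mul (le_abs_self A) ?_ (by positivity) (abs_nonneg A)
          exact mul_le_mul (hC h) (hC' h') (apply_nonneg _ _)
            (mul_nonneg hC0 (apply_nonneg _ _))
      _ = _ := by ring

/-- Concentrated test sections, multiplied by a cutoff of the reference point, form a smooth family of
test sections. -/
theorem isTestFamily_concFactor (hκ : S.IsChart κ) (i : Label) {F : Vec D → ℂ}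
    {s : S.M → (W i).Fib} (hF : ContDiff ℝ ∞ F) (hs : (W i).IsSmooth s) {z₀ : Vec D} {ρ R lam : ℝ}
    (hl : 0 < lam) (hR : ∀ w ∈ Function.support F, ‖w‖ ≤ R) (hlR : lam * R ≤ ρ) {U : Set S.M}
    (ht : Metric.closedBall z₀ (3 * ρ) ⊆ κ.target)
    (hU : κ.symm '' Metric.closedBall z₀ (3 * ρ) ⊆ U)
    {η : Vec D → ℝ} (hη : ContDiff ℝ ∞ η)
    (hη0 : Function.support η ⊆ Metric.closedBall z₀ (2 * ρ)) (hρ : 0 < ρ) :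
    (W i).IsTestFamily U fun y' ↦ κ.source.indicator (fun y' ↦ (W i).chartMul κ
      (fun z ↦ (η (κ y') : ℂ) * rescale ((lam ^ D)⁻¹ : ℝ) lam (κ y') F z) s) y' := by
  have hsub : Metric.closedBall z₀ (2 * ρ) ⊆ Metric.closedBall z₀ (3 * ρ) :=
    Metric.closedBall_subset_closedBall (by linarith)
  have hzero : ∀ y' x, y' ∉ κ.symm '' Metric.closedBall z₀ (2 * ρ) ∨
      x ∉ κ.symm '' Metric.closedBall z₀ (3 * ρ) →
      κ.source.indicator (fun y' ↦ (W i).chartMul κ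
        (fun z ↦ (η (κ y') : ℂ) * rescale ((lam ^ D)⁻¹ : ℝ) lam (κ y') F z) s) y' x = 0 := by
    intro y' x h
    by_cases hy' : y' ∈ κ.source
    swap
    · rw [indicator_of_notMem hy']; rfl
    rw [indicator_of_mem hy']
    by_cases hη' : η (κ y') = 0
    · have : (fun z ↦ (η (κ y') : ℂ) * rescale ((lam ^ D)⁻¹ : ℝ) lam (κ y') F z) = 0 := by
        funext z
        simp [hη']
      rw [this, CBundle.chartMul_zero]
      rfl
    have hy2 := hη0 hη'
    rcases h with h | h
    · exact absurd ⟨κ y', hy2, κ.left_inv hy'⟩ h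
    · refine (W i).chartMul_eq_zero (K := Metric.closedBall z₀ (3 * ρ)) (fun z hz ↦ ?_) h
      have h1 := support_rescale_subset (K := Function.support F)
        (K' := Metric.closedBall z₀ (3 * ρ)) subset_rfl (c := ((lam ^ D)⁻¹ : ℝ)) (z := κ y') hl.ne'
        (fun w hw ↦ by
          rw [mem_closedBall_iff_norm] at hy2 ⊢
          have h2 : κ y' + lam • w - z₀ = (κ y' - z₀) + lam • w := by abel
          have h3 : ‖lam • w‖ ≤ ρ := by
            rw [norm_smul, Real.norm_of_nonneg hl.le]
            exact (mul_le_mul_of_nonneg_left (hR w hw) hl.le).trans hlR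
          rw [h2]
          refine (norm_add_le _ _).trans ?_
          linarith)
      exact h1 (right_ne_zero_of_mul hz)
  refine ⟨fun a ↦ ?_, κ.symm '' Metric.closedBall z₀ (3 * ρ),
    (isCompact_closedBall _ _).image_of_continuousOn (κ.continuousOn_symm.mono ht), hU,
    fun y' _ x hx ↦ hzero y' x (Or.inr hx)⟩
  refine contMDiffOn_of_zero_off (O := κ.source ×ˢ κ.source)
    (C := (κ.symm '' Metric.closedBall z₀ (2 * ρ)) ×ˢ (κ.symm '' Metric.closedBall z₀ (3 * ρ)))
    (κ.open_source.prod κ.open_source)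
    ((CBundle.isClosed_symm_image (isCompact_closedBall _ _) (hsub.trans ht)).prod
      (CBundle.isClosed_symm_image (isCompact_closedBall _ _) ht))
    (prod_mono ((image_mono (hsub.trans ht)).trans κ.symm_image_target_eq_source.subset)
      ((image_mono ht).trans κ.symm_image_target_eq_source.subset))
    (g := fun p ↦ ((η (κ p.1) : ℂ) * rescale ((lam ^ D)⁻¹ : ℝ) lam (κ p.1) F (κ p.2)) •
      (W i).rep a p.2 (s p.2)) ?_ (fun p hp ↦ ?_) fun p hp ↦ ?_
  · refine contMDiffOn_smul_complex ?_ ?_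
    · have h1 : ContDiff ℝ ∞ fun q : Vec D × Vec D ↦
          (η q.1 : ℂ) * rescale ((lam ^ D)⁻¹ : ℝ) lam q.1 F q.2 := by
        refine ContDiff.mul (Complex.ofRealCLM.contDiff.comp (hη.comp contDiff_fst)) ?_
        exact contDiff_const.mul (hF.comp (by fun_prop))
      have hk := contMDiffOn_of_mem_maximalAtlas hκ
      have hk1 : ContMDiffOn ((𝓡 D).prod (𝓡 D)) 𝓘(ℝ, Vec D) ∞ (fun p : S.M × S.M ↦ κ p.1)
          ((κ.source ×ˢ κ.source) ∩ U ×ˢ (W i).core.baseSet a) :=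
        hk.comp contMDiffOn_fst fun p hp ↦ hp.1.1
      have hk2 : ContMDiffOn ((𝓡 D).prod (𝓡 D)) 𝓘(ℝ, Vec D) ∞ (fun p : S.M × S.M ↦ κ p.2)
          ((κ.source ×ˢ κ.source) ∩ U ×ˢ (W i).core.baseSet a) :=
        hk.comp contMDiffOn_snd fun p hp ↦ hp.1.2
      exact h1.contMDiff.comp_contMDiffOn (hk1.prodMk_space hk2)
    · exact (hs a).comp contMDiffOn_snd fun p hp ↦ ⟨trivial, hp.2.2⟩
  · beta_reduce
    rw [indicator_of_mem hp.1.1, CBundle.chartMul_apply_of_mem _ hp.1.2, CBundle.rep_smul]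
  · beta_reduce
    rw [hzero p.1 p.2 (by
      by_contra h
      push Not at h
      exact hp h), CBundle.rep_zero]

end Concentrated

namespace OPESystem

variable {D : ℕ} {Q : OPESystem.{u, v, w} D} {b : Q.Bg} {y : Q.Pt b}
  {κ : OpenPartialHomeomorph (Q.Pt b) (Vec D)}

theorem vanishesScaled_of_sd_le (hκ : (Q.st b).IsChart κ) (hy : y ∈ κ.source)
    {is : List Q.Label} {j : Q.Label} {t r : ℝ}
    (h : Q.sd b is j y ≤ t) (hr : t < r) {a : (Q.V b j).idx} (ha : y ∈ (Q.V b j).core.baseSet a)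
    {L : List (Profile (Q.V b))} (hL : L.map Sigma.fst = is)
    (hLp : ∀ p ∈ L, (Q.V b p.1).IsProfile p.2) :
    VanishesScaled r (fun lam z ↦ (Q.V b j).rep a (κ.symm z)
      (Q.coef b (L.map (Profile.scaled κ lam (κ (κ.symm z)))) j (κ.symm z))) (κ y) := by
  have h1 : Q.sd b is j y < (r : EReal) := h.trans_lt (EReal.coe_lt_coe_iff.2 hr)
  obtain ⟨δ, ⟨r', rfl, hr'⟩, hlt⟩ := sInf_lt_iff.1 h1
  exact (hr' κ hκ hy a ha L ⟨hL, hLp⟩).mono (EReal.coe_lt_coe_iff.1 hlt)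

end OPESystem

/-! ### Profiles that are products -/

section Product

variable {D : ℕ} {S : Spacetime.{u} D} {Label : Type w} (W : Label → CBundle S)

/-- A field label with a profile that is a single product `F(w) s(x)` of a scalar test function and a
smooth section. -/
structure ProductProfile where
  label : Label
  fn : Vec D → ℂ
  sec : S.M → (W label).Fib
  contDiff : ContDiff ℝ ∞ fn
  compact : HasCompactSupport fn
  smooth : (W label).IsSmooth sec

variable {W} {κ : OpenPartialHomeomorph S.M (Vec D)}

namespace ProductProfile

/-- The underlying profile. -/
def toProfile (p : ProductProfile W) : Profile W := ⟨p.label, fun w x ↦ p.fn w • p.sec x⟩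

/-- The profile concentrated at the point with coordinates `z`. -/
def conc (p : ProductProfile W) (κ : OpenPartialHomeomorph S.M (Vec D)) (lam : ℝ) (z : Vec D) :
    Factor W :=
  concFactor W p.label κ lam z p.fn p.sec

theorem scaled_toProfile (p : ProductProfile W) (κ : OpenPartialHomeomorph S.M (Vec D)) (lam : ℝ)
    (z : Vec D) : p.toProfile.scaled κ lam z = p.conc κ lam z :=
  profile_scaled_smul W _ κ lam z _ _

theorem isProfile (p : ProductProfile W) : (W p.label).IsProfile p.toProfile.2 :=
  (W p.label).isProfile_smul p.contDiff p.compact p.smooth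

theorem exists_support_bound (p : ProductProfile W) :
    ∃ R > 0, ∀ w ∈ Function.support p.fn, ‖w‖ ≤ R := by
  obtain ⟨R, hR⟩ := p.compact.isCompact.isBounded.exists_norm_le
  exact ⟨max R 1, by positivity, fun w hw ↦ (hR w (subset_tsupport _ hw)).trans (le_max_left _ _)⟩

end ProductProfile

/-- A section multiplied by a concentrated test function, expanded in a local frame. -/
theorem CBundle.scaledMul_eq_sum (V : CBundle S) {a : V.idx} {N : Set S.M}
    {s : Fin V.rank → S.M → V.Fib} (hs : ∀ x ∈ N, ∀ v, v = ∑ m, V.rep a x v m • s m x) {ε : ℝ}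
    (hε : ε ≠ 0) {z₀ : Vec D} {F : Vec D → ℂ}
    (hN : ∀ w ∈ tsupport F, κ.symm (z₀ + ε • w) ∈ N) (G : S.M → V.Fib) :
    V.scaledMul κ ε z₀ F G = ∑ m, V.chartMul κ (rescale ((ε ^ D)⁻¹ : ℝ) ε z₀ fun w ↦
      F w * (((S.volDensity κ (z₀ + ε • w))⁻¹ : ℝ) *
        V.rep a (κ.symm (z₀ + ε • w)) (G (κ.symm (z₀ + ε • w))) m)) (s m) := by
  funext x
  rw [Finset.sum_apply]
  by_cases hx : x ∈ κ.source
  swap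
  · simp [scaledMul, chartMul, hx]
  have hback : z₀ + ε • ε⁻¹ • (κ x - z₀) = κ x := by
    rw [smul_smul, mul_inv_cancel₀ hε, one_smul, add_sub_cancel]
  simp only [scaledMul, indicator_of_mem hx, V.chartMul_apply_of_mem hx, rescale, hback,
    κ.left_inv hx]
  by_cases hF : F (ε⁻¹ • (κ x - z₀)) = 0
  · simp [hF]
  have hxN : x ∈ N := by
    have := hN _ (subset_tsupport _ hF)
    rwa [hback, κ.left_inv hx] at this
  conv_lhs => rw [hs x hxN (G x), Finset.smul_sum]
  refine Finset.sum_congr rfl fun m _ ↦ ?_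
  rw [smul_smul, mul_inv]
  push_cast
  congr 1
  ring

theorem testIn_pair {U : Set S.M} {p p' : Factor W} (h : (W p.1).IsTest p.2 ∧ tsupport p.2 ⊆ U)
    (h' : (W p'.1).IsTest p'.2 ∧ tsupport p'.2 ⊆ U) : TestIn U [p, p'] := by
  intro q hq
  simp only [List.mem_cons, List.not_mem_nil, or_false] at hq
  rcases hq with rfl | rfl
  exacts [h, h']

theorem IsDistributionOn.map_smul_smul {E : Type*} [NormedAddCommGroup E] [NormedSpace ℂ E]
    {U : Set S.M} {i j : Label} {u : List (Factor W) → E} (hu : IsDistributionOn U [i, j] u)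
    (c c' : ℂ) {f : S.M → (W i).Fib} {f' : S.M → (W j).Fib}
    (hf : (W i).IsTest f ∧ tsupport f ⊆ U) (hf' : (W j).IsTest f' ∧ tsupport f' ⊆ U) :
    u [⟨i, c • f⟩, ⟨j, c' • f'⟩] = (c * c') • u [⟨i, f⟩, ⟨j, f'⟩] := by
  have h0 : ∀ k, (W k).IsTest 0 ∧ tsupport (0 : S.M → (W k).Fib) ⊆ U :=
    fun k ↦ ⟨isTest_zero k, by simp [tsupport]⟩
  have hcf' : (W j).IsTest (c' • f') ∧ tsupport (c' • f') ⊆ U := by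
    have := isTest_add_smul c' (h0 j) hf'
    rwa [zero_add] at this
  have h1 := hu.1 [] [⟨j, c' • f'⟩] i 0 f c rfl (testIn_pair (h0 i) hcf')
    (testIn_pair hf hcf')
  have h2 := hu.map_zero (l₁ := []) (l₂ := [⟨j, c' • f'⟩]) (i := i) rfl
    (testIn_pair (h0 i) hcf')
  have h3 := hu.1 [⟨i, f⟩] [] j 0 f' c' rfl (testIn_pair hf (h0 j))
    (testIn_pair hf hf')
  have h4 := hu.map_zero (l₁ := [⟨i, f⟩]) (l₂ := []) (i := j) rfl
    (testIn_pair hf (h0 j))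
  simp only [List.nil_append, List.cons_append, zero_add] at h1 h2 h3 h4
  rw [h1, h2, zero_add, h3, h4, zero_add, smul_smul]

end Product

namespace OPESystem

variable {D : ℕ} {Q : OPESystem.{u, v, w} D} {b : Q.Bg} {y : Q.Pt b}
  {κ : OpenPartialHomeomorph (Q.Pt b) (Vec D)}

/-! ### Asymptotics of the coefficients with two upper labels -/

theorem vanishesScaled_pair (hQ : Q.Axioms) (hκ : (Q.st b).IsChart κ) (hy : y ∈ κ.source)
    (p p' : ProductProfile (Q.V b)) (k : Q.Label) {r : ℝ}
    (hr : Q.dim p.label + Q.dim p'.label - Q.dim k < r) {a : (Q.V b k).idx}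
    (ha : y ∈ (Q.V b k).core.baseSet a) :
    VanishesScaled r (fun lam z ↦ (Q.V b k).rep a (κ.symm z)
      (Q.coef b [p.conc κ lam (κ (κ.symm z)), p'.conc κ lam (κ (κ.symm z))] k (κ.symm z))) (κ y) := by
  have := vanishesScaled_of_sd_le hκ hy (hQ.scaling_degree b p.label p'.label k y) hr ha
    (L := [p.toProfile, p'.toProfile]) rfl (by simpa using ⟨p.isProfile, p'.isProfile⟩)
  simpa only [List.map_cons, List.map_nil, ProductProfile.scaled_toProfile] using this

theorem tendsto_coef_pair (hQ : Q.Axioms) (hκ : (Q.st b).IsChart κ) (hy : y ∈ κ.source)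
    (p p' : ProductProfile (Q.V b)) (k : Q.Label) {r : ℝ}
    (hr : Q.dim p.label + Q.dim p'.label - Q.dim k < r) :
    Tendsto (fun ε : ℝ ↦ ε ^ r * ‖Q.coef b [p.conc κ ε (κ y), p'.conc κ ε (κ y)] k y‖)
      (𝓝[>] 0) (𝓝 0) := by
  have h1 := vanishesScaled_pair hQ hκ hy p p' k hr ((Q.V b k).core.mem_baseSet_at y) 0
  have h2 := (h1.comp (tendsto_id.prodMk (tendsto_const_nhds (x := κ y)))).norm
  rw [norm_zero] at h2
  refine h2.congr' ?_
  filter_upwards [eventually_mem_nhdsWithin] with ε hε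
  simp only [Function.comp, id]
  rw [norm_smul, norm_iteratedFDeriv_zero, Real.norm_of_nonneg (Real.rpow_nonneg (le_of_lt hε) _),
    κ.left_inv hy, CBundle.rep_indexAt]

/-- The coefficients with two concentrated test sections depend smoothly on the point at which both
test sections are concentrated and which serves as the reference point. -/
theorem eventually_contDiffAt_pair (hQ : Q.Axioms) (hκ : (Q.st b).IsChart κ) (hy : y ∈ κ.source)
    (p p' : ProductProfile (Q.V b)) (k : Q.Label) {a : (Q.V b k).idx}
    (ha : y ∈ (Q.V b k).core.baseSet a) :
    ∀ᶠ q : ℝ × Vec D in 𝓝[>] 0 ×ˢ 𝓝 (κ y), ContDiffAt ℝ ∞ (fun z ↦ (Q.V b k).rep a (κ.symm z)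
      (Q.coef b [p.conc κ q.1 (κ (κ.symm z)), p'.conc κ q.1 (κ (κ.symm z))] k (κ.symm z))) q.2 := by
  obtain ⟨U, hUo, hyU, -, hU⟩ := hQ.coef_distribution b [p.label, p'.label] k y
  obtain ⟨ρ', hρ', ht, hUρ⟩ := exists_closedBall_subset hy (inter_mem (hUo.mem_nhds hyU)
    (((Q.V b k).core.isOpen_baseSet a).mem_nhds ha))
  obtain ⟨ρ, rfl⟩ : ∃ ρ, ρ' = 3 * ρ := ⟨ρ' / 3, by ring⟩
  have hρ : 0 < ρ := by linarith
  obtain ⟨R, hR0, hR⟩ := p.exists_support_bound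
  obtain ⟨R', hR0', hR'⟩ := p'.exists_support_bound
  let η : ContDiffBump (κ y) := ⟨ρ, 2 * ρ, hρ, by linarith⟩
  have hη0 : Function.support η ⊆ Metric.closedBall (κ y) (2 * ρ) := by
    rw [η.support_eq]
    exact Metric.ball_subset_closedBall
  have hsmall : ∀ T : ℝ, ∀ᶠ lam : ℝ in 𝓝[>] 0, lam * T ≤ ρ := by
    intro T
    have hc : Continuous fun lam : ℝ ↦ lam * T := by fun_prop
    have := (hc.tendsto 0).mono_left (nhdsWithin_le_nhds (s := Ioi 0))
    rw [zero_mul] at this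
    exact this.eventually (eventually_le_nhds hρ)
  have hev : ∀ᶠ q : ℝ × Vec D in 𝓝[>] 0 ×ˢ 𝓝 (κ y),
      (0 < q.1 ∧ q.1 * R ≤ ρ ∧ q.1 * R' ≤ ρ) ∧ q.2 ∈ Metric.ball (κ y) ρ :=
    (eventually_mem_nhdsWithin.and ((hsmall R).and (hsmall R'))).prod_mk
      (Metric.ball_mem_nhds (κ y) hρ)
  filter_upwards [hev] with q hq
  obtain ⟨⟨hl, hlR, hlR'⟩, hz⟩ := hq
  have hUρ' := hUρ.trans inter_subset_left
  have hfam : ∀ p : ProductProfile (Q.V b), (∃ R, (∀ w ∈ Function.support p.fn, ‖w‖ ≤ R) ∧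
      q.1 * R ≤ ρ) → ∃ f, (Q.V b p.label).IsTestFamily U f ∧ ∀ z ∈ Metric.ball (κ y) ρ,
        z ∈ κ.target → f (κ.symm z) = (p.conc κ q.1 z).2 := by
    rintro p ⟨R, hR, hlR⟩
    refine ⟨_, isTestFamily_concFactor hκ p.label p.contDiff p.smooth hl hR hlR ht hUρ'
      η.contDiff hη0 hρ, fun z hz hzt ↦ ?_⟩
    have h1 : η z = 1 := η.one_of_mem_closedBall (Metric.ball_subset_closedBall hz)
    simp only [indicator_of_mem (κ.map_target hzt), κ.right_inv hzt, h1, Complex.ofReal_one,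
      one_mul]
    rfl
  obtain ⟨f, hf, hfz⟩ := hfam p ⟨R, hR, hlR⟩
  obtain ⟨f', hf', hfz'⟩ := hfam p' ⟨R', hR', hlR'⟩
  have hsm := hU [⟨p.label, f⟩, ⟨p'.label, f'⟩] rfl (by
    intro t ht
    simp only [List.mem_cons, List.not_mem_nil, or_false] at ht
    rcases ht with rfl | rfl
    exacts [hf, hf']) a
  have hbt : Metric.ball (κ y) ρ ⊆ Metric.closedBall (κ y) (3 * ρ) :=
    Metric.ball_subset_closedBall.trans (Metric.closedBall_subset_closedBall (by linarith))
  have hcomp := hsm.comp ((contMDiffOn_symm_of_mem_maximalAtlas hκ).mono (hbt.trans ht))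
    fun z hz ↦ hUρ ⟨z, hbt hz, rfl⟩
  have hat := (contMDiffOn_iff_contDiffOn.1 hcomp).contDiffAt (Metric.isOpen_ball.mem_nhds hz)
  refine hat.congr_of_eventuallyEq ?_
  filter_upwards [Metric.isOpen_ball.mem_nhds hz] with z hz
  have hzt := ht (hbt hz)
  simp only [Function.comp, List.map_cons, List.map_nil, hfz z hz hzt, hfz' z hz hzt,
    κ.right_inv hzt]
  rfl

/-- The coefficient with two concentrated test sections, multiplied with a sufficiently high power of
the scale, is bounded with all derivatives. -/
theorem locallyBdd_pair (hQ : Q.Axioms) (hκ : (Q.st b).IsChart κ) (hy : y ∈ κ.source)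
    (p p' : ProductProfile (Q.V b)) (k : Q.Label) {r : ℝ}
    (hr : Q.dim p.label + Q.dim p'.label - Q.dim k < r) {a : (Q.V b k).idx}
    (ha : y ∈ (Q.V b k).core.baseSet a) (m : Fin (Q.V b k).rank) :
    LocallyBdd (κ y) fun lam z ↦ ((lam ^ r : ℝ) : ℂ) * (Q.V b k).rep a (κ.symm z)
      (Q.coef b [p.conc κ lam (κ (κ.symm z)), p'.conc κ lam (κ (κ.symm z))] k (κ.symm z)) m := by
  have hc := eventually_contDiffAt_pair hQ hκ hy p p' k ha
  have hcm : ∀ {u : Vec D → (Q.V b k).Fib} {z : Vec D}, ContDiffAt ℝ ∞ u z →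
      ContDiffAt ℝ ∞ (fun z ↦ u z m) z := fun h ↦
    (ContinuousLinearMap.proj (R := ℝ) (φ := fun _ : Fin (Q.V b k).rank ↦ ℂ) m).contDiff.contDiffAt.comp
      _ h
  refine ⟨?_, fun n ↦ ⟨1, ?_⟩⟩
  · filter_upwards [hc] with q hq
    exact contDiffAt_const.mul (hcm hq)
  · have h1 := (vanishesScaled_pair hQ hκ hy p p' k hr ha n).norm
    rw [norm_zero] at h1
    filter_upwards [hc, h1.eventually (eventually_le_nhds zero_lt_one)] with q hq hb
    have h2 : (fun z ↦ ((q.1 ^ r : ℝ) : ℂ) * (Q.V b k).rep a (κ.symm z)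
        (Q.coef b [p.conc κ q.1 (κ (κ.symm z)), p'.conc κ q.1 (κ (κ.symm z))] k (κ.symm z)) m) =
        (q.1 ^ r) • fun z ↦ (Q.V b k).rep a (κ.symm z)
          (Q.coef b [p.conc κ q.1 (κ (κ.symm z)), p'.conc κ q.1 (κ (κ.symm z))] k (κ.symm z)) m := by
      funext z
      rw [Pi.smul_apply, Complex.real_smul]
    rw [h2, iteratedFDeriv_const_smul_apply ((hcm hq).of_le (mod_cast le_top))]
    rw [norm_smul] at hb ⊢
    refine le_trans (mul_le_mul_of_nonneg_left ?_ (norm_nonneg _)) hb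
    have h3 := (ContinuousLinearMap.proj (R := ℝ) (φ := fun _ : Fin (Q.V b k).rank ↦ ℂ) m
      ).norm_iteratedFDeriv_comp_left (hq.of_le (mod_cast le_top)) (n := n) le_rfl
    refine h3.trans ?_
    refine mul_le_of_le_one_left (norm_nonneg _) ?_
    refine ContinuousLinearMap.opNorm_le_bound _ zero_le_one fun v ↦ ?_
    rw [one_mul]
    exact norm_le_pi_norm v m

end OPESystem

/-! ### Averages of bounded families -/

section Averages

variable {X : Type*} [NormedAddCommGroup X] [InnerProductSpace ℝ X]

theorem LocallyBdd.comp_sq {z₀ : X} {q : ℝ → X → ℂ} (hq : LocallyBdd z₀ q) :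
    LocallyBdd z₀ fun ε ↦ q (ε ^ 2) := by
  have h1 : Tendsto (fun ε : ℝ ↦ ε ^ 2) (𝓝[>] 0) (𝓝[>] 0) := by
    refine tendsto_nhdsWithin_iff.2 ⟨?_, ?_⟩
    · have hc : Continuous fun ε : ℝ ↦ ε ^ 2 := by fun_prop
      simpa using (hc.tendsto 0).mono_left (nhdsWithin_le_nhds (s := Ioi 0))
    · filter_upwards [eventually_mem_nhdsWithin] with ε hε
      exact pow_pos (mem_Ioi.1 hε) 2
  have h2 := h1.prodMap (tendsto_id (x := 𝓝 z₀))
  refine ⟨h2.eventually hq.1, fun m ↦ ?_⟩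
  obtain ⟨C, hC⟩ := hq.2 m
  exact ⟨C, h2.eventually hC⟩

/-- The mean value inequality on the scale `ε`. -/
theorem LocallyBdd.exists_lipschitz {z₀ : X} {q : ℝ → X → ℂ} (hq : LocallyBdd z₀ q) {K : Set X}
    (hK : Bornology.IsBounded K) :
    ∃ C, ∀ᶠ ε : ℝ in 𝓝[>] 0, ∀ w ∈ K, ‖q ε (z₀ + ε • w) - q ε z₀‖ ≤ C * (ε * ‖w‖) := by
  obtain ⟨C, hC⟩ := hq.2 1
  refine ⟨C, ?_⟩
  obtain ⟨P₁, h₁, P₂, h₂, h⟩ := eventually_prod_iff.1 (hq.1.and hC)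
  obtain ⟨ρ, hρ, hball⟩ := Metric.eventually_nhds_iff_ball.1 h₂
  have h3 := eventually_forall_zoom (P := fun p ↦ p.2 ∈ Metric.ball z₀ ρ)
    (Eventually.prod_inr (Metric.ball_mem_nhds z₀ hρ) (𝓝[>] 0)) hK
  filter_upwards [h₁, h3, eventually_mem_nhdsWithin] with ε hε hz hpos w hw
  have h4 := (convex_ball z₀ ρ).norm_image_sub_le_of_norm_fderiv_le (𝕜 := ℝ) (f := q ε) (C := C)
    (fun x hx ↦ (h hε (hball x hx)).1.differentiableAt (by simp)) (fun x hx ↦ by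
      rw [← norm_iteratedFDeriv_one]
      exact (h hε (hball x hx)).2) (Metric.mem_ball_self hρ) (hz w hw)
  rwa [add_sub_cancel_left, norm_smul, Real.norm_of_nonneg (le_of_lt hpos)] at h4

/-- On a small scale, a bounded family may be replaced by its value at the central point. -/
theorem LocallyBdd.tendsto_average [FiniteDimensional ℝ X] [MeasurableSpace X] [BorelSpace X] {z₀ : X} {q : ℝ → X → ℂ}
    (hq : LocallyBdd z₀ q) {F : X → ℂ} (hF : ContDiff ℝ ∞ F) (hFc : HasCompactSupport F) {t : ℝ}
    (ht : t < 1) :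
    Tendsto (fun ε : ℝ ↦ ε ^ (-t) * ‖(∫ w, F w * q ε (z₀ + ε • w)) - (∫ w, F w) * q ε z₀‖)
      (𝓝[>] 0) (𝓝 0) := by
  obtain ⟨C, hC⟩ := hq.exists_lipschitz hFc.isCompact.isBounded
  have hlim := (tendsto_rpow_nhdsGT_zero (sub_pos.2 ht)).mul_const (C * ∫ w, ‖F w‖ * ‖w‖)
  rw [zero_mul] at hlim
  refine squeeze_zero' ?_ ?_ hlim
  · filter_upwards [eventually_mem_nhdsWithin] with ε hε
    exact mul_nonneg (Real.rpow_nonneg (le_of_lt hε) _) (norm_nonneg _)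
  filter_upwards [(hq.zoom hF hFc).1, hC, eventually_mem_nhdsWithin] with ε hs hlip hpos
  have hint : Integrable fun w ↦ F w * q ε (z₀ + ε • w) :=
    hs.continuous.integrable_of_hasCompactSupport hFc.mul_right
  have hint' : Integrable fun w ↦ F w * q ε z₀ :=
    (hF.continuous.integrable_of_hasCompactSupport hFc).mul_const _
  have hFw : Integrable fun w ↦ ‖F w‖ * ‖w‖ :=
    (hF.continuous.norm.mul continuous_norm).integrable_of_hasCompactSupport hFc.norm.mul_right
  have h1 : ‖(∫ w, F w * q ε (z₀ + ε • w)) - (∫ w, F w) * q ε z₀‖ ≤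
      ε * (C * ∫ w, ‖F w‖ * ‖w‖) := by
    rw [← integral_mul_const, ← integral_sub hint hint', ← integral_const_mul, ← integral_const_mul]
    refine norm_integral_le_of_norm_le ((hFw.const_mul _).const_mul _) (ae_of_all _ fun w ↦ ?_)
    rw [← mul_sub, norm_mul]
    by_cases hw : w ∈ tsupport F
    · calc _ ≤ ‖F w‖ * (C * (ε * ‖w‖)) := mul_le_mul_of_nonneg_left (hlip w hw) (norm_nonneg _)
        _ = _ := by ring
    · simp [image_eq_zero_of_notMem_tsupport hw]
  calc _ ≤ ε ^ (-t) * (ε * (C * ∫ w, ‖F w‖ * ‖w‖)) :=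
        mul_le_mul_of_nonneg_left h1 (Real.rpow_nonneg (le_of_lt hpos) _)
    _ = _ := by
      rw [← mul_assoc, sub_eq_neg_add, Real.rpow_add hpos, Real.rpow_one]

end Averages

section ScaledMul

variable {D : ℕ} {S : Spacetime.{u} D} {κ : OpenPartialHomeomorph S.M (Vec D)}

theorem CBundle.scaledMul_smul (V : CBundle S) (c : ℂ) (ε : ℝ) (z₀ : Vec D) (F : Vec D → ℂ)
    (G : S.M → V.Fib) : V.scaledMul κ ε z₀ F (c • G) = c • V.scaledMul κ ε z₀ F G := by
  funext x
  by_cases hx : x ∈ κ.source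
  · simp only [scaledMul, indicator_of_mem hx, Pi.smul_apply]
    rw [smul_comm]
  · simp [scaledMul, hx]

theorem locallyBdd_inv_volDensity (hκ : S.IsChart κ) {y : S.M} (hy : y ∈ κ.source) :
    LocallyBdd (κ y) fun _ z ↦ (((S.volDensity κ z)⁻¹ : ℝ) : ℂ) := by
  refine LocallyBdd.of_contDiffAt ?_
  filter_upwards [κ.open_target.mem_nhds (κ.map_source hy)] with z hz
  have h1 : ContDiffAt ℝ ∞ (S.volDensity κ) z :=
    (S.contDiffOn_volDensity hκ).contDiffAt (κ.open_target.mem_nhds hz)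
  exact Complex.ofRealCLM.contDiff.contDiffAt.comp z (h1.inv (S.volDensity_pos hκ hz).ne')

/-- A section with bounded components, multiplied by a concentrated test function, is a sum of
concentrated test sections. -/
theorem CBundle.exists_scaledMul_eq_sum (V : CBundle S) (hκ : S.IsChart κ) {y : S.M}
    (hy : y ∈ κ.source) {a : V.idx} (ha : y ∈ V.core.baseSet a) {G : ℝ → S.M → V.Fib}
    (hG : ∀ m, LocallyBdd (κ y) fun ε z ↦ V.rep a (κ.symm z) (G ε (κ.symm z)) m) {F : Vec D → ℂ}
    (hF : ContDiff ℝ ∞ F) (hFc : HasCompactSupport F) :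
    ∃ (s : Fin V.rank → S.M → V.Fib) (q : Fin V.rank → ℝ → Vec D → ℂ),
      (∀ m, V.IsSmooth (s m)) ∧ (∀ m, LocallyBdd (κ y) (q m)) ∧ ∀ U ∈ 𝓝 y, ∀ᶠ ε : ℝ in 𝓝[>] 0,
        V.scaledMul κ ε (κ y) F (G ε) = ∑ m, V.chartMul κ
          (rescale ((ε ^ D)⁻¹ : ℝ) ε (κ y) fun w ↦ F w * q m ε (κ y + ε • w)) (s m) ∧
        ∀ m, V.IsTest (V.chartMul κ
            (rescale ((ε ^ D)⁻¹ : ℝ) ε (κ y) fun w ↦ F w * q m ε (κ y + ε • w)) (s m)) ∧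
          tsupport (V.chartMul κ
            (rescale ((ε ^ D)⁻¹ : ℝ) ε (κ y) fun w ↦ F w * q m ε (κ y + ε • w)) (s m)) ⊆ U := by
  obtain ⟨s, hs, hfr⟩ := V.exists_local_frame a ha
  have hq : ∀ m, LocallyBdd (κ y) fun ε z ↦
      (((S.volDensity κ z)⁻¹ : ℝ) : ℂ) * V.rep a (κ.symm z) (G ε (κ.symm z)) m :=
    fun m ↦ (locallyBdd_inv_volDensity hκ hy).mul (hG m)
  refine ⟨s, _, hs, hq, fun U hU ↦ ?_⟩
  obtain ⟨ρ, hρ, ht, hUρ⟩ := exists_closedBall_subset hy (inter_mem hU hfr)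
  filter_upwards [eventually_zoom_mem (Metric.closedBall_mem_nhds (κ y) hρ) hFc.isCompact,
    eventually_all.2 fun m ↦ ((hq m).zoom hF hFc).1, eventually_mem_nhdsWithin] with ε hz hsm hpos
  have hne : ε ≠ 0 := ne_of_gt hpos
  refine ⟨V.scaledMul_eq_sum (N := {x | ∀ v, v = ∑ m, V.rep a x v m • s m x}) (fun x hx ↦ hx) hne
    (fun w hw ↦ (hUρ ⟨_, hz w hw, rfl⟩).2.2) _, fun m ↦ ?_⟩
  have hsupp := support_rescale_subset (c := ((ε ^ D)⁻¹ : ℝ)) (z := κ y)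
    (F := fun w ↦ F w * ((((S.volDensity κ (κ y + ε • w))⁻¹ : ℝ) : ℂ) *
      V.rep a (κ.symm (κ y + ε • w)) (G ε (κ.symm (κ y + ε • w))) m))
    ((Function.support_mul_subset_left _ _).trans (subset_tsupport F)) hne hz
  exact ⟨V.isTest_chartMul hκ (isCompact_closedBall _ _) ht hsupp (contDiff_rescale (hsm m) _ _ _)
    (hs m), (V.tsupport_chartMul_subset (isCompact_closedBall _ _) ht hsupp).trans
      (hUρ.trans inter_subset_left)⟩

end ScaledMul

namespace OPESystem

variable {D : ℕ} {Q : OPESystem.{u, v, w} D} {b : Q.Bg} {y : Q.Pt b}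
  {κ : OpenPartialHomeomorph (Q.Pt b) (Vec D)}

theorem eventually_isTest_scaledMul (hκ : (Q.st b).IsChart κ) (hy : y ∈ κ.source) {i : Q.Label}
    {G : ℝ → Q.Pt b → (Q.V b i).Fib} {a : (Q.V b i).idx} (ha : y ∈ (Q.V b i).core.baseSet a)
    (hG : ∀ m, LocallyBdd (κ y) fun ε z ↦ (Q.V b i).rep a (κ.symm z) (G ε (κ.symm z)) m)
    {F : Vec D → ℂ} (hF : ContDiff ℝ ∞ F) (hFc : HasCompactSupport F) {U : Set (Q.Pt b)}
    (hU : U ∈ 𝓝 y) : ∀ᶠ ε : ℝ in 𝓝[>] 0,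
      (Q.V b i).IsTest ((Q.V b i).scaledMul κ ε (κ y) F (G ε)) ∧
        tsupport ((Q.V b i).scaledMul κ ε (κ y) F (G ε)) ⊆ U := by
  obtain ⟨s, q, -, -, h⟩ := (Q.V b i).exists_scaledMul_eq_sum hκ hy ha hG hF hFc
  filter_upwards [h U hU] with ε hε
  rw [hε.1]
  exact isTest_sum (W := Q.V b) _ fun m _ ↦ hε.2 m

/-- The bound on the scaling degree extends to test sections that contain, besides the concentrated
test functions, sections which vary with the scale in a bounded way. -/
theorem tendsto_coef_scaledMul (hQ : Q.Axioms) (hκ : (Q.st b).IsChart κ) (hy : y ∈ κ.source)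
    {i j : Q.Label} (k : Q.Label) {G : ℝ → Q.Pt b → (Q.V b i).Fib}
    {G' : ℝ → Q.Pt b → (Q.V b j).Fib} {a : (Q.V b i).idx} (ha : y ∈ (Q.V b i).core.baseSet a)
    {a' : (Q.V b j).idx} (ha' : y ∈ (Q.V b j).core.baseSet a')
    (hG : ∀ m, LocallyBdd (κ y) fun ε z ↦ (Q.V b i).rep a (κ.symm z) (G ε (κ.symm z)) m)
    (hG' : ∀ m, LocallyBdd (κ y) fun ε z ↦ (Q.V b j).rep a' (κ.symm z) (G' ε (κ.symm z)) m)
    {F F' : Vec D → ℂ} (hF : ContDiff ℝ ∞ F) (hFc : HasCompactSupport F) (hF' : ContDiff ℝ ∞ F')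
    (hFc' : HasCompactSupport F') {r : ℝ} (hr : Q.dim i + Q.dim j - Q.dim k < r) :
    Tendsto (fun ε : ℝ ↦ ε ^ r * ‖Q.coef b [⟨i, (Q.V b i).scaledMul κ ε (κ y) F (G ε)⟩,
      ⟨j, (Q.V b j).scaledMul κ ε (κ y) F' (G' ε)⟩] k y‖) (𝓝[>] 0) (𝓝 0) := by
  obtain ⟨s, q, hs, hq, h⟩ := (Q.V b i).exists_scaledMul_eq_sum hκ hy ha hG hF hFc
  obtain ⟨s', q', hs', hq', h'⟩ := (Q.V b j).exists_scaledMul_eq_sum hκ hy ha' hG' hF' hFc'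
  obtain ⟨U, hUo, hyU, hU, -⟩ := hQ.coef_distribution b [i, j] k y
  have hd := hU y hyU
  have hUn := hUo.mem_nhds hyU
  have hlim : Tendsto (fun ε : ℝ ↦ ∑ m, ∑ m', ε ^ r * ‖Q.coef b
      [concFactor (Q.V b) i κ ε (κ y) (fun w ↦ F w * q m ε (κ y + ε • w)) (s m),
        concFactor (Q.V b) j κ ε (κ y) (fun w ↦ F' w * q' m' ε (κ y + ε • w)) (s' m')] k y‖)
      (𝓝[>] 0) (𝓝 0) := by
    obtain ⟨r₀, hr₀, hr₁⟩ := exists_between hr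
    have : ∀ m m', Tendsto (fun ε : ℝ ↦ ε ^ r * ‖Q.coef b
        [concFactor (Q.V b) i κ ε (κ y) (fun w ↦ F w * q m ε (κ y + ε • w)) (s m),
          concFactor (Q.V b) j κ ε (κ y) (fun w ↦ F' w * q' m' ε (κ y + ε • w)) (s' m')] k y‖)
        (𝓝[>] 0) (𝓝 0) := fun m m' ↦
      tendsto_bilinear_zoom (hq m) (hq' m') hF hFc hF' hFc'
        (fun ε h h' ↦ Q.coef b [concFactor (Q.V b) i κ ε (κ y) h (s m),
          concFactor (Q.V b) j κ ε (κ y) h' (s' m')] k y) hr₁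
        (fun K K' ↦ hd.eventually_bilinear hκ hy hUn (hs m) (hs' m') K K')
        fun h h' hh hhc hh' hhc' ↦ tendsto_coef_pair hQ hκ hy ⟨i, h, s m, hh, hhc, hs m⟩
          ⟨j, h', s' m', hh', hhc', hs' m'⟩ k hr₀
    have h0 := tendsto_finsetSum Finset.univ fun m _ ↦
      tendsto_finsetSum Finset.univ fun m' _ ↦ this m m'
    simpa using h0
  refine squeeze_zero' ?_ ?_ hlim
  · filter_upwards [eventually_mem_nhdsWithin] with ε hε
    exact mul_nonneg (Real.rpow_nonneg (le_of_lt hε) _) (norm_nonneg _)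
  filter_upwards [h U hUn, h' U hUn, eventually_mem_nhdsWithin] with ε hε hε' hpos
  rw [hε.1, hε'.1, hd.map_sum_sum _ _ (fun m _ ↦ hε.2 m) (fun m _ ↦ hε'.2 m)]
  simp_rw [← Finset.mul_sum]
  exact mul_le_mul_of_nonneg_left ((norm_sum_le _ _).trans (Finset.sum_le_sum fun m _ ↦
    norm_sum_le _ _)) (Real.rpow_nonneg (le_of_lt hpos) _)

/-- The section obtained by merging two concentrated fields into the field `a`. -/
def merged (Q : OPESystem.{u, v, w} D) (b : Q.Bg) (κ : OpenPartialHomeomorph (Q.Pt b) (Vec D))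
    (p p' : ProductProfile (Q.V b)) (lam : ℝ) (a : Q.Label) : Q.Pt b → (Q.V b a).Fib :=
  fun x ↦ Q.coef b [p.conc κ lam (κ x), p'.conc κ lam (κ x)] a x

/-- The components of the merged section, on the scale `ε²` of the pairs, are bounded after
multiplication with a sufficiently high power of that scale. -/
theorem locallyBdd_merged (hQ : Q.Axioms) (hκ : (Q.st b).IsChart κ) (hy : y ∈ κ.source)
    (p p' : ProductProfile (Q.V b)) (k : Q.Label) {r : ℝ}
    (hr : Q.dim p.label + Q.dim p'.label - Q.dim k < r) {a : (Q.V b k).idx}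
    (ha : y ∈ (Q.V b k).core.baseSet a) (m : Fin (Q.V b k).rank) :
    LocallyBdd (κ y) fun ε z ↦ (Q.V b k).rep a (κ.symm z)
      (((((ε ^ 2 : ℝ) ^ r : ℝ) : ℂ) • Q.merged b κ p p' (ε ^ 2) k) (κ.symm z)) m := by
  simp only [Pi.smul_apply, CBundle.rep_smul, smul_eq_mul]
  exact (locallyBdd_pair hQ hκ hy p p' k hr ha m).comp_sq

/-- The magnitude of the terms that arise from the associativity axiom when four fields are first
merged in pairs. -/
theorem tendsto_coef_merged (hQ : Q.Axioms) (hκ : (Q.st b).IsChart κ) (hy : y ∈ κ.source)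
    (p₁ p₁' p₂ p₂' : ProductProfile (Q.V b)) (i j k : Q.Label) {F F' : Vec D → ℂ}
    (hF : ContDiff ℝ ∞ F) (hFc : HasCompactSupport F) (hF' : ContDiff ℝ ∞ F')
    (hFc' : HasCompactSupport F') {r : ℝ}
    (hr : 2 * (Q.dim p₁.label + Q.dim p₁'.label - Q.dim i) +
      2 * (Q.dim p₂.label + Q.dim p₂'.label - Q.dim j) + (Q.dim i + Q.dim j - Q.dim k) < r) :
    Tendsto (fun ε : ℝ ↦ ε ^ r *
      ‖Q.coef b [⟨i, (Q.V b i).scaledMul κ ε (κ y) F (Q.merged b κ p₁ p₁' (ε ^ 2) i)⟩,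
        ⟨j, (Q.V b j).scaledMul κ ε (κ y) F' (Q.merged b κ p₂ p₂' (ε ^ 2) j)⟩] k y‖)
      (𝓝[>] 0) (𝓝 0) := by
  -- The slack in `r` is shared between the two inner coefficients, on the scale `ε²`, which accounts for
  -- the factors `2`, and the outer one, on the scale `ε`.
  obtain ⟨η, hη, hηr⟩ : ∃ η > 0, r = 2 * (Q.dim p₁.label + Q.dim p₁'.label - Q.dim i + η) +
      2 * (Q.dim p₂.label + Q.dim p₂'.label - Q.dim j + η) +
      (Q.dim i + Q.dim j - Q.dim k + η) :=
    ⟨(r - (2 * (Q.dim p₁.label + Q.dim p₁'.label - Q.dim i) +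
      2 * (Q.dim p₂.label + Q.dim p₂'.label - Q.dim j) + (Q.dim i + Q.dim j - Q.dim k))) / 5,
      by linarith, by ring⟩
  set r₁ := Q.dim p₁.label + Q.dim p₁'.label - Q.dim i + η
  set r₂ := Q.dim p₂.label + Q.dim p₂'.label - Q.dim j + η
  have hG := locallyBdd_merged hQ hκ hy p₁ p₁' i (r := r₁) (by simp [r₁, hη])
    ((Q.V b i).core.mem_baseSet_at y)
  have hG' := locallyBdd_merged hQ hκ hy p₂ p₂' j (r := r₂) (by simp [r₂, hη])
    ((Q.V b j).core.mem_baseSet_at y)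
  obtain ⟨U, hUo, hyU, hU, -⟩ := hQ.coef_distribution b [i, j] k y
  have hUn := hUo.mem_nhds hyU
  refine (tendsto_coef_scaledMul hQ hκ hy k ((Q.V b i).core.mem_baseSet_at y)
    ((Q.V b j).core.mem_baseSet_at y) hG hG' hF hFc hF' hFc'
    (r := Q.dim i + Q.dim j - Q.dim k + η) (by linarith)).congr' ?_
  filter_upwards [eventually_isTest_scaledMul hκ hy ((Q.V b i).core.mem_baseSet_at y) hG hF hFc hUn,
    eventually_isTest_scaledMul hκ hy ((Q.V b j).core.mem_baseSet_at y) hG' hF' hFc' hUn,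
    eventually_mem_nhdsWithin] with ε h h' hpos
  have hpos : 0 < ε := hpos
  have hc : ∀ t : ℝ, ((((ε ^ 2 : ℝ) ^ t : ℝ) : ℂ)) ≠ 0 := fun t ↦ by
    exact_mod_cast (Real.rpow_pos_of_pos (pow_pos hpos 2) t).ne'
  have h1 := (hU y hyU).map_smul_smul ((((ε ^ 2 : ℝ) ^ r₁ : ℝ) : ℂ))⁻¹
    ((((ε ^ 2 : ℝ) ^ r₂ : ℝ) : ℂ))⁻¹ h h'
  rw [CBundle.scaledMul_smul, CBundle.scaledMul_smul, inv_smul_smul₀ (hc _),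
    inv_smul_smul₀ (hc _)] at h1
  rw [h1, norm_smul, CBundle.scaledMul_smul, CBundle.scaledMul_smul, norm_mul, norm_inv, norm_inv,
    Complex.norm_real, Complex.norm_real, Real.norm_of_nonneg (by positivity),
    Real.norm_of_nonneg (by positivity), ← mul_assoc]
  congr 1
  have h2 : ∀ t : ℝ, (ε ^ 2 : ℝ) ^ t = ε ^ (2 * t) := fun t ↦ by
    rw [Real.rpow_mul hpos.le, Real.rpow_two]
  rw [h2, h2, hηr, Real.rpow_add hpos (2 * r₁ + 2 * r₂), Real.rpow_add hpos (2 * r₁)]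
  have h3 := (Real.rpow_pos_of_pos hpos (2 * r₁)).ne'
  have h4 := (Real.rpow_pos_of_pos hpos (2 * r₂)).ne'
  generalize ε ^ (2 * r₁) = A at *
  generalize ε ^ (2 * r₂) = B at *
  field_simp

end OPESystem

theorem eventually_isTest_concFactor {D : ℕ} {S : Spacetime.{u} D} {Label : Type w}
    {W : Label → CBundle S} {κ : OpenPartialHomeomorph S.M (Vec D)} (hκ : S.IsChart κ) {y : S.M}
    (hy : y ∈ κ.source) {i : Label} {F : Vec D → ℂ} {s : S.M → (W i).Fib} (hF : ContDiff ℝ ∞ F)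
    (hFc : HasCompactSupport F) (hs : (W i).IsSmooth s) {U : Set S.M} (hU : U ∈ 𝓝 y) :
    ∀ᶠ ε : ℝ in 𝓝[>] 0, (W i).IsTest (concFactor W i κ ε (κ y) F s).2 ∧
      tsupport (concFactor W i κ ε (κ y) F s).2 ⊆ U := by
  obtain ⟨ρ, hρ, ht, hUρ⟩ := exists_closedBall_subset hy hU
  filter_upwards [eventually_zoom_mem (Metric.closedBall_mem_nhds (κ y) hρ) hFc.isCompact,
    eventually_mem_nhdsWithin] with ε hz hpos
  have := isTest_concFactor hκ (W := W) (ne_of_gt (mem_Ioi.1 hpos)) hF hs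
    (isCompact_closedBall _ _) ht fun w hw ↦ hz w (subset_tsupport _ hw)
  exact ⟨this.1, this.2.trans hUρ⟩

theorem exists_testFunction_integral_one {D : ℕ} (a : Vec D) {θ : ℝ} (hθ : 0 < θ) :
    ∃ F : Vec D → ℂ, (ContDiff ℝ ∞ F ∧ HasCompactSupport F ∧ ∫ w, F w = 1) ∧
      tsupport F ⊆ Metric.closedBall a θ := by
  let η : ContDiffBump a := ⟨θ / 2, θ, half_pos hθ, half_lt_self hθ⟩
  refine ⟨fun w ↦ (η.normed volume w : ℂ), ⟨Complex.ofRealCLM.contDiff.comp η.contDiff_normed,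
    η.hasCompactSupport_normed.comp_left Complex.ofReal_zero, ?_⟩, ?_⟩
  · rw [integral_complex_ofReal, η.integral_normed, Complex.ofReal_one]
  · rw [← η.tsupport_normed_eq (μ := volume)]
    exact closure_mono fun w hw hw' ↦ hw (by simp [hw'])

namespace OPESystem

variable {D : ℕ} {Q : OPESystem.{u, v, w} D} {b : Q.Bg} {y : Q.Pt b}
  {κ : OpenPartialHomeomorph (Q.Pt b) (Vec D)}

theorem dim_one (hQ : Q.Axioms) : Q.dim Q.one = 0 := (hQ.dim_eq_zero _).2 rfl

/-! ### The identity field -/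

/-- In the integral of a section of the trivial bundle that contains a concentrated test function,
the metric density cancels. -/
theorem chartIntegral_unit_scaledMul (hκ : (Q.st b).IsChart κ) {ε : ℝ} (hε : 0 < ε) {z₀ : Vec D}
    {F : Vec D → ℂ} (hF : ∀ w ∈ Function.support F, z₀ + ε • w ∈ κ.target)
    (G : Q.Pt b → (Q.V b Q.one).Fib) :
    (Q.st b).chartIntegral κ
        (fun x ↦ Q.unit b x ((Q.V b Q.one).scaledMul κ ε z₀ F G x)) =
      ∫ w, F w * Q.unit b (κ.symm (z₀ + ε • w)) (G (κ.symm (z₀ + ε • w))) := by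
  set h : Vec D → ℂ := fun w ↦ F w * Q.unit b (κ.symm (z₀ + ε • w)) (G (κ.symm (z₀ + ε • w)))
    with hdef
  have hback : ∀ z, z₀ + ε • ε⁻¹ • (z - z₀) = z := fun z ↦ by
    rw [smul_smul, mul_inv_cancel₀ hε.ne', one_smul, add_sub_cancel]
  have h1 : (Q.st b).chartIntegral κ
      (fun x ↦ Q.unit b x ((Q.V b Q.one).scaledMul κ ε z₀ F G x)) =
      ∫ z in κ.target, (ε ^ D)⁻¹ • h (ε⁻¹ • (z - z₀)) := by
    refine setIntegral_congr_fun κ.open_target.measurableSet fun z hz ↦ ?_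
    have hv : (((Q.st b).volDensity κ z : ℝ) : ℂ) ≠ 0 := by
      exact_mod_cast ((Q.st b).volDensity_pos hκ hz).ne'
    simp only [CBundle.scaledMul, indicator_of_mem (κ.map_target hz), κ.right_inv hz, hdef, hback,
      map_smul, smul_eq_mul, Complex.real_smul, mul_inv]
    push_cast
    field_simp
  have h2 : ∫ z in κ.target, (ε ^ D)⁻¹ • h (ε⁻¹ • (z - z₀)) =
      ∫ z, (ε ^ D)⁻¹ • h (ε⁻¹ • (z - z₀)) := by
    refine setIntegral_eq_integral_of_forall_compl_eq_zero fun z hz ↦ ?_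
    have h0 : F (ε⁻¹ • (z - z₀)) = 0 := by
      by_contra h0
      exact hz (by simpa only [hback] using hF _ h0)
    simp [hdef, h0]
  rw [h1, h2, integral_sub_right_eq_self (fun z ↦ (ε ^ D)⁻¹ • h (ε⁻¹ • z)) z₀, integral_smul,
    Measure.integral_comp_inv_smul_of_nonneg _ _ hε.le, finrank_euclideanSpace_fin, smul_smul,
    inv_mul_cancel₀ (pow_pos hε D).ne', one_smul]

/-- Two identity fields may be omitted together. -/
theorem exists_coef_one_one (hQ : Q.Axioms) (hκ : (Q.st b).IsChart κ) (hy : y ∈ κ.source)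
    (k : Q.Label) : ∃ U ∈ 𝓝 y, ∀ f f' : Q.Pt b → (Q.V b Q.one).Fib,
      ((Q.V b Q.one).IsTest f ∧ tsupport f ⊆ U) → ((Q.V b Q.one).IsTest f' ∧ tsupport f' ⊆ U) →
      Q.coef b [⟨Q.one, f⟩, ⟨Q.one, f'⟩] k y =
        ((Q.st b).chartIntegral κ (fun x ↦ Q.unit b x (f x)) *
          (Q.st b).chartIntegral κ (fun x ↦ Q.unit b x (f' x))) • Q.coef b [] k y := by
  obtain ⟨U₁, hU₁, hy₁, h₁⟩ := hQ.identity_left b [] [Q.one] k y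
  obtain ⟨U₂, hU₂, hy₂, h₂⟩ := hQ.identity_left b [] [] k y
  refine ⟨U₁ ∩ U₂ ∩ κ.source, inter_mem (inter_mem (hU₁.mem_nhds hy₁) (hU₂.mem_nhds hy₂))
    (κ.open_source.mem_nhds hy), fun f f' hf hf' ↦ ?_⟩
  have e1 := h₁ y hy₁ [] [⟨Q.one, f'⟩] f κ rfl rfl
    (testIn_pair ⟨hf.1, fun x hx ↦ (hf.2 hx).1.1⟩ ⟨hf'.1, fun x hx ↦ (hf'.2 hx).1.1⟩) hκ
    fun x hx ↦ (hf.2 hx).2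
  have e2 := h₂ y hy₂ [] [] f' κ rfl rfl (by
    intro p hp
    simp only [List.nil_append, List.mem_cons, List.not_mem_nil, or_false] at hp
    subst hp
    exact ⟨hf'.1, fun x hx ↦ (hf'.2 hx).1.2⟩) hκ fun x hx ↦ (hf'.2 hx).2
  simp only [List.nil_append] at e1 e2
  rw [e1, e2, smul_smul]

/-- There are test sections for the identity field with prescribed integrals. -/
theorem exists_unit_section (Q : OPESystem.{u, v, w} D) (b : Q.Bg) {y : Q.Pt b}
    {κ : OpenPartialHomeomorph (Q.Pt b) (Vec D)} (hκ : (Q.st b).IsChart κ) (hy : y ∈ κ.source) :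
    ∃ s : Q.Pt b → (Q.V b Q.one).Fib, (Q.V b Q.one).IsSmooth s ∧ ∀ F : Vec D → ℂ,
      HasCompactSupport F → ∀ᶠ ε : ℝ in 𝓝[>] 0, (Q.st b).chartIntegral κ (fun x ↦
        Q.unit b x ((concFactor (Q.V b) Q.one κ ε (κ y) F s).2 x)) = ∫ w, F w := by
  obtain ⟨χ, -, hχ⟩ := (SmoothBumpFunction.nhds_basis_tsupport (I := 𝓡 D) y).mem_iff.1
    (κ.open_source.mem_nhds hy)
  refine ⟨fun x ↦ (Q.unit b x).symm ((χ x : ℂ) * (((Q.st b).volDensity κ (κ x))⁻¹ : ℝ)), ?_,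
    fun F hFc ↦ ?_⟩
  · rw [Q.unit_smooth]
    rw [← contMDiffOn_univ]
    refine contMDiffOn_of_zero_off (g := fun x ↦ (χ x : ℂ) *
      (((Q.st b).volDensity κ (κ x))⁻¹ : ℝ)) κ.open_source (isClosed_tsupport χ) hχ ?_
      (fun _ _ ↦ rfl) fun x hx ↦ by simp [image_eq_zero_of_notMem_tsupport hx]
    rw [inter_univ]
    have h1 : ContMDiffOn (𝓡 D) 𝓘(ℝ, ℂ) ∞ (fun x ↦ (χ x : ℂ)) κ.source :=
      Complex.ofRealCLM.contDiff.contMDiff.comp_contMDiffOn χ.contMDiff.contMDiffOn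
    have h2 : ContDiffOn ℝ ∞ (fun z ↦ (((Q.st b).volDensity κ z)⁻¹ : ℝ)) κ.target :=
      ((Q.st b).contDiffOn_volDensity hκ).inv fun z hz ↦ ((Q.st b).volDensity_pos hκ hz).ne'
    have h3 : ContMDiffOn (𝓡 D) 𝓘(ℝ, ℂ) ∞
        (fun x ↦ ((((Q.st b).volDensity κ (κ x))⁻¹ : ℝ) : ℂ)) κ.source :=
      (Complex.ofRealCLM.contDiff.comp_contDiffOn h2).contMDiffOn.comp
        (contMDiffOn_of_mem_maximalAtlas hκ) fun x hx ↦ κ.map_source hx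
    exact contMDiffOn_smul_complex h1 h3
  · obtain ⟨ρ, hρ, ht, hU⟩ := exists_closedBall_subset hy χ.eventuallyEq_one
    filter_upwards [eventually_zoom_mem (Metric.closedBall_mem_nhds (κ y) hρ) hFc.isCompact,
      eventually_mem_nhdsWithin] with ε hz hpos
    have hpos : 0 < ε := hpos
    have h1 : (concFactor (Q.V b) Q.one κ ε (κ y) F fun x ↦
        (Q.unit b x).symm ((χ x : ℂ) * (((Q.st b).volDensity κ (κ x))⁻¹ : ℝ))).2 =
        (Q.V b Q.one).scaledMul κ ε (κ y) F fun x ↦ (Q.unit b x).symm 1 := by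
      funext x
      by_cases hx : x ∈ κ.source
      · simp only [concFactor, CBundle.chartMul_apply_of_mem _ hx, CBundle.scaledMul,
          indicator_of_mem hx, rescale]
        by_cases hF : F (ε⁻¹ • (κ x - κ y)) = 0
        · simp [hF]
        have h2 := hz _ (subset_tsupport _ hF)
        rw [smul_smul, mul_inv_cancel₀ hpos.ne', one_smul, add_sub_cancel] at h2
        have h3 : χ x = 1 := hU ⟨κ x, h2, κ.left_inv hx⟩
        rw [h3, ← map_smul, ← map_smul]
        congr 1
        simp only [smul_eq_mul, mul_inv]
        push_cast
        ring
      · simp [concFactor, CBundle.chartMul, CBundle.scaledMul, hx]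
    rw [h1, chartIntegral_unit_scaledMul hκ hpos
      fun w hw ↦ ht (hz w (subset_tsupport _ hw))]
    simp

/-- The coefficient without upper labels has no component in the direction of a field other than the
identity: with two identity fields added, it is a coefficient of negative scaling degree, but it does
not depend on the scale. -/
theorem coef_nil_eq_zero (hQ : Q.Axioms) (b : Q.Bg) (y : Q.Pt b) {j : Q.Label} (hj : j ≠ Q.one) :
    Q.coef b [] j y = 0 := by
  let κ : OpenPartialHomeomorph (Q.Pt b) (Vec D) := chartAt (Vec D) y
  have hκ : (Q.st b).IsChart κ := IsManifold.chart_mem_maximalAtlas y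
  have hy : y ∈ κ.source := mem_chart_source _ y
  obtain ⟨s, hs, hint⟩ := exists_unit_section Q b hκ hy
  obtain ⟨F, ⟨hF, hFc, hF1⟩, -⟩ := exists_testFunction_integral_one (0 : Vec D) one_pos
  obtain ⟨U, hU, h1⟩ := exists_coef_one_one hQ hκ hy j
  let p : ProductProfile (Q.V b) := ⟨Q.one, F, s, hF, hFc, hs⟩
  have h2 := tendsto_coef_pair hQ hκ hy p p j (r := 0) (by
    have h3 := (hQ.dim_nonneg j).lt_of_ne fun h ↦ hj ((hQ.dim_eq_zero j).1 h.symm)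
    simp only [p, dim_one hQ]
    linarith)
  have h3 : Tendsto (fun _ : ℝ ↦ ‖Q.coef b [] j y‖) (𝓝[>] 0) (𝓝 0) := by
    refine h2.congr' ?_
    filter_upwards [eventually_isTest_concFactor hκ hy hF hFc hs hU, hint F hFc] with ε ht hi
    rw [Real.rpow_zero, one_mul]
    change ‖Q.coef b [⟨Q.one, (concFactor (Q.V b) Q.one κ ε (κ y) F s).2⟩,
      ⟨Q.one, (concFactor (Q.V b) Q.one κ ε (κ y) F s).2⟩] j y‖ = _
    rw [h1 _ _ ht ht, hi, hF1, one_mul, one_smul]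
  exact norm_eq_zero.1 (tendsto_nhds_unique tendsto_const_nhds h3)

theorem field_of_isTest {p : Factor (Q.V b)} (h : (Q.V b p.1).IsTest p.2) :
    Q.field b p = RingQuot.mkRingHom _ (FreeStar.gen (⟨p.1, p.2, h⟩ : Q.Gen b)) := dif_pos h

theorem field_one (hκ : (Q.st b).IsChart κ) {f : Q.Pt b → (Q.V b Q.one).Fib}
    (hf : (Q.V b Q.one).IsTest f) (hfκ : tsupport f ⊆ κ.source) :
    Q.field b ⟨Q.one, f⟩ =
      algebraMap ℂ (Q.Alg b) ((Q.st b).chartIntegral κ fun x ↦ Q.unit b x (f x)) := by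
  rw [field_of_isTest hf]
  refine (RingQuot.mkRingHom_rel (StarRel.of (Rel.identity κ hκ ⟨f, hf⟩ hfκ))).trans ?_
  rw [← RingQuot.mkAlgHom_coe ℂ]
  exact AlgHom.commutes _ _

/-- In each state, the coefficient without upper labels combines with the one-point function of the
identity to `1`. This is the operator product expansion of two identity fields, whose two-point
function is constant. -/
theorem onePoint_coef_nil (hQ : Q.Axioms) (ψ : Q.State b) (y : Q.Pt b) :
    ψ.onePoint Q.one y (Q.coef b [] Q.one y) = 1 := by
  let κ : OpenPartialHomeomorph (Q.Pt b) (Vec D) := chartAt (Vec D) y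
  have hκ : (Q.st b).IsChart κ := IsManifold.chart_mem_maximalAtlas y
  have hy : y ∈ κ.source := mem_chart_source _ y
  obtain ⟨s, hs, hint⟩ := exists_unit_section Q b hκ hy
  obtain ⟨F, ⟨hF, hFc, hF1⟩, -⟩ := exists_testFunction_integral_one (0 : Vec D) one_pos
  let p : ProductProfile (Q.V b) := ⟨Q.one, F, s, hF, hFc, hs⟩
  choose U hU h1 using fun k ↦ exists_coef_one_one hQ hκ hy k
  obtain ⟨Δ, hΔ, J, hJ, hope⟩ := ψ.ope y κ hκ hy [.leaf Q.one, .leaf Q.one] 1 one_pos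
  have h2 := hope [.leaf p.toProfile, .leaf p.toProfile]
    ⟨le_rfl, by
      intro t ht
      simp only [List.mem_cons, List.not_mem_nil, or_false, or_self] at ht
      subst ht
      exact .leaf p.isProfile⟩ (by simp [MergerTree.shapes, MergerTree.shape, p,
        ProductProfile.toProfile])
  have h1J : Q.one ∈ J := (hJ _).2 (by rw [dim_one hQ]; exact hΔ)
  have h3 : Tendsto (fun ε : ℝ ↦ ε ^ (-1 : ℝ) • (1 - ψ.onePoint Q.one y (Q.coef b [] Q.one y)))
      (𝓝[>] 0) (𝓝 0) := by
    refine h2.congr' ?_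
    filter_upwards [(Finset.eventually_all J).2 fun k _ ↦
        eventually_isTest_concFactor hκ hy hF hFc hs (hU k),
      eventually_isTest_concFactor hκ hy hF hFc hs (κ.open_source.mem_nhds hy),
      hint F hFc] with ε ht hts hi
    congr 1
    simp only [mergeLeavesList, mergeLeaves, ProductProfile.scaled_toProfile, List.append_nil,
      List.cons_append, List.nil_append, pow_one]
    congr 1
    · change ψ.toFun ([Q.field b ⟨Q.one, (concFactor (Q.V b) Q.one κ ε (κ y) F s).2⟩,
        Q.field b ⟨Q.one, (concFactor (Q.V b) Q.one κ ε (κ y) F s).2⟩].prod) = 1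
      rw [field_one hκ hts.1 hts.2, hi, hF1]
      simp [ψ.normalized]
    · have hc : ∀ k ∈ J, Q.coef b [p.conc κ ε (κ y), p.conc κ ε (κ y)] k y = Q.coef b [] k y := by
        intro k hk
        have := h1 k _ _ (ht k hk) (ht k hk)
        rw [hi, hF1, one_mul, one_smul] at this
        exact this
      rw [Finset.sum_eq_single_of_mem Q.one h1J, hc _ h1J]
      intro k hk hk1
      rw [hc k hk, coef_nil_eq_zero hQ b y hk1, map_zero]
  -- A constant that is `o(ε)` vanishes.
  have h4 := h3.norm
  rw [norm_zero] at h4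
  have h5 := h4.mul (tendsto_rpow_nhdsGT_zero one_pos)
  rw [mul_zero] at h5
  have h6 : Tendsto (fun _ : ℝ ↦ ‖1 - ψ.onePoint Q.one y (Q.coef b [] Q.one y)‖)
      (𝓝[>] 0) (𝓝 0) := by
    refine h5.congr' ?_
    filter_upwards [eventually_mem_nhdsWithin] with ε hε
    have hε : 0 < ε := hε
    rw [norm_smul, Real.norm_of_nonneg (by positivity), mul_right_comm, ← Real.rpow_add hε,
      neg_add_cancel, Real.rpow_zero, one_mul]
  exact (sub_eq_zero.1 (norm_eq_zero.1 (tendsto_nhds_unique tendsto_const_nhds h6))).symm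

end OPESystem

theorem tendsto_rpow_smul_iff {E : Type*} [NormedAddCommGroup E] [NormedSpace ℝ E] {r : ℝ}
    {u : ℝ → E} : Tendsto (fun ε : ℝ ↦ ε ^ r • u ε) (𝓝[>] 0) (𝓝 0) ↔
      Tendsto (fun ε : ℝ ↦ ε ^ r * ‖u ε‖) (𝓝[>] 0) (𝓝 0) := by
  rw [tendsto_zero_iff_norm_tendsto_zero]
  refine tendsto_congr' ?_
  filter_upwards [eventually_mem_nhdsWithin] with ε hε
  rw [norm_smul, Real.norm_of_nonneg (Real.rpow_nonneg (le_of_lt hε) _)]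

theorem tendsto_rpow_smul_mono {E : Type*} [NormedAddCommGroup E] [NormedSpace ℝ E] {r r' : ℝ}
    (hr : r < r') {u : ℝ → E} (h : Tendsto (fun ε : ℝ ↦ ε ^ r • u ε) (𝓝[>] 0) (𝓝 0)) :
    Tendsto (fun ε : ℝ ↦ ε ^ r' • u ε) (𝓝[>] 0) (𝓝 0) := by
  have h1 := (tendsto_rpow_nhdsGT_zero (sub_pos.2 hr)).smul h
  rw [smul_zero] at h1
  refine h1.congr' ?_
  filter_upwards [eventually_mem_nhdsWithin] with ε hε
  rw [smul_smul, ← Real.rpow_add hε, sub_add_cancel]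

theorem tendsto_rpow_smul_mul {r r' s : ℝ} (hs : r + r' = s) {u u' : ℝ → ℂ}
    (h : Tendsto (fun ε : ℝ ↦ ε ^ r • u ε) (𝓝[>] 0) (𝓝 0))
    (h' : Tendsto (fun ε : ℝ ↦ ε ^ r' • u' ε) (𝓝[>] 0) (𝓝 0)) :
    Tendsto (fun ε : ℝ ↦ ε ^ s • (u ε * u' ε)) (𝓝[>] 0) (𝓝 0) := by
  have h1 := h.mul h'
  rw [mul_zero] at h1
  refine h1.congr' ?_
  filter_upwards [eventually_mem_nhdsWithin] with ε hε
  rw [smul_mul_smul_comm, ← Real.rpow_add hε, hs]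

section

variable {X : Type*} [NormedAddCommGroup X] [NormedSpace ℝ X] {z₀ : X} {q q' : ℝ → X → ℂ}

theorem LocallyBdd.congr (hq : LocallyBdd z₀ q) (h : ∀ᶠ z in 𝓝 z₀, ∀ ε, q' ε z = q ε z) :
    LocallyBdd z₀ q' := by
  have h1 : ∀ᶠ p : ℝ × X in 𝓝[>] 0 ×ˢ 𝓝 z₀, q' p.1 =ᶠ[𝓝 p.2] q p.1 :=
    (eventually_eventually_nhds.2 h).prod_inr _ |>.mono fun p hp ↦ hp.mono fun z hz ↦ hz p.1
  refine ⟨?_, fun m ↦ ?_⟩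
  · filter_upwards [h1, hq.1] with p hp h using h.congr_of_eventuallyEq hp
  · obtain ⟨C, hC⟩ := hq.2 m
    refine ⟨C, ?_⟩
    filter_upwards [h1, hC] with p hp h
    rwa [(hp.iteratedFDeriv ℝ m).self_of_nhds]

theorem LocallyBdd.tendsto_rpow_smul (hq : LocallyBdd z₀ q) {s : ℝ} (hs : 0 < s) :
    Tendsto (fun ε : ℝ ↦ ε ^ s • q ε z₀) (𝓝[>] 0) (𝓝 0) := by
  obtain ⟨C, hC⟩ := hq.2 0
  have h1 := (tendsto_id.prodMk (tendsto_const_nhds (x := z₀))).eventually hC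
  refine tendsto_rpow_smul_iff.2 (squeeze_zero' ?_ ?_ (by
    simpa using (tendsto_rpow_nhdsGT_zero hs).mul_const C))
  · filter_upwards [eventually_mem_nhdsWithin] with ε hε
    exact mul_nonneg (Real.rpow_nonneg (le_of_lt hε) _) (norm_nonneg _)
  · filter_upwards [h1, eventually_mem_nhdsWithin] with ε hε hpos
    rw [norm_iteratedFDeriv_zero] at hε
    exact mul_le_mul_of_nonneg_left hε (Real.rpow_nonneg (le_of_lt hpos) _)

end

namespace OPESystem

variable {D : ℕ} {Q : OPESystem.{u, v, w} D} {b : Q.Bg} {y : Q.Pt b}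
  {κ : OpenPartialHomeomorph (Q.Pt b) (Vec D)}

/-! ### Merging two fields into the identity -/

/-- In a local frame, the trivialization of the bundle of the identity field has smooth components. -/
theorem locallyBdd_unit (hκ : (Q.st b).IsChart κ) (hy : y ∈ κ.source)
    {G : ℝ → Q.Pt b → (Q.V b Q.one).Fib} {a : (Q.V b Q.one).idx}
    (ha : y ∈ (Q.V b Q.one).core.baseSet a)
    (hG : ∀ m, LocallyBdd (κ y) fun ε z ↦ (Q.V b Q.one).rep a (κ.symm z) (G ε (κ.symm z)) m) :
    LocallyBdd (κ y) fun ε z ↦ Q.unit b (κ.symm z) (G ε (κ.symm z)) := by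
  obtain ⟨s, hs, hfr⟩ := (Q.V b Q.one).exists_local_frame a ha
  have hu : ∀ m, ContMDiff (𝓡 D) 𝓘(ℝ, ℂ) ∞ fun x ↦ Q.unit b x (s m x) := fun m ↦ by
    rw [← Q.unit_smooth]
    simpa using hs m
  have hl : ∀ m, LocallyBdd (κ y) fun _ z ↦ Q.unit b (κ.symm z) (s m (κ.symm z)) := fun m ↦ by
    refine LocallyBdd.of_contDiffAt ?_
    filter_upwards [κ.open_target.mem_nhds (κ.map_source hy)] with z hz
    have h1 : ContMDiffOn 𝓘(ℝ, Vec D) 𝓘(ℝ, ℂ) ∞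
        (fun z ↦ Q.unit b (κ.symm z) (s m (κ.symm z))) κ.target :=
      (hu m).comp_contMDiffOn (contMDiffOn_symm_of_mem_maximalAtlas hκ)
    exact (contMDiffOn_iff_contDiffOn.1 h1).contDiffAt (κ.open_target.mem_nhds hz)
  refine (LocallyBdd.sum Finset.univ fun m _ ↦ (hG m).mul (hl m)).congr ?_
  have hc := κ.continuousAt_symm (κ.map_source hy)
  rw [ContinuousAt, κ.left_inv hy] at hc
  filter_upwards [hc.eventually hfr] with z hz ε
  conv_lhs => rw [hz.2 (G ε (κ.symm z)), map_sum]
  simp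

theorem locallyBdd_unit_merged (hQ : Q.Axioms) (hκ : (Q.st b).IsChart κ) (hy : y ∈ κ.source)
    (p p' : ProductProfile (Q.V b)) {r : ℝ} (hr : Q.dim p.label + Q.dim p'.label < r) :
    LocallyBdd (κ y) fun ε z ↦ (((ε ^ 2 : ℝ) ^ r : ℝ) : ℂ) *
      Q.unit b (κ.symm z) (Q.merged b κ p p' (ε ^ 2) Q.one (κ.symm z)) := by
  have ha := (Q.V b Q.one).core.mem_baseSet_at y
  have := locallyBdd_unit hκ hy ha fun m ↦
    locallyBdd_merged hQ hκ hy p p' Q.one (r := r) (by rw [dim_one hQ]; linarith) ha m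
  refine this.congr (Eventually.of_forall fun z ε ↦ ?_)
  rw [Pi.smul_apply, map_smul, smul_eq_mul]

/-- The factor that a pair of fields, merged into the identity, contributes: the average, over the
position of the pair, of the coefficient of the identity. -/
def pairAverage (Q : OPESystem.{u, v, w} D) (b : Q.Bg) (κ : OpenPartialHomeomorph (Q.Pt b) (Vec D))
    (p p' : ProductProfile (Q.V b)) (y : Q.Pt b) (F : Vec D → ℂ) (ε : ℝ) : ℂ :=
  ∫ w, F w * Q.unit b (κ.symm (κ y + ε • w))
    (Q.merged b κ p p' (ε ^ 2) Q.one (κ.symm (κ y + ε • w)))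

theorem rpow_smul_sq {ε : ℝ} (hε : 0 < ε) {r s t : ℝ} (h : t = s - 2 * r) (x : ℂ) :
    ε ^ t • ((((ε ^ 2 : ℝ) ^ r : ℝ) : ℂ) * x) = ε ^ s • x := by
  rw [← Complex.real_smul, smul_smul, ← Real.rpow_two, ← Real.rpow_mul hε.le, ← Real.rpow_add hε, h]
  congr 2
  ring

theorem tendsto_pairValue (hQ : Q.Axioms) (hκ : (Q.st b).IsChart κ) (hy : y ∈ κ.source)
    (p p' : ProductProfile (Q.V b)) {s : ℝ} (hs : 2 * (Q.dim p.label + Q.dim p'.label) < s) :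
    Tendsto (fun ε : ℝ ↦ ε ^ s • Q.unit b y (Q.merged b κ p p' (ε ^ 2) Q.one y))
      (𝓝[>] 0) (𝓝 0) := by
  obtain ⟨r, hr, hrs⟩ := exists_between (show Q.dim p.label + Q.dim p'.label < s / 2 by linarith)
  have h1 := (locallyBdd_unit_merged hQ hκ hy p p' hr).tendsto_rpow_smul (s := s - 2 * r)
    (by linarith)
  refine h1.congr' ?_
  filter_upwards [eventually_mem_nhdsWithin] with ε hε
  rw [rpow_smul_sq hε rfl, κ.left_inv hy]

/-- The averaging over the position of the pair is on the scale `ε`, on which the coefficient is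
constant up to a relative error of order `ε`. -/
theorem tendsto_pairAverage_sub (hQ : Q.Axioms) (hκ : (Q.st b).IsChart κ) (hy : y ∈ κ.source)
    (p p' : ProductProfile (Q.V b)) {F : Vec D → ℂ} (hF : ContDiff ℝ ∞ F)
    (hFc : HasCompactSupport F) {s : ℝ} (hs : 2 * (Q.dim p.label + Q.dim p'.label) - 1 < s) :
    Tendsto (fun ε : ℝ ↦ ε ^ s • (Q.pairAverage b κ p p' y F ε -
      (∫ w, F w) * Q.unit b y (Q.merged b κ p p' (ε ^ 2) Q.one y))) (𝓝[>] 0) (𝓝 0) := by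
  obtain ⟨r, hr, hrs⟩ := exists_between
    (show Q.dim p.label + Q.dim p'.label < (s + 1) / 2 by linarith)
  have h1 := tendsto_rpow_smul_iff.2
    ((locallyBdd_unit_merged hQ hκ hy p p' hr).tendsto_average hF hFc (t := 2 * r - s)
      (by linarith))
  refine h1.congr' ?_
  filter_upwards [eventually_mem_nhdsWithin] with ε hε
  rw [← rpow_smul_sq hε (r := r) (s := s) (t := -(2 * r - s)) (by ring)]
  congr 1
  rw [pairAverage, mul_sub, ← integral_const_mul, κ.left_inv hy]
  congr 1
  · congr 1
    funext w
    ring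
  · ring

theorem tendsto_pairAverage (hQ : Q.Axioms) (hκ : (Q.st b).IsChart κ) (hy : y ∈ κ.source)
    (p p' : ProductProfile (Q.V b)) {F : Vec D → ℂ} (hF : ContDiff ℝ ∞ F)
    (hFc : HasCompactSupport F) {s : ℝ} (hs : 2 * (Q.dim p.label + Q.dim p'.label) < s) :
    Tendsto (fun ε : ℝ ↦ ε ^ s • Q.pairAverage b κ p p' y F ε) (𝓝[>] 0) (𝓝 0) := by
  have h1 := (tendsto_pairAverage_sub hQ hκ hy p p' hF hFc (s := s) (by linarith)).add
    ((tendsto_pairValue hQ hκ hy p p' hs).const_mul (∫ w, F w))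
  rw [mul_zero, add_zero] at h1
  refine h1.congr fun ε ↦ ?_
  rw [mul_smul_comm, ← smul_add, sub_add_cancel]

theorem tendsto_pairAverage_mul_sub (hQ : Q.Axioms) (hκ : (Q.st b).IsChart κ) (hy : y ∈ κ.source)
    (p p' : ProductProfile (Q.V b)) {F F' : Vec D → ℂ} (hF : ContDiff ℝ ∞ F)
    (hFc : HasCompactSupport F) (hF' : ContDiff ℝ ∞ F') (hFc' : HasCompactSupport F') {s : ℝ}
    (hs : 4 * (Q.dim p.label + Q.dim p'.label) - 1 < s) :
    Tendsto (fun ε : ℝ ↦ ε ^ s • (Q.pairAverage b κ p p' y F ε * Q.pairAverage b κ p p' y F' ε -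
      (∫ w, F w) * (∫ w, F' w) * Q.unit b y (Q.merged b κ p p' (ε ^ 2) Q.one y) ^ 2))
      (𝓝[>] 0) (𝓝 0) := by
  set d := Q.dim p.label + Q.dim p'.label with hd
  have h1 : 2 * d - 1 < s / 2 - 1 / 2 := by linarith
  have h2 : 2 * d < s / 2 + 1 / 2 := by linarith
  have e1 := tendsto_rpow_smul_mul (s := s) (by ring)
    (tendsto_pairAverage_sub hQ hκ hy p p' hF hFc h1) (tendsto_pairAverage hQ hκ hy p p' hF' hFc' h2)
  have e2 := (tendsto_rpow_smul_mul (s := s) (by ring)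
    (tendsto_pairAverage_sub hQ hκ hy p p' hF' hFc' h1) (tendsto_pairValue hQ hκ hy p p' h2)
    ).const_mul (∫ w, F w)
  have e3 := e1.add e2
  rw [mul_zero, add_zero] at e3
  refine e3.congr fun ε ↦ ?_
  rw [mul_smul_comm, ← smul_add]
  congr 1
  ring

theorem eventually_isTest_merged (hQ : Q.Axioms) (hκ : (Q.st b).IsChart κ) (hy : y ∈ κ.source)
    (p p' : ProductProfile (Q.V b)) (i : Q.Label) {F : Vec D → ℂ} (hF : ContDiff ℝ ∞ F)
    (hFc : HasCompactSupport F) {U : Set (Q.Pt b)} (hU : U ∈ 𝓝 y) : ∀ᶠ ε : ℝ in 𝓝[>] 0,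
      (Q.V b i).IsTest ((Q.V b i).scaledMul κ ε (κ y) F (Q.merged b κ p p' (ε ^ 2) i)) ∧
        tsupport ((Q.V b i).scaledMul κ ε (κ y) F (Q.merged b κ p p' (ε ^ 2) i)) ⊆ U := by
  obtain ⟨r, hr⟩ := exists_gt (Q.dim p.label + Q.dim p'.label - Q.dim i)
  have ha := (Q.V b i).core.mem_baseSet_at y
  filter_upwards [eventually_isTest_scaledMul hκ hy ha
    (fun m ↦ locallyBdd_merged hQ hκ hy p p' i hr ha m) hF hFc hU,
    eventually_mem_nhdsWithin] with ε h hpos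
  have hpos : 0 < ε := hpos
  have h1 := isTest_add_smul ((((ε ^ 2 : ℝ) ^ r : ℝ) : ℂ))⁻¹ (W := Q.V b)
    (⟨isTest_zero i, by simp [tsupport]⟩ : (Q.V b i).IsTest 0 ∧ tsupport (0 : Q.Pt b → (Q.V b i).Fib) ⊆ U) h
  rwa [zero_add, CBundle.scaledMul_smul, inv_smul_smul₀] at h1
  exact_mod_cast (Real.rpow_pos_of_pos (pow_pos hpos 2) r).ne'

/-- When both pairs are merged into the identity, the coefficients factorize. -/
theorem eventually_coef_merged_one (hQ : Q.Axioms) (hκ : (Q.st b).IsChart κ) (hy : y ∈ κ.source)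
    (p p' : ProductProfile (Q.V b)) {F F' : Vec D → ℂ} (hF : ContDiff ℝ ∞ F)
    (hFc : HasCompactSupport F) (hF' : ContDiff ℝ ∞ F') (hFc' : HasCompactSupport F')
    (k : Q.Label) : ∀ᶠ ε : ℝ in 𝓝[>] 0,
      Q.coef b [⟨Q.one, (Q.V b Q.one).scaledMul κ ε (κ y) F (Q.merged b κ p p' (ε ^ 2) Q.one)⟩,
        ⟨Q.one, (Q.V b Q.one).scaledMul κ ε (κ y) F' (Q.merged b κ p p' (ε ^ 2) Q.one)⟩] k y =
      (Q.pairAverage b κ p p' y F ε * Q.pairAverage b κ p p' y F' ε) • Q.coef b [] k y := by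
  obtain ⟨U, hU, h⟩ := exists_coef_one_one hQ hκ hy k
  have ht := κ.open_target.mem_nhds (κ.map_source hy)
  filter_upwards [eventually_isTest_merged hQ hκ hy p p' Q.one hF hFc hU,
    eventually_isTest_merged hQ hκ hy p p' Q.one hF' hFc' hU,
    eventually_zoom_mem ht hFc.isCompact, eventually_zoom_mem ht hFc'.isCompact,
    eventually_mem_nhdsWithin] with ε h1 h1' hz hz' hpos
  rw [h _ _ h1 h1', chartIntegral_unit_scaledMul hκ hpos fun w hw ↦ hz w (subset_tsupport _ hw),
    chartIntegral_unit_scaledMul hκ hpos fun w hw ↦ hz' w (subset_tsupport _ hw)]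
  rfl

/-! ### The four-point function of two pairs -/

/-- The merger tree in which four fields are merged in two pairs, whose positions are averaged with
`F` and `F'`. -/
def pairTree (p p' : ProductProfile (Q.V b)) (F F' : Vec D → ℂ) : List (TestTree (Q.V b)) :=
  [.node F [.leaf p.toProfile, .leaf p'.toProfile], .node F' [.leaf p.toProfile, .leaf p'.toProfile]]

theorem validBranches_pairTree (p p' : ProductProfile (Q.V b)) {F F' : Vec D → ℂ}
    (hF : ContDiff ℝ ∞ F) (hFc : HasCompactSupport F) (hF' : ContDiff ℝ ∞ F')
    (hFc' : HasCompactSupport F') : ValidBranches (pairTree p p' F F') := by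
  have hl : ∀ t ∈ [.leaf p.toProfile, .leaf p'.toProfile],
      MergerTree.Valid (fun p : Profile (Q.V b) ↦ ((Q.V b) p.1).IsProfile p.2)
        (fun F : Vec D → ℂ ↦ ContDiff ℝ ∞ F ∧ HasCompactSupport F) t := by
    intro t ht
    simp only [List.mem_cons, List.not_mem_nil, or_false] at ht
    rcases ht with rfl | rfl
    exacts [.leaf p.isProfile, .leaf p'.isProfile]
  refine ⟨le_rfl, fun t ht ↦ ?_⟩
  simp only [pairTree, List.mem_cons, List.not_mem_nil, or_false] at ht
  rcases ht with rfl | rfl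
  exacts [.node ⟨hF, hFc⟩ le_rfl hl, .node ⟨hF', hFc'⟩ le_rfl hl]

theorem mergeLeavesList_pairTree {E : Type*} [NormedAddCommGroup E] [NormedSpace ℂ E]
    (p p' : ProductProfile (Q.V b)) (F F' : Vec D → ℂ) (ε : ℝ) (z : Vec D)
    (k : List (Factor (Q.V b)) → E) :
    mergeLeavesList κ ε 1 z (pairTree p p' F F') k = ∫ v, F v • ∫ v', F' v' •
      k [p.conc κ (ε ^ 2) (z + ε • v), p'.conc κ (ε ^ 2) (z + ε • v),
        p.conc κ (ε ^ 2) (z + ε • v'), p'.conc κ (ε ^ 2) (z + ε • v')] := by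
  simp only [pairTree, mergeLeavesList, mergeLeaves, ProductProfile.scaled_toProfile,
    List.append_nil, List.cons_append, List.nil_append, pow_one, one_add_one_eq_two]

theorem mergeNodesList_pairTree (p p' : ProductProfile (Q.V b)) (F F' : Vec D → ℂ) (ε : ℝ)
    (z : Vec D) (J : Finset Q.Label) (k : Q.Label) (y : Q.Pt b) :
    mergeNodesList (Q.coef b) J κ ε 1 z (pairTree p p' F F') (fun l ↦ Q.coef b l k y) =
      ∑ i ∈ J, ∑ j ∈ J,
        Q.coef b [⟨i, (Q.V b i).scaledMul κ ε z F (Q.merged b κ p p' (ε ^ 2) i)⟩,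
          ⟨j, (Q.V b j).scaledMul κ ε z F' (Q.merged b κ p p' (ε ^ 2) j)⟩] k y := by
  simp only [pairTree, mergeNodesList, mergeNodes, ProductProfile.scaled_toProfile, pow_one,
    one_add_one_eq_two]
  rfl

/-- The coefficients for two pairs, to leading order. The bound `-γ` on the exponent comes from the terms
of the associativity axiom in which at least one pair is not merged into the identity. -/
theorem tendsto_coef_pairTree (hQ : Q.Axioms) (hκ : (Q.st b).IsChart κ) (hy : y ∈ κ.source)
    (p p' : ProductProfile (Q.V b)) {F F' : Vec D → ℂ} (hF : ContDiff ℝ ∞ F)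
    (hFc : HasCompactSupport F) (hF' : ContDiff ℝ ∞ F') (hFc' : HasCompactSupport F') {γ ρ : ℝ}
    (hγ : ∀ j, j ≠ Q.one → γ ≤ Q.dim j)
    (hρ : 4 * (Q.dim p.label + Q.dim p'.label) - γ < ρ) (hρ0 : 0 ≤ ρ) (k : Q.Label) :
    Tendsto (fun ε : ℝ ↦ ε ^ ρ •
      (mergeLeavesList κ ε 1 (κ y) (pairTree p p' F F') (fun l ↦ Q.coef b l k y) -
        (Q.pairAverage b κ p p' y F ε * Q.pairAverage b κ p p' y F' ε) • Q.coef b [] k y))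
      (𝓝[>] 0) (𝓝 0) := by
  classical
  -- Since `ρ ≥ 0`, every positive order of accuracy suffices.
  obtain ⟨Δ, hΔ, J, hJ, hass⟩ := hQ.associativity b y κ hκ hy
    (MergerTree.shapes Sigma.fst (pairTree p p' F F')) k 1 one_pos
  have h1 := tendsto_rpow_smul_mono (show -1 < ρ by linarith)
    (hass _ (validBranches_pairTree p p' hF hFc hF' hFc') rfl)
  simp only [mergeNodesList_pairTree] at h1
  have h1J : Q.one ∈ J := (hJ _).2 (by rw [dim_one hQ]; exact hΔ)
  have h2 : ∀ i j : Q.Label, Tendsto (fun ε : ℝ ↦ ε ^ ρ •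
      (Q.coef b [⟨i, (Q.V b i).scaledMul κ ε (κ y) F (Q.merged b κ p p' (ε ^ 2) i)⟩,
          ⟨j, (Q.V b j).scaledMul κ ε (κ y) F' (Q.merged b κ p p' (ε ^ 2) j)⟩] k y -
        if i = Q.one ∧ j = Q.one then
          (Q.pairAverage b κ p p' y F ε * Q.pairAverage b κ p p' y F' ε) • Q.coef b [] k y
        else 0)) (𝓝[>] 0) (𝓝 0) := by
    intro i j
    by_cases hij : i = Q.one ∧ j = Q.one
    · obtain ⟨rfl, rfl⟩ := hij
      refine tendsto_const_nhds.congr' ?_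
      filter_upwards [eventually_coef_merged_one hQ hκ hy p p' hF hFc hF' hFc' k] with ε hε
      rw [hε, if_pos ⟨rfl, rfl⟩, sub_self, smul_zero]
    · simp only [if_neg hij, sub_zero]
      refine tendsto_rpow_smul_iff.2 (tendsto_coef_merged hQ hκ hy p p' p p' i j k hF hFc hF' hFc' ?_)
      have := hQ.dim_nonneg i
      have := hQ.dim_nonneg j
      have := hQ.dim_nonneg k
      have h3 : γ ≤ Q.dim i + Q.dim j := by
        by_cases hi : i = Q.one
        · linarith [hγ j fun hj ↦ hij ⟨hi, hj⟩]
        · linarith [hγ i hi]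
      linarith
  have h3 := tendsto_finsetSum J fun i _ ↦ tendsto_finsetSum J fun j _ ↦ h2 i j
  have h4 := h1.add h3
  simp only [Finset.sum_const_zero, add_zero] at h4
  refine h4.congr fun ε ↦ ?_
  simp only [← Finset.smul_sum, Finset.sum_sub_distrib]
  rw [← smul_add, sub_add_sub_cancel]
  congr 2
  rw [Finset.sum_eq_single_of_mem Q.one h1J fun i _ hi ↦ by simp [hi],
    Finset.sum_eq_single_of_mem Q.one h1J fun j _ hj ↦ by simp [hj], if_pos ⟨rfl, rfl⟩]

/-- To leading order, the four-point function of two pairs is the product of the contributions of the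
pairs: all other terms are suppressed, by the gap `γ` in the spectrum of the dimensions. -/
theorem tendsto_state_pairTree (hQ : Q.Axioms) (hκ : (Q.st b).IsChart κ) (hy : y ∈ κ.source)
    (ψ : Q.State b) (p p' : ProductProfile (Q.V b)) {F F' : Vec D → ℂ} (hF : ContDiff ℝ ∞ F)
    (hFc : HasCompactSupport F) (hF' : ContDiff ℝ ∞ F') (hFc' : HasCompactSupport F') {γ ρ : ℝ}
    (hγ : ∀ j, j ≠ Q.one → γ ≤ Q.dim j)
    (hρ : 4 * (Q.dim p.label + Q.dim p'.label) - γ < ρ) (hρ0 : 0 ≤ ρ) :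
    Tendsto (fun ε : ℝ ↦ ε ^ ρ •
      (mergeLeavesList κ ε 1 (κ y) (pairTree p p' F F') (fun l ↦ ψ.toFun (l.map (Q.field b)).prod) -
        Q.pairAverage b κ p p' y F ε * Q.pairAverage b κ p p' y F' ε)) (𝓝[>] 0) (𝓝 0) := by
  -- Since `ρ ≥ 0`, every positive order of accuracy suffices.
  obtain ⟨Δ, hΔ, J, hJ, hope⟩ := ψ.ope y κ hκ hy
    (MergerTree.shapes Sigma.fst (pairTree p p' F F')) 1 one_pos
  have h1 := tendsto_rpow_smul_mono (show -1 < ρ by linarith)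
    (hope _ (validBranches_pairTree p p' hF hFc hF' hFc') rfl)
  have h1J : Q.one ∈ J := (hJ _).2 (by rw [dim_one hQ]; exact hΔ)
  have h2 := tendsto_finsetSum J fun k _ ↦
    ((ψ.onePoint k y).continuous_of_finiteDimensional.tendsto 0).comp
      (tendsto_coef_pairTree hQ hκ hy p p' hF hFc hF' hFc' hγ hρ hρ0 k)
  have h3 := h1.add h2
  simp only [map_zero, Finset.sum_const_zero, add_zero] at h3
  refine h3.congr fun ε ↦ ?_
  have h4 : ∑ k ∈ J, ψ.onePoint k y
      ((Q.pairAverage b κ p p' y F ε * Q.pairAverage b κ p p' y F' ε) • Q.coef b [] k y) =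
      Q.pairAverage b κ p p' y F ε * Q.pairAverage b κ p p' y F' ε := by
    rw [Finset.sum_eq_single_of_mem Q.one h1J fun k _ hk ↦ by
      rw [coef_nil_eq_zero hQ b y hk, smul_zero, map_zero], map_smul, onePoint_coef_nil hQ ψ y,
      smul_eq_mul, mul_one]
  have h5 : ∀ (k : Q.Label) (v : (Q.V b k).Fib), ψ.onePoint k y (ε ^ ρ • v) =
      ε ^ ρ • ψ.onePoint k y v := fun k v ↦ by
    rw [← Complex.coe_smul, map_smul, Complex.coe_smul]
  simp only [Function.comp, h5, map_sub, ← Finset.smul_sum, Finset.sum_sub_distrib, h4]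
  rw [← smul_add, sub_add_sub_cancel]

end OPESystem

/-! ### Exchange of the two pairs -/

section Fubini

open scoped Distributions
open TopologicalSpace (Compacts)

variable {D : ℕ} {S : Spacetime.{u} D} {Label : Type w} {W : Label → CBundle S}
  {κ : OpenPartialHomeomorph S.M (Vec D)}

/-- A distribution, smeared with concentrated test functions, depends continuously on the points of
concentration. -/
theorem IsDistributionOn.continuous_conc {E : Type*} [NormedAddCommGroup E] [NormedSpace ℂ E]
    {U : Set S.M} {is : List Label} {u : List (Factor W) → E} (hu : IsDistributionOn U is u)
    {n : ℕ} (p : Fin n → ProductProfile W) (hp : (List.ofFn fun k ↦ (p k).label) = is)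
    (hκ : S.IsChart κ) {K : Set (Vec D)} (hK : IsCompact K) (hKt : K ⊆ κ.target)
    (hKU : κ.symm '' K ⊆ U) {Y : Type*} [TopologicalSpace Y] (c : Fin n → Y → Vec D)
    (hc : ∀ k, Continuous (c k)) {lam : ℝ} (hl : lam ≠ 0)
    (hcK : ∀ k t, ∀ w ∈ Function.support (p k).fn, c k t + lam • w ∈ K) :
    Continuous fun t ↦ u (List.ofFn fun k ↦ (p k).conc κ lam (c k t)) := by
  let K' : Compacts (Vec D) := ⟨K, hK⟩
  obtain ⟨μ, hμ, N, A, hA⟩ := hu.exists_multilinear (fun k ↦ ⟨(p k).label, (p k).sec⟩)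
    (by rw [← hp, List.map_ofFn]; rfl) (fun k ↦ (p k).smooth) hκ K' hKt hKU
  let φ : Y → Fin n → 𝓓_{K'}(Vec D, ℂ) := fun t k ↦ ContDiffMapSupportedIn.of_support_subset
    (contDiff_rescale (p k).contDiff ((lam ^ D)⁻¹ : ℝ) lam (c k t))
    (support_rescale_subset subset_rfl hl (hcK k t))
  have h1 : Continuous fun t ↦ μ (φ t) := multilinear_continuous_of_bound _ μ hA φ fun t₀ k ↦
    tendsto_testNorm_rescale _ lam (hc k) (p k).contDiff (p k).compact hl (fun t ↦ φ t k)
      (fun t ↦ rfl) N t₀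
  refine h1.congr fun t ↦ ?_
  rw [hμ]
  rfl

/-- Fubini's theorem for an antisymmetric integrand. -/
theorem integral_antisymm {X : Type*} [NormedAddCommGroup X] [MeasurableSpace X] [BorelSpace X]
    [SecondCountableTopology X] {μ : Measure X} [SFinite μ] [IsFiniteMeasureOnCompacts μ]
    {F F' : X → ℂ} (hF : Continuous F) (hFc : HasCompactSupport F) (hF' : Continuous F')
    (hFc' : HasCompactSupport F') {g : X → X → ℂ}
    (hg : ContinuousOn (Function.uncurry g) (tsupport F ×ˢ tsupport F'))
    (hanti : ∀ x ∈ tsupport F, ∀ x' ∈ tsupport F', g x x' = -g x' x) :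
    ∫ x, F x • ∫ x', F' x' • g x x' ∂μ ∂μ = -∫ x, F' x • ∫ x', F x' • g x x' ∂μ ∂μ := by
  have hint : Integrable (Function.uncurry fun x x' ↦ F x * (F' x' * g x x')) (μ.prod μ) := by
    rw [← integrableOn_iff_integrable_of_support_subset (s := tsupport F ×ˢ tsupport F')]
    · refine ContinuousOn.integrableOn_compact (hFc.isCompact.prod hFc'.isCompact) ?_
      exact (hF.comp continuous_fst).continuousOn.mul
        ((hF'.comp continuous_snd).continuousOn.mul hg)
    · rintro ⟨x, x'⟩ h
      exact ⟨subset_tsupport _ (left_ne_zero_of_mul h),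
        subset_tsupport _ (left_ne_zero_of_mul (right_ne_zero_of_mul h))⟩
  simp only [smul_eq_mul, ← integral_const_mul]
  rw [integral_integral_swap hint, ← integral_neg]
  congr 1
  funext x'
  rw [← integral_neg]
  congr 1
  funext x
  by_cases hx : x ∈ tsupport F
  · by_cases hx' : x' ∈ tsupport F'
    · rw [hanti x hx x' hx']
      ring
    · simp [image_eq_zero_of_notMem_tsupport hx']
  · simp [image_eq_zero_of_notMem_tsupport hx]

end Fubini

/-- In each chart there are two test functions whose supports, contracted towards a point, are
spacelike separated, even after an enlargement that is small compared with the contraction. -/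
theorem Spacetime.exists_spacelike_testFunctions {D : ℕ} (hD : 2 ≤ D) (S : Spacetime.{u} D)
    {κ : OpenPartialHomeomorph S.M (Vec D)} (hκ : S.IsChart κ) {y : S.M} (hy : y ∈ κ.source) :
    ∃ F F' : Vec D → ℂ, (ContDiff ℝ ∞ F ∧ HasCompactSupport F ∧ ∫ w, F w = 1) ∧
      (ContDiff ℝ ∞ F' ∧ HasCompactSupport F' ∧ ∫ w, F' w = 1) ∧
      ∀ R : ℝ, ∀ᶠ ε : ℝ in 𝓝[>] 0, ∀ v ∈ tsupport F, ∀ v' ∈ tsupport F',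
        S.SpacelikeSeparated (κ.symm '' Metric.closedBall (κ y + ε • v) (ε ^ 2 * R))
          (κ.symm '' Metric.closedBall (κ y + ε • v') (ε ^ 2 * R)) := by
  obtain ⟨L, c, hc, V, hV, hcone⟩ := S.exists_causal_cone hκ hy
  -- A unit vector in the kernel of `L`, which is not trivial as `D ≥ 2`, is a spacelike direction.
  obtain ⟨n, hn0, hn1⟩ : ∃ n : Vec D, L n = 0 ∧ ‖n‖ = 1 := by
    have h1 : (LinearMap.ker (L : Vec D →ₗ[ℝ] ℝ)) ≠ ⊥ := by
      intro h
      have h2 := (L : Vec D →ₗ[ℝ] ℝ).finrank_range_add_finrank_ker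
      rw [h, finrank_bot, finrank_euclideanSpace_fin] at h2
      have h3 := (LinearMap.range (L : Vec D →ₗ[ℝ] ℝ)).finrank_le
      rw [Module.finrank_self] at h3
      omega
    obtain ⟨x, hx, hx0⟩ := Submodule.exists_mem_ne_zero_of_ne_bot h1
    refine ⟨‖x‖⁻¹ • x, ?_, ?_⟩
    · rw [map_smul, show L x = 0 from hx, smul_zero]
    · rw [norm_smul, norm_inv, norm_norm, inv_mul_cancel₀ (norm_ne_zero_iff.2 hx0)]
  obtain ⟨ρ, hρ, ht, hρV⟩ := exists_closedBall_subset hy hV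
  set θ : ℝ := c / (‖L‖ + c) / 4 with hθ
  have hLc : 0 < ‖L‖ + c := by positivity
  have hθ0 : 0 < θ := by positivity
  have hθ1 : 4 * θ * (‖L‖ + c) = c := by
    rw [hθ]
    field_simp
  obtain ⟨F, hF, hFs⟩ := exists_testFunction_integral_one (0 : Vec D) hθ0
  obtain ⟨F', hF', hFs'⟩ := exists_testFunction_integral_one n hθ0
  refine ⟨F, F', hF, hF', fun R ↦ ?_⟩
  have hsmall : ∀ T τ : ℝ, 0 < τ → ∀ᶠ ε : ℝ in 𝓝[>] 0, ε * T < τ := by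
    intro T τ hτ
    have hcont : Continuous fun ε : ℝ ↦ ε * T := by fun_prop
    have := (hcont.tendsto 0).mono_left (nhdsWithin_le_nhds (s := Ioi 0))
    rw [zero_mul] at this
    exact this.eventually (gt_mem_nhds hτ)
  filter_upwards [hsmall R θ hθ0, hsmall (1 + 2 * θ) ρ hρ, eventually_mem_nhdsWithin]
    with ε hεR hερ hpos v hv v' hv'
  have hpos : 0 < ε := hpos
  -- The coordinates of a point of one of the two sets, in units of `ε`.
  have key : ∀ a v : Vec D, ‖a‖ ≤ 1 → v ∈ Metric.closedBall a θ →
      ∀ x ∈ Metric.closedBall (κ y + ε • v) (ε ^ 2 * R),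
        ∃ e : Vec D, ‖e‖ < 2 * θ ∧ x = κ y + ε • (a + e) ∧ x ∈ κ.target ∧ κ.symm x ∈ V := by
    intro a v ha hv x hx
    rw [mem_closedBall_iff_norm] at hv hx
    have h1 : ‖ε⁻¹ • (x - (κ y + ε • v))‖ < θ := by
      rw [norm_smul, norm_inv, Real.norm_of_nonneg hpos.le, inv_mul_lt_iff₀ hpos]
      refine hx.trans_lt ?_
      rw [pow_two, mul_assoc]
      exact mul_lt_mul_of_pos_left hεR hpos
    have h2 : ‖v - a + ε⁻¹ • (x - (κ y + ε • v))‖ < 2 * θ :=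
      (norm_add_le _ _).trans_lt (by linarith)
    have h3 : x = κ y + ε • (a + (v - a + ε⁻¹ • (x - (κ y + ε • v)))) := by
      rw [smul_add, smul_add, smul_inv_smul₀ hpos.ne', smul_sub]
      abel
    have h4 : x ∈ Metric.closedBall (κ y) ρ := by
      rw [mem_closedBall_iff_norm, h3, add_sub_cancel_left, norm_smul,
        Real.norm_of_nonneg hpos.le]
      refine (mul_le_mul_of_nonneg_left ((norm_add_le _ _).trans ?_) hpos.le).trans hερ.le
      linarith
    exact ⟨_, h2, h3, ht h4, hρV ⟨x, h4, rfl⟩⟩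
  have estimate : ∀ e e' : Vec D, ‖e‖ < 2 * θ → ‖e'‖ < 2 * θ → ∀ s : ℝ, |s| = 1 →
      ¬ c * ‖ε • s • (n + e' - (0 + e))‖ ≤ L (ε • s • (n + e' - (0 + e))) := by
    intro e e' he he' s hs h
    have hee : ‖e' - e‖ < 4 * θ := (norm_sub_le _ _).trans_lt (by linarith)
    have h1 : n + e' - (0 + e) = n + (e' - e) := by abel
    rw [h1, map_smul, map_smul, map_add, hn0, zero_add, norm_smul, norm_smul, Real.norm_eq_abs s, hs,
      one_mul, Real.norm_of_nonneg hpos.le, smul_eq_mul, smul_eq_mul, mul_left_comm] at h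
    have h2 := le_of_mul_le_mul_left h hpos
    have h3 : s * L (e' - e) ≤ ‖L‖ * ‖e' - e‖ := by
      refine (le_abs_self _).trans ?_
      rw [abs_mul, hs, one_mul]
      exact L.le_opNorm _
    have h4 : 1 - ‖e' - e‖ ≤ ‖n + (e' - e)‖ := by
      have := norm_sub_norm_le n (-(e' - e))
      rwa [norm_neg, sub_neg_eq_add, hn1] at this
    have h5 : c * (1 - ‖e' - e‖) ≤ c * ‖n + (e' - e)‖ := mul_le_mul_of_nonneg_left h4 hc.le
    have h6 : ‖e' - e‖ * (‖L‖ + c) < c :=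
      (mul_lt_mul_of_pos_right hee hLc).trans_eq hθ1
    linarith
  rintro _ ⟨x, hx, rfl⟩ _ ⟨x', hx', rfl⟩
  obtain ⟨e, he, hxe, hxt, hxV⟩ := key 0 v (by simp) (hFs hv) x hx
  obtain ⟨e', he', hxe', hxt', hxV'⟩ := key n v' hn1.le (hFs' hv') x' hx'
  constructor
  · intro h
    have h1 := hcone _ hxV _ hxV' h
    rw [κ.right_inv hxt, κ.right_inv hxt'] at h1
    refine estimate e e' he he' 1 (by simp) ?_
    have h2 : x' - x = ε • (1 : ℝ) • (n + e' - (0 + e)) := by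
      rw [hxe, hxe', one_smul, smul_sub]
      abel
    rwa [← h2]
  · intro h
    have h1 := hcone _ hxV' _ hxV h
    rw [κ.right_inv hxt, κ.right_inv hxt'] at h1
    refine estimate e e' he he' (-1) (by simp) ?_
    have h2 : x - x' = ε • (-1 : ℝ) • (n + e' - (0 + e)) := by
      rw [hxe, hxe', neg_one_smul, smul_neg, smul_sub]
      abel
    rwa [← h2]

namespace OPESystem

variable {D : ℕ} {Q : OPESystem.{u, v, w} D} {b : Q.Bg} {y : Q.Pt b}
  {κ : OpenPartialHomeomorph (Q.Pt b) (Vec D)}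

theorem field_comm {p q : Factor (Q.V b)} (hp : (Q.V b p.1).IsTest p.2)
    (hq : (Q.V b q.1).IsTest q.2)
    (h : (Q.st b).SpacelikeSeparated (tsupport p.2) (tsupport q.2)) :
    Q.field b p * Q.field b q =
      (-1 : ℂ) ^ (Q.parity p.1 * Q.parity q.1).val • (Q.field b q * Q.field b p) := by
  have key : ∀ (c : ℂ) (g g' : Q.Gen b),
      RingQuot.mkRingHom (StarRel (Q.Rel b)) (c • (FreeStar.gen g * FreeStar.gen g')) =
        c • (RingQuot.mkRingHom (StarRel (Q.Rel b)) (FreeStar.gen g) *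
          RingQuot.mkRingHom (StarRel (Q.Rel b)) (FreeStar.gen g')) := by
    intro c g g'
    rw [← RingQuot.mkAlgHom_coe ℂ]
    simp only [AlgHom.coe_toRingHom, map_smul, map_mul]
  rw [field_of_isTest hp, field_of_isTest hq]
  refine (map_mul (RingQuot.mkRingHom (StarRel (Q.Rel b))) _ _).symm.trans ?_
  exact (RingQuot.mkRingHom_rel (StarRel.of
    (Rel.comm p.1 q.1 ⟨p.2, hp⟩ ⟨q.2, hq⟩ h))).trans (key _ ⟨q.1, q.2, hq⟩ ⟨p.1, p.2, hp⟩)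

theorem mul_exchange {A : Type*} [Ring A] [Algebra ℂ A] {x x' z z' : A} {s₁ s₂ s₃ s₄ : ℂ}
    (hs : s₁ * s₂ * s₃ * s₄ = -1)
    (h₁ : x * z = s₁ • (z * x)) (h₂ : x * z' = s₂ • (z' * x)) (h₃ : x' * z = s₃ • (z * x'))
    (h₄ : x' * z' = s₄ • (z' * x')) :
    x * (x' * (z * z')) = -(z * (z' * (x * x'))) := by
  have e1 : x' * (z * z') = (s₃ * s₄) • (z * (z' * x')) := by
    rw [← mul_assoc, h₃, smul_mul_assoc, mul_assoc, h₄, mul_smul_comm, smul_smul]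
  have e2 : x * (z * (z' * x')) = (s₁ * s₂) • (z * (z' * (x * x'))) := by
    rw [← mul_assoc, h₁, smul_mul_assoc, mul_assoc, ← mul_assoc x z', h₂, smul_mul_assoc,
      mul_smul_comm, smul_smul, mul_assoc]
  rw [e1, mul_smul_comm, e2, smul_smul, show s₃ * s₄ * (s₁ * s₂) = s₁ * s₂ * s₃ * s₄ by ring, hs,
    neg_one_smul]

/-- The sign that results when the product of a bosonic and a fermionic field is moved past a copy of
itself: only the two fermionic fields contribute. -/
theorem sign_of_parity_ne {a a' : ZMod 2} (h : a ≠ a') :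
    (-1 : ℂ) ^ (a * a).val * (-1) ^ (a * a').val * (-1) ^ (a' * a).val * (-1) ^ (a' * a').val =
      -1 := by
  have h1 : ∀ a a' : ZMod 2, a ≠ a' →
      (a * a).val + (a * a').val + (a' * a).val + (a' * a').val = 1 := by decide
  rw [← pow_add, ← pow_add, ← pow_add, h1 a a' h, pow_one]

/-- If the parities of two fields differ, their product anticommutes with itself at spacelike
separation. -/
theorem prod_field_exchange {p₁ p₁' p₂ p₂' : Factor (Q.V b)} (hp : p₁.1 = p₂.1)
    (hp' : p₁'.1 = p₂'.1) (hne : Q.parity p₁.1 ≠ Q.parity p₁'.1) {A B : Set (Q.Pt b)}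
    (hAB : (Q.st b).SpacelikeSeparated A B) (h₁ : (Q.V b p₁.1).IsTest p₁.2 ∧ tsupport p₁.2 ⊆ A)
    (h₁' : (Q.V b p₁'.1).IsTest p₁'.2 ∧ tsupport p₁'.2 ⊆ A)
    (h₂ : (Q.V b p₂.1).IsTest p₂.2 ∧ tsupport p₂.2 ⊆ B)
    (h₂' : (Q.V b p₂'.1).IsTest p₂'.2 ∧ tsupport p₂'.2 ⊆ B) :
    ([p₁, p₁', p₂, p₂'].map (Q.field b)).prod = -([p₂, p₂', p₁, p₁'].map (Q.field b)).prod := by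
  have hc : ∀ {p q : Factor (Q.V b)}, ((Q.V b p.1).IsTest p.2 ∧ tsupport p.2 ⊆ A) →
      ((Q.V b q.1).IsTest q.2 ∧ tsupport q.2 ⊆ B) → _ := fun {p q} h h' ↦
    field_comm h.1 h'.1 fun x hx x' hx' ↦ hAB x (h.2 hx) x' (h'.2 hx')
  have := mul_exchange (by
    rw [← hp, ← hp']
    exact sign_of_parity_ne hne) (hc h₁ h₂) (hc h₁ h₂') (hc h₁' h₂) (hc h₁' h₂')
  simp only [List.map_cons, List.map_nil, List.prod_cons, List.prod_nil, mul_one]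
  exact this

/-- The coefficient of the identity in the product of two fields whose parities differ is less
singular than is allowed by the dimensions of the fields: the four-point function of two pairs is
antisymmetric in the pairs, and its leading term, which is symmetric, must therefore be small. -/
theorem tendsto_pairValue_sq (hD : 2 ≤ D) (hQ : Q.Axioms) (hκ : (Q.st b).IsChart κ)
    (hy : y ∈ κ.source) (ψ : Q.State b) (p p' : ProductProfile (Q.V b))
    (hne : Q.parity p.label ≠ Q.parity p'.label) {γ ρ : ℝ} (hγ : ∀ j, j ≠ Q.one → γ ≤ Q.dim j)
    (hρ : 4 * (Q.dim p.label + Q.dim p'.label) - γ < ρ)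
    (hρ1 : 4 * (Q.dim p.label + Q.dim p'.label) - 1 < ρ) (hρ0 : 0 ≤ ρ) :
    Tendsto (fun ε : ℝ ↦ ε ^ ρ • Q.unit b y (Q.merged b κ p p' (ε ^ 2) Q.one y) ^ 2)
      (𝓝[>] 0) (𝓝 0) := by
  obtain ⟨F, F', ⟨hF, hFc, hF1⟩, ⟨hF', hFc', hF1'⟩, hsep⟩ :=
    (Q.st b).exists_spacelike_testFunctions hD hκ hy
  obtain ⟨R₁, hR₁0, hR₁⟩ := p.exists_support_bound
  obtain ⟨R₂, hR₂0, hR₂⟩ := p'.exists_support_bound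
  set R := max R₁ R₂
  have hR0 : 0 < R := lt_max_of_lt_left hR₁0
  obtain ⟨ρ₀, hρ₀, ht, -⟩ := exists_closedBall_subset hy univ_mem
  set u : List (Factor (Q.V b)) → ℂ := fun l ↦ ψ.toFun (l.map (Q.field b)).prod with hu
  have hanti : ∀ᶠ ε : ℝ in 𝓝[>] 0, mergeLeavesList κ ε 1 (κ y) (pairTree p p' F F') u =
      -mergeLeavesList κ ε 1 (κ y) (pairTree p p' F' F) u := by
    obtain ⟨B, hB⟩ := (hFc.isCompact.union hFc'.isCompact).isBounded.exists_norm_le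
    have hzoom := eventually_zoom_mem (Metric.closedBall_mem_nhds (κ y) hρ₀)
      (isCompact_closedBall (0 : Vec D) (B + R))
    have hle : ∀ᶠ ε : ℝ in 𝓝[>] 0, ε ≤ 1 := nhdsWithin_le_nhds (eventually_le_nhds zero_lt_one)
    filter_upwards [hsep R, hzoom, hle, eventually_mem_nhdsWithin] with ε hs hz hε1 hpos
    have hpos : 0 < ε := hpos
    have hlne : ε ^ 2 ≠ 0 := (pow_pos hpos 2).ne'
    have hball : ∀ v ∈ tsupport F ∪ tsupport F',
        Metric.closedBall (κ y + ε • v) (ε ^ 2 * R) ⊆ Metric.closedBall (κ y) ρ₀ := by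
      intro v hv x hx
      have h1 := hz (v + ε⁻¹ • (x - (κ y + ε • v))) (by
        rw [mem_closedBall_iff_norm] at hx
        rw [mem_closedBall_zero_iff]
        refine (norm_add_le _ _).trans (add_le_add (hB v hv) ?_)
        rw [norm_smul, norm_inv, Real.norm_of_nonneg hpos.le, inv_mul_le_iff₀ hpos]
        refine hx.trans ?_
        rw [pow_two, mul_assoc]
        exact mul_le_mul_of_nonneg_left (mul_le_of_le_one_left hR0.le hε1) hpos.le)
      rwa [smul_add, smul_inv_smul₀ hpos.ne', ← add_assoc, add_sub_cancel] at h1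
    have hmem : ∀ (q : ProductProfile (Q.V b)), (∀ w ∈ Function.support q.fn, ‖w‖ ≤ R) →
        ∀ v : Vec D, ∀ w ∈ Function.support q.fn, κ y + ε • v + ε ^ 2 • w ∈
          Metric.closedBall (κ y + ε • v) (ε ^ 2 * R) := by
      intro q hq v w hw
      rw [mem_closedBall_iff_norm, add_sub_cancel_left, norm_smul,
        Real.norm_of_nonneg (pow_pos hpos 2).le]
      exact mul_le_mul_of_nonneg_left (hq w hw) (pow_pos hpos 2).le
    have hp : ∀ w ∈ Function.support p.fn, ‖w‖ ≤ R := fun w hw ↦ (hR₁ w hw).trans (le_max_left _ _)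
    have hp' : ∀ w ∈ Function.support p'.fn, ‖w‖ ≤ R :=
      fun w hw ↦ (hR₂ w hw).trans (le_max_right _ _)
    have htest : ∀ (q : ProductProfile (Q.V b)), (∀ w ∈ Function.support q.fn, ‖w‖ ≤ R) →
        ∀ v ∈ tsupport F ∪ tsupport F',
          (Q.V b (q.conc κ (ε ^ 2) (κ y + ε • v)).1).IsTest (q.conc κ (ε ^ 2) (κ y + ε • v)).2 ∧
          tsupport (q.conc κ (ε ^ 2) (κ y + ε • v)).2 ⊆
            κ.symm '' Metric.closedBall (κ y + ε • v) (ε ^ 2 * R) := fun q hq v hv ↦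
      isTest_concFactor hκ hlne q.contDiff q.smooth (isCompact_closedBall _ _)
        ((hball v hv).trans ht) (hmem q hq v)
    have hlab : ∀ (q : ProductProfile (Q.V b)) (z : Vec D), (q.conc κ (ε ^ 2) z).1 = q.label :=
      fun _ _ ↦ rfl
    rw [mergeLeavesList_pairTree, mergeLeavesList_pairTree]
    refine integral_antisymm hF.continuous hFc hF'.continuous hFc' ?_ fun v hv v' hv' ↦ ?_
    · rw [continuousOn_iff_continuous_domRestrict]
      have hc := (ψ.distribution [p.label, p'.label, p.label, p'.label]).continuous_conc
        (n := 4) ![p, p', p, p'] rfl hκ (isCompact_closedBall (κ y) ρ₀) ht (subset_univ _)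
        (Y := ↥(tsupport F ×ˢ tsupport F'))
        ![fun t ↦ κ y + ε • t.1.1, fun t ↦ κ y + ε • t.1.1, fun t ↦ κ y + ε • t.1.2,
          fun t ↦ κ y + ε • t.1.2] (by
          intro k
          fin_cases k
          · exact continuous_const.add ((continuous_fst.comp continuous_subtype_val).const_smul ε)
          · exact continuous_const.add ((continuous_fst.comp continuous_subtype_val).const_smul ε)
          · exact continuous_const.add ((continuous_snd.comp continuous_subtype_val).const_smul ε)
          · exact continuous_const.add ((continuous_snd.comp continuous_subtype_val).const_smul ε))
        hlne (by
          intro k t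
          have h1 := hball _ (Or.inl t.2.1)
          have h2 := hball _ (Or.inr t.2.2)
          fin_cases k
          · exact fun w hw ↦ h1 (hmem p hp _ w hw)
          · exact fun w hw ↦ h1 (hmem p' hp' _ w hw)
          · exact fun w hw ↦ h2 (hmem p hp _ w hw)
          · exact fun w hw ↦ h2 (hmem p' hp' _ w hw))
      exact hc
    · have h1 := prod_field_exchange (p₁ := p.conc κ (ε ^ 2) (κ y + ε • v))
        (p₁' := p'.conc κ (ε ^ 2) (κ y + ε • v)) (p₂ := p.conc κ (ε ^ 2) (κ y + ε • v'))
        (p₂' := p'.conc κ (ε ^ 2) (κ y + ε • v')) ((hlab p _).trans (hlab p _).symm)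
        ((hlab p' _).trans (hlab p' _).symm) hne (hs v hv v' hv')
        (htest p hp v (Or.inl hv)) (htest p' hp' v (Or.inl hv)) (htest p hp v' (Or.inr hv'))
        (htest p' hp' v' (Or.inr hv'))
      simp only [hu, h1, map_neg]
  have h1 := (tendsto_state_pairTree hQ hκ hy ψ p p' hF hFc hF' hFc' hγ hρ hρ0).add
    (tendsto_state_pairTree hQ hκ hy ψ p p' hF' hFc' hF hFc hγ hρ hρ0)
  have h2 := (h1.const_mul (-1 / 2)).sub
    (tendsto_pairAverage_mul_sub hQ hκ hy p p' hF hFc hF' hFc' hρ1)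
  simp only [add_zero, mul_zero, sub_zero] at h2
  refine h2.congr' ?_
  filter_upwards [hanti] with ε hε
  rw [← smul_add, mul_smul_comm, ← smul_sub, hF1, hF1', ← hu, hε]
  congr 1
  ring

end OPESystem

namespace OPESystem

variable {D : ℕ} {Q : OPESystem.{u, v, w} D} {b : Q.Bg} {y : Q.Pt b}
  {κ : OpenPartialHomeomorph (Q.Pt b) (Vec D)}

/-! ### Contradiction with asymptotic positivity -/

/-- The scaling degree of `C^{(i)(i*)}_{(1)}` is `2 dim i` at some point, and nowhere exceeds
`dim i + dim i*`. -/
theorem dim_star (hQ : Q.Axioms) (i : Q.Label) : Q.dim (Q.star i) = Q.dim i := by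
  have h : ∀ i, Q.dim i ≤ Q.dim (Q.star i) := by
    intro i
    obtain ⟨b, y, hy⟩ := hQ.dim_attained i
    have h1 := hQ.scaling_degree b i (Q.star i) Q.one y
    rw [hy, EReal.coe_le_coe_iff, dim_one hQ] at h1
    linarith
  have h2 := h (Q.star i)
  rw [Q.star_star] at h2
  exact le_antisymm h2 (h i)

/-- As there are only finitely many fields of dimension at most `1`, and only the identity has dimension
`0`, the dimensions of the other fields are bounded away from `0`. -/
theorem exists_dim_gap (hQ : Q.Axioms) : ∃ γ > 0, γ ≤ 1 ∧ ∀ j, j ≠ Q.one → γ ≤ Q.dim j := by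
  have hfin : ({j | Q.dim j ≤ 1} \ {Q.one}).Finite := (hQ.dim_finite 1).subset sdiff_subset
  rcases ({j | Q.dim j ≤ 1} \ {Q.one}).eq_empty_or_nonempty with h | h
  · refine ⟨1, one_pos, le_rfl, fun j hj ↦ ?_⟩
    by_contra hlt
    have : j ∈ ({j | Q.dim j ≤ 1} \ {Q.one} : Set Q.Label) := ⟨(not_le.1 hlt).le, hj⟩
    rw [h] at this
    exact this
  · obtain ⟨a, ha, hmin⟩ := exists_min_image _ Q.dim hfin h
    refine ⟨Q.dim a, (hQ.dim_nonneg a).lt_of_ne fun h0 ↦ ha.2 ((hQ.dim_eq_zero a).1 h0.symm), ha.1,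
      fun j hj ↦ ?_⟩
    by_cases hj1 : Q.dim j ≤ 1
    · exact hmin j ⟨hj1, hj⟩
    · exact le_trans ha.1 (not_le.1 hj1).le

/-- `tendsto_pairValue_sq` in terms of the scale `lam = ε²` of the pairs. -/
theorem tendsto_pairValue_of_parity_ne (hD : 2 ≤ D) (hQ : Q.Axioms) (hκ : (Q.st b).IsChart κ)
    (hy : y ∈ κ.source) (ψ : Q.State b) (p p' : ProductProfile (Q.V b))
    (hne : Q.parity p.label ≠ Q.parity p'.label) {γ ρ : ℝ} (hγ : ∀ j, j ≠ Q.one → γ ≤ Q.dim j)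
    (hρ : 4 * (Q.dim p.label + Q.dim p'.label) - γ < ρ)
    (hρ1 : 4 * (Q.dim p.label + Q.dim p'.label) - 1 < ρ) (hρ0 : 0 ≤ ρ) :
    Tendsto (fun lam : ℝ ↦ lam ^ (ρ / 4) *
      ‖Q.unit b y (Q.coef b [p.conc κ lam (κ y), p'.conc κ lam (κ y)] Q.one y)‖)
      (𝓝[>] 0) (𝓝 0) := by
  have h1 := (tendsto_pairValue_sq hD hQ hκ hy ψ p p' hne hγ hρ hρ1 hρ0).norm
  have hs : Tendsto Real.sqrt (𝓝[>] 0) (𝓝[>] 0) := by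
    refine tendsto_nhdsWithin_iff.2 ⟨?_, ?_⟩
    · have := (Real.continuous_sqrt.tendsto 0).mono_left (nhdsWithin_le_nhds (s := Ioi 0))
      rwa [Real.sqrt_zero] at this
    · filter_upwards [eventually_mem_nhdsWithin] with lam hl
      exact Real.sqrt_pos.2 hl
  have h2 := (Real.continuous_sqrt.tendsto 0).comp (norm_zero (E := ℂ) ▸ h1.comp hs)
  rw [Real.sqrt_zero] at h2
  refine h2.congr' ?_
  filter_upwards [eventually_mem_nhdsWithin] with lam hl
  have hl : 0 < lam := hl
  simp only [Function.comp, Real.sq_sqrt hl.le]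
  rw [norm_smul, norm_pow, Real.norm_of_nonneg (by positivity), Real.sqrt_mul (by positivity),
    Real.sqrt_sq (norm_nonneg _), Real.sqrt_eq_rpow, Real.sqrt_eq_rpow, ← Real.rpow_mul hl.le,
    ← Real.rpow_mul hl.le]
  congr 2
  ring

/-- A rescaled profile is a sum of concentrated sections. -/
theorem scaled_eq_sum {D : ℕ} {S : Spacetime.{u} D} (V : CBundle S)
    (κ : OpenPartialHomeomorph S.M (Vec D)) (lam : ℝ) (z : Vec D) {r : ℕ} {F : Fin r → Vec D → ℂ}
    {s : Fin r → S.M → V.Fib} {P : Vec D → S.M → V.Fib} (hP : ∀ w x, P w x = ∑ k, F k w • s k x) :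
    V.scaled κ lam z P = ∑ k, V.chartMul κ (rescale ((lam ^ D)⁻¹ : ℝ) lam z (F k)) (s k) := by
  funext x
  rw [Finset.sum_apply]
  by_cases hx : x ∈ κ.source
  · simp only [CBundle.scaled, CBundle.chartMul, indicator_of_mem hx, rescale, hP,
      Finset.smul_sum, mul_smul, Complex.coe_smul]
  · simp [CBundle.scaled, CBundle.chartMul, hx]

theorem conjSec_scaled_eq_sum (Q : OPESystem.{u, v, w} D) (b : Q.Bg) (i : Q.Label)
    (κ : OpenPartialHomeomorph (Q.Pt b) (Vec D)) (lam : ℝ) (z : Vec D) {r : ℕ}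
    {F : Fin r → Vec D → ℂ} {s : Fin r → Q.Pt b → (Q.V b i).Fib}
    {P : Vec D → Q.Pt b → (Q.V b i).Fib} (hP : ∀ w x, P w x = ∑ k, F k w • s k x) :
    Q.conjSec b i ((Q.V b i).scaled κ lam z P) =
      ∑ k, (Q.V b (Q.star i)).chartMul κ
        (rescale ((lam ^ D)⁻¹ : ℝ) lam z fun w ↦ starRingEnd ℂ (F k w)) (Q.conjSec b i (s k)) := by
  rw [scaled_eq_sum _ κ lam z hP]
  funext x
  simp only [FieldContent.conjSec]
  rw [Finset.sum_apply, Finset.sum_apply, map_sum]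
  refine Finset.sum_congr rfl fun k _ ↦ ?_
  by_cases hx : x ∈ κ.source
  · simp only [CBundle.chartMul, indicator_of_mem hx, rescale]
    rw [map_smulₛₗ, map_mul, Complex.conj_ofReal]
    rfl
  · simp [CBundle.chartMul, hx]

end OPESystem

end OPEQFT

end

theorem theorem1 {D : ℕ} (hD : 2 ≤ D) (Q : OPEQFT.OPESystem.{u, v, w} D) (hQ : Q.Axioms)
    (hS : ∀ b : Q.Bg, Nonempty (Q.State b)) (i : Q.Label) :
    Q.parity i = Q.parity (Q.star i) := by
  open OPEQFT OPESystem in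
  by_contra hne
  have hi : i ≠ Q.one := by
    rintro rfl
    exact hne (by rw [Q.star_one])
  obtain ⟨γ, hγ0, hγ1, hγ⟩ := exists_dim_gap hQ
  obtain ⟨b, y, hsd⟩ := hQ.dim_attained i
  obtain ⟨ψ⟩ := hS b
  let κ : OpenPartialHomeomorph (Q.Pt b) (Vec D) := chartAt (Vec D) y
  have hκ : (Q.st b).IsChart κ := IsManifold.chart_mem_maximalAtlas y
  have hy : y ∈ κ.source := mem_chart_source _ y
  obtain ⟨P, ⟨r, F, s, hF, hs, hP⟩, hlim⟩ :=
    hQ.asymptotic_positivity i b y hsd κ hκ hy (γ / 8) (by positivity)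
  let p : Fin r → ProductProfile (Q.V b) := fun k ↦ ⟨i, F k, s k, (hF k).1, (hF k).2, hs k⟩
  let p' : Fin r → ProductProfile (Q.V b) := fun k ↦ ⟨Q.star i, fun w ↦ starRingEnd ℂ (F k w),
    Q.conjSec b i (s k), Complex.conjCLE.contDiff.comp (hF k).1,
    (hF k).2.comp_left (map_zero (starRingEnd ℂ)), Q.conj_smooth b i _ (hs k)⟩
  have hd := dim_star hQ i
  have hdi := hγ i hi
  -- The exponent `8 dim i - γ / 2` leaves room for the bounds `8 dim i - γ` and `8 dim i - 1`; it is
  -- quartered by the square root and the change of scale `lam = ε²`.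
  have hterm : ∀ k k', Tendsto (fun lam : ℝ ↦ lam ^ (2 * Q.dim i - γ / 8) *
      ‖Q.unit b y (Q.coef b [(p k).conc κ lam (κ y), (p' k').conc κ lam (κ y)] Q.one y)‖)
      (𝓝[>] 0) (𝓝 0) := by
    intro k k'
    have := tendsto_pairValue_of_parity_ne hD hQ hκ hy ψ (p k) (p' k') hne
      (ρ := 8 * Q.dim i - γ / 2) hγ (by simp only [p, p', hd]; linarith)
      (by simp only [p, p', hd]; linarith) (by linarith)
    rwa [show (8 * Q.dim i - γ / 2) / 4 = 2 * Q.dim i - γ / 8 by ring] at this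
  have hsum := tendsto_finsetSum Finset.univ fun k _ ↦
    tendsto_finsetSum Finset.univ fun k' _ ↦ hterm k k'
  simp only [Finset.sum_const_zero] at hsum
  obtain ⟨U, hUo, hyU, hU, -⟩ := hQ.coef_distribution b [i, Q.star i] Q.one y
  have hUn := hUo.mem_nhds hyU
  refine not_tendsto_nhds_of_tendsto_atTop hlim 0 (squeeze_zero' ?_ ?_ hsum)
  · filter_upwards [eventually_mem_nhdsWithin] with lam hl
    exact mul_nonneg (Real.rpow_nonneg (le_of_lt hl) _) (norm_nonneg _)
  · filter_upwards [eventually_mem_nhdsWithin,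
      eventually_all.2 fun k ↦ eventually_isTest_concFactor hκ hy (hF k).1 (hF k).2 (hs k) hUn,
      eventually_all.2 fun k ↦ eventually_isTest_concFactor hκ hy (p' k).contDiff (p' k).compact
        (p' k).smooth hUn] with lam hl ht ht'
    have hexp : Q.coef b [⟨i, (Q.V b i).scaled κ lam (κ y) P⟩,
        ⟨Q.star i, Q.conjSec b i ((Q.V b i).scaled κ lam (κ y) P)⟩] Q.one y =
        ∑ k, ∑ k', Q.coef b [(p k).conc κ lam (κ y), (p' k').conc κ lam (κ y)] Q.one y := by
      rw [conjSec_scaled_eq_sum Q b i κ lam (κ y) hP, scaled_eq_sum (Q.V b i) κ lam (κ y) hP]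
      exact (hU y hyU).map_sum_sum _ _ (fun k _ ↦ ht k) (fun k _ ↦ ht' k)
    rw [hexp]
    simp_rw [← Finset.mul_sum, map_sum]
    exact mul_le_mul_of_nonneg_left ((norm_sum_le _ _).trans (Finset.sum_le_sum fun k _ ↦
      norm_sum_le _ _)) (Real.rpow_nonneg (le_of_lt hl) _)
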